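/- Let $\mathbb K$ be $\mathbb R$ or $\mathbb C$ and let $d\ge 2$. For $g\in\mathrm{SL}(d,\mathbb K)$ let $\lambda_1(g)\ge\dots\ge\lambda_d(g)$ be the absolute values of its (complex) eigenvalues and $\mu_1(g)\ge\dots\ge\mu_d(g)$ its singular values, and, when $\mu_k(g)>\mu_{k+1}(g)$, let $U_k(g)$ be the span of the $k$ largest axes of the ellipsoid $g\cdot\{\|x\|_2=1\}$. Call $g$ *$\mathsf P_1$-proximal* if $\lambda_1(g)>\lambda_2(g)$; then $\ell_g^+$ denotes the eigenline for the eigenvalue of absolute value $\lambda_1(g)$ and $H_g^-$ the unique $g$-invariant hyperplane with $\ell_g^+\oplus H_g^-=\mathbb K^d$. Call $g$ *$\mathsf P_1$-biproximal* if $g$ and $g^{-1}$ are both $\mathsf P_1$-proximal; then put $\ell_g^-=\ell_{g^{-1}}^+$, $H_g^+=H_{g^{-1}}^-$, $F_g^{\pm}=(\ell_g^\pm,H_g^\pm)$. Two flags $F=(F^1\subset F^{d-1})$ and $G=(G^1\subset G^{d-1})$ (with $\dim F^j=\dim G^j=j$) are *transverse* if $F^1\oplus G^{d-1}=\mathbb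 K^d=G^1\oplus F^{d-1}$. A subgroup $U\le\mathrm{SL}(d,\mathbb K)$ is *weakly unipotent* if $\lambda_j(u)=1$ for all $u\in U$ and all $j$. A discrete subgroup $U$ is *$\mathsf P_1$-divergent* if $\frac{\mu_1}{\mu_2}(u_n)\to\infty$ for every sequence $(u_n)$ in $U$ that leaves every finite subset (an escaping sequence); its *limit set* $\Lambda_{1,d-1}(U)$ is then the set of all flags $F=(F^1\subset F^{d-1})$ of the form $F=\lim (U_1(u_n),U_{d-1}(u_n))$ with $(u_n)$ an escaping sequence in $U$. For a finitely generated group $\Gamma$ and a finite set $\mathcal P$ of finitely generated infinite subgroups, $(\Gamma,\mathcal P)$ is *relatively hyperbolic* with *Bowditch boundary* $\partial(\Gamma,\mathcal P)$ if $\Gamma$ acts on the non-empty compact perfect metrizable space $\partial(\Gamma,\mathcal P)$ as a geometrically finite convergence group whose maximal parabolic subgroups are exactly the conjugates of the members of $\mathcal P$. (This space is unique up to equivariant homeomorphism.) A homomorphism $\rho\colon\Gamma\to\mathrm{SL}(d,\mathbb K)$ is *$\mathsf P_1$-Anosov relative to $\mathcal P$* if $(\Gamma,\mathcal P)$ is relatively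 hyperbolic and there is a continuous $\rho$-equivariant map $\xi=(\xi^1,\xi^{d-1})\colon\partial(\Gamma,\mathcal P)\to\mathrm{Gr}_1(\mathbb K^d)\times\mathrm{Gr}_{d-1}(\mathbb K^d)$ such that $\xi^1(x)\oplus\xi^{d-1}(y)=\mathbb K^d$ for all $x\ne y$, and such that, whenever $\gamma_n\to x$ and $\gamma_n^{-1}\to y$ in $\Gamma\sqcup\partial(\Gamma,\mathcal P)$, one has $\rho(\gamma_n)V\to\xi^1(x)$ for every line $V$ with $V\oplus\xi^{d-1}(y)=\mathbb K^d$. **Proposition.** Suppose that $\gamma\in\mathrm{SL}(d,\mathbb K)$ is $\mathsf P_1$-biproximal, that $U\le\mathrm{SL}(d,\mathbb K)$ is a discrete, weakly unipotent, $\mathsf P_1$-divergent group whose limit set $\Lambda_{1,d-1}(U)=\{F_U\}$ is a single flag, and that $F_U$ is transverse to both $F_\gamma^+$ and $F_\gamma^-$. Then there exist $N\ge 1$ and a finite-index subgroup $U'\le U$ such that the group $\Gamma$ generated by $\gamma^N$ and $U'$ is naturally isomorphic to the free product $\langle\gamma^N\rangle * U'$ (the homomorphism $\langle\gamma^N\rangle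 * U'\to\Gamma$ extending the two inclusions is an isomorphism), and the inclusion $\Gamma\hookrightarrow\mathrm{SL}(d,\mathbb K)$ is $\mathsf P_1$-Anosov relative to $\{U'\}$. -/

import Mathlib

open Filter Topology

namespace RelAnosov

noncomputable section

/-! ## Convergence group actions and relatively hyperbolic groups

Throughout, `Γ` is a discrete group acting on a topological space `M`. -/

section Convergence

variable {Γ : Type*} [Group Γ] {M : Type*} [TopologicalSpace M] [MulAction Γ M]

/-- A sequence in a discrete group is escaping if it leaves every finite (= compact) subset. -/
def Escaping {G : Type*} (g : ℕ → G) : Prop := Tendsto g atTop cofinite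

/-- `g n` restricted to `M ∖ {y}` converges locally uniformly (that is, uniformly on compact sets,
`M` being locally compact) to the constant map with value `x`. -/
def ConvergesOffPoint (g : ℕ → Γ) (x y : M) : Prop :=
  ∀ K : Set M, IsCompact K → y ∉ K → ∀ V ∈ 𝓝 x, ∀ᶠ n in atTop, ∀ z ∈ K, g n • z ∈ V

variable (Γ M) in
/-- `Γ` acts on `M` (by homeomorphisms) as a convergence group. -/
def IsConvergenceAction : Prop :=
  ContinuousConstSMul Γ M ∧
    ∀ g : ℕ → Γ, Function.Injective g →
      ∃ φ : ℕ → ℕ, StrictMono φ ∧ ∃ x y : M, ConvergesOffPoint (g ∘ φ) x y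

/-- Convergence `g n → x` of a sequence of group elements to a point of `M` in the compactification
`Γ ⊔ M` determined by a convergence action: every subsequence has a further subsequence with
attracting point `x`. -/
def ConvergesToPoint (g : ℕ → Γ) (x : M) : Prop :=
  Escaping g ∧ ∀ φ : ℕ → ℕ, StrictMono φ →
    ∃ ψ : ℕ → ℕ, StrictMono ψ ∧ ∃ y : M, ConvergesOffPoint (g ∘ φ ∘ ψ) x y

variable (M) in
/-- A loxodromic element: infinite order and exactly two fixed points. -/
def IsLoxodromic (g : Γ) : Prop :=
  ¬ IsOfFinOrder g ∧ (MulAction.fixedBy M g).ncard = 2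

variable (M) in
/-- A parabolic subgroup: infinite, fixing some point, and without loxodromic elements. -/
def IsParabolicSubgroup (H : Subgroup Γ) : Prop :=
  Infinite H ∧ (∃ p : M, ∀ h ∈ H, h • p = p) ∧ ∀ h ∈ H, ¬ IsLoxodromic M h

variable (Γ) in
/-- Conical limit points. -/
def IsConicalLimitPoint (x : M) : Prop :=
  ∃ (g : ℕ → Γ) (a b : M), a ≠ b ∧ Tendsto (fun n => g n • x) atTop (𝓝 a) ∧
    ∀ y : M, y ≠ x → Tendsto (fun n => g n • y) atTop (𝓝 b)

variable (Γ) in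
/-- Bounded parabolic points: the stabilizer is parabolic and acts cocompactly on `M ∖ {p}`. -/
def IsBoundedParabolicPoint (p : M) : Prop :=
  IsParabolicSubgroup M (MulAction.stabilizer Γ p) ∧
    ∃ K : Set M, IsCompact K ∧ p ∉ K ∧
      ∀ z : M, z ≠ p → ∃ g ∈ MulAction.stabilizer Γ p, g • z ∈ K

variable (Γ M) in
/-- A geometrically finite convergence action. -/
def IsGeometricallyFiniteAction : Prop :=
  IsConvergenceAction Γ M ∧ ∀ x : M, IsConicalLimitPoint Γ x ∨ IsBoundedParabolicPoint Γ x

variable (M) in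
/-- `M`, with its action of `Γ`, is a Bowditch boundary `∂(Γ, Ps)`: a compact, perfect, metrizable
space on which `Γ` acts as a geometrically finite convergence group whose maximal parabolic
subgroups are exactly the conjugates of the members of `Ps`. -/
structure IsBowditchBoundary (Ps : Set (Subgroup Γ)) : Prop where
  nonempty : Nonempty M
  compact : CompactSpace M
  metrizable : TopologicalSpace.MetrizableSpace M
  perfect : PerfectSpace M
  geometricallyFinite : IsGeometricallyFiniteAction Γ M
  maximalParabolic : ∀ H : Subgroup Γ, Maximal (IsParabolicSubgroup M) H ↔
    ∃ P ∈ Ps, ∃ g : Γ, H = P.map (MulAut.conj g).toMonoidHom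

/-- The standing finiteness assumptions on a group with a family of peripheral subgroups. -/
structure IsPeripheralFamily (Ps : Set (Subgroup Γ)) : Prop where
  fg : Group.FG Γ
  finite : Ps.Finite
  peripheral_fg : ∀ P ∈ Ps, P.FG
  peripheral_infinite : ∀ P ∈ Ps, Infinite P

end Convergence

/-! ## Subspaces of `K^d`, singular values, eigenvalues -/

section Linear

variable {K : Type*} [RCLike K] {d : ℕ}

variable (K d) in
/-- The linear subspaces of `K^d`, with its standard inner product. -/
abbrev Subspaces := Submodule K (EuclideanSpace K (Fin d))

/-- The usual topology on subspaces (`V n → V` iff the orthogonal projections converge); it is the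
disjoint union of the usual topologies of the Grassmannians `Gr_k(K^d)`. -/
instance subspacesTopology : TopologicalSpace (Subspaces K d) :=
  TopologicalSpace.induced (fun V => V.starProjection) inferInstance

/-- The linear map of `K^d` given by `g ∈ SL(d, K)`. -/
def toLin (g : Matrix.SpecialLinearGroup (Fin d) K) :
    EuclideanSpace K (Fin d) →ₗ[K] EuclideanSpace K (Fin d) :=
  Matrix.toEuclideanLin (g : Matrix (Fin d) (Fin d) K)

/-- The action of `SL(d, K)` on subspaces. -/
def act (g : Matrix.SpecialLinearGroup (Fin d) K) (V : Subspaces K d) : Subspaces K d :=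
  V.map (toLin g)

/-- The singular values `μ_1(g) ≥ … ≥ μ_d(g)`, indexed from `1`. -/
def singVal (j : ℕ) (g : Matrix.SpecialLinearGroup (Fin d) K) : ℝ :=
  (toLin g).singularValues (j - 1)

/-- The subspace `U_k(g)` spanned by the `k` largest axes of the ellipsoid `g · {‖x‖ = 1}`, i.e. by
the eigenvectors of `g g*` with eigenvalues at least `μ_k(g)²`. It has dimension `k` when
`μ_k(g) > μ_{k+1}(g)`, which is the only case in which it is meaningful. -/
def axes (k : ℕ) (g : Matrix.SpecialLinearGroup (Fin d) K) : Subspaces K d :=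
  ⨆ (t : ℝ) (_ : singVal k g ^ 2 ≤ t),
    Module.End.eigenspace (toLin g ∘ₗ LinearMap.adjoint (toLin g)) (t : K)

/-- The complex eigenvalues of `g`, with algebraic multiplicity. -/
def complexEigenvalues (g : Matrix.SpecialLinearGroup (Fin d) K) : Multiset ℂ :=
  ((g : Matrix (Fin d) (Fin d) K).map (RCLike.map K ℂ)).charpoly.roots

/-- The absolute values `λ_1(g) ≥ … ≥ λ_d(g)` of the eigenvalues, indexed from `1`. -/
def eigMod (j : ℕ) (g : Matrix.SpecialLinearGroup (Fin d) K) : ℝ :=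
  (((complexEigenvalues g).map (fun z => ‖z‖)).sort (· ≥ ·)).getD (j - 1) 0

/-- `P_k`-proximal elements. -/
def IsProximal (k : ℕ) (g : Matrix.SpecialLinearGroup (Fin d) K) : Prop :=
  eigMod (k + 1) g < eigMod k g

/-- `P_k`-biproximal elements. -/
def IsBiproximal (k : ℕ) (g : Matrix.SpecialLinearGroup (Fin d) K) : Prop :=
  IsProximal k g ∧ IsProximal k g⁻¹

/-- Weakly unipotent elements: all eigenvalues have absolute value `1`. -/
def IsWeaklyUnipotent (g : Matrix.SpecialLinearGroup (Fin d) K) : Prop :=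
  ∀ j : ℕ, 1 ≤ j → j ≤ d → eigMod j g = 1

/-- `ℓ_g^+`: the eigenline of a `P_1`-proximal element for the eigenvalue of absolute value
`λ_1(g)`. (Of the scalars with this absolute value exactly one is an eigenvalue of `g`; the
eigenspaces of the others vanish.) -/
def attractingLine (g : Matrix.SpecialLinearGroup (Fin d) K) : Subspaces K d :=
  ⨆ (c : K) (_ : ‖c‖ = eigMod 1 g), Module.End.eigenspace (toLin g) c

/-- `H_g^-`: the unique `g`-invariant subspace `H` with `ℓ_g^+ ⊕ H = K^d`, for `P_1`-proximal `g`.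
(As there is exactly one such `H`, the supremum is `H` itself.) -/
def repellingHyperplane (g : Matrix.SpecialLinearGroup (Fin d) K) : Subspaces K d :=
  sSup {H | act g H ≤ H ∧ IsCompl (attractingLine g) H}

/-- `F_g^+ = (ℓ_g^+, H_g^+)` with `H_g^+ = H_{g⁻¹}^-`, for `P_1`-biproximal `g`. The flag
`F_g^- = (ℓ_g^-, H_g^-)`, where `ℓ_g^- = ℓ_{g⁻¹}^+`, is `attractingFlag g⁻¹`. -/
def attractingFlag (g : Matrix.SpecialLinearGroup (Fin d) K) : Subspaces K d × Subspaces K d :=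
  (attractingLine g, repellingHyperplane g⁻¹)

variable (K d) in
/-- The space of partial flags `F^k ⊆ F^{d-k} ⊆ K^d`. -/
def flags (k : ℕ) : Set (Subspaces K d × Subspaces K d) :=
  {F | Module.finrank K F.1 = k ∧ Module.finrank K F.2 = d - k ∧ F.1 ≤ F.2}

/-- Transverse flags. -/
def Transverse (F G : Subspaces K d × Subspaces K d) : Prop :=
  IsCompl F.1 G.2 ∧ IsCompl G.1 F.2

/-- `P_k`-divergent (discrete) subgroups. -/
def IsDivergent (k : ℕ) (Γ : Subgroup (Matrix.SpecialLinearGroup (Fin d) K)) : Prop :=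
  ∀ g : ℕ → Γ, Escaping g →
    Tendsto (fun n => singVal k (g n : Matrix.SpecialLinearGroup (Fin d) K) /
      singVal (k + 1) (g n : Matrix.SpecialLinearGroup (Fin d) K)) atTop atTop

/-- The limit set `Λ_{k,d-k}(Γ)` of a `P_k`-divergent (discrete) subgroup. -/
def limitSet (k : ℕ) (Γ : Subgroup (Matrix.SpecialLinearGroup (Fin d) K)) :
    Set (Subspaces K d × Subspaces K d) :=
  {F | F ∈ flags K d k ∧ ∃ g : ℕ → Γ, Escaping g ∧
    Tendsto (fun n => (axes k (g n : Matrix.SpecialLinearGroup (Fin d) K),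
      axes (d - k) (g n : Matrix.SpecialLinearGroup (Fin d) K))) atTop (𝓝 F)}

/-! ## Relatively Anosov representations -/

variable {Γ : Type*} [Group Γ]

/-- `ξ = (ξ^k, ξ^{d-k}) : M → Gr_k(K^d) × Gr_{d-k}(K^d)` is continuous, `ρ`-equivariant, transverse
and strongly dynamics preserving. -/
structure IsAnosovBoundaryMap {M : Type*} [TopologicalSpace M] [MulAction Γ M] (k : ℕ)
    (ρ : Γ →* Matrix.SpecialLinearGroup (Fin d) K) (ξ : M → Subspaces K d × Subspaces K d) :
    Prop where
  finrank_fst : ∀ x, Module.finrank K (ξ x).1 = k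
  finrank_snd : ∀ x, Module.finrank K (ξ x).2 = d - k
  continuous : Continuous ξ
  equivariant : ∀ (g : Γ) (x : M), ξ (g • x) = (act (ρ g) (ξ x).1, act (ρ g) (ξ x).2)
  transverse : ∀ x y : M, x ≠ y → IsCompl (ξ x).1 (ξ y).2
  stronglyDynamicsPreserving : ∀ (g : ℕ → Γ) (x y : M),
    ConvergesToPoint g x → ConvergesToPoint (fun n => (g n)⁻¹) y →
      ∀ V : Subspaces K d, Module.finrank K V = k → IsCompl V (ξ y).2 →
        Tendsto (fun n => act (ρ (g n)) V) atTop (𝓝 (ξ x).1)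

/-- `(Γ, Ps)` is relatively hyperbolic and `ρ` is `P_k`-Anosov relative to `Ps`. The Bowditch boundary
`M = ∂(Γ, Ps)` exists exactly when `(Γ, Ps)` is relatively hyperbolic, and it is unique up to
`Γ`-equivariant homeomorphism, so it does not matter which model carries the boundary map; being
compact and metrizable it always has a model in `Type`. -/
def IsAnosovRelativeTo (k : ℕ) (Ps : Set (Subgroup Γ))
    (ρ : Γ →* Matrix.SpecialLinearGroup (Fin d) K) : Prop :=
  IsPeripheralFamily Ps ∧
    ∃ (M : Type) (_ : TopologicalSpace M) (_ : MulAction Γ M), IsBowditchBoundary M Ps ∧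
      ∃ ξ : M → Subspaces K d × Subspaces K d, IsAnosovBoundaryMap k ρ ξ

end Linear

end

end RelAnosov

open RelAnosov

/-!
The flags of the statement are encoded as pairs of lines (`FlagPair`): the line of the flag and the
normal line of its hyperplane. On these, `SL(d, K)` acts through `g` and its contragredient, and
transversality becomes an open condition on pairs (`FlagPair.Opp`). All dynamics is expressed by
`Dyn g x y`: suitable multiples of `g n` and of `(g n)⁻¹` converge to maps of rank one with images and
kernels prescribed by `x` and `y`. Then `g n` converges to `x`, and contracts ever more strongly, on
compact sets of flags transverse to `y`.

Powers of `γ` have these dynamics from `F_γ⁻` to `F_γ⁺` because multiples of `γ ^ n` converge to the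
projection onto the dominant eigenline (`exists_rankOneLimit_pow`). Escaping sequences of `U` have a
subsequence with these dynamics from `F_U` to `F_U`: in a singular value decomposition the gaps grow, and
every limit of the axes is `F_U` (`exists_dyn_of_escaping`). So in small balls around the three
pairwise transverse flags, the nontrivial powers of `γ ^ N` for large `N` and all but finitely many
elements of `U` play contracting ping-pong (`pingPong_factors`).

To remove the finitely many exceptions in `U` by a subgroup of finite index, `U` must be residually
finite, which holds for finitely generated linear groups by Malcev's argument
(`residuallyFinite_of_fg`). Finite generation, which relative hyperbolicity also demands, is where
weak unipotence enters (`fg_of_weaklyUnipotent`). Bounded traces give a block triangular form whose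
diagonal blocks are bounded (`exists_blocks`). By discreteness, elements with diagonal part close to
`1` generate a nilpotent subgroup of finite index: their iterated commutators become trivial after
conjugation by a large scaling, and boundedness rules out Jordan blocks of the conjugation action
(`fg_of_triangular`). This reduces finite generation to that of discrete abelian groups, where the
exponential map gives a lattice (`fg_of_discrete_commutative`).

Contracting ping-pong then yields everything at once, since all but finitely many reduced words
contract by a given factor (`PingPong.finite_word`). Reduced words are nontrivial, so the group is a
free product (`exists_coprod_mulEquiv`). Distinct points of its limit set are transverse
(`PingPong.opp_of_ne`) and escaping sequences subconverge in the sense of `Dyn` (`PingPong.exists_dyn`), so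
the action on the limit set is a convergence action. Its points are conical, by the expansion of the
inverse prefixes of an infinite word, or translates of `F_U`, which is bounded parabolic with
stabilizer `U'` (`ParabolicPingPong.isBowditchBoundary`). The two components of a flag give the boundary
map (`LimitModel.isAnosovBoundaryMap`).
-/

namespace RelAnosov

noncomputable section

/-! ### Lines in a Euclidean space -/

section Lines

variable {K : Type*} [RCLike K] {d : ℕ}

local notation "𝔼" => EuclideanSpace K (Fin d)

variable (K d) in
/-- The projective space of lines in `K^d`, with the metric `‖P_V - P_W‖` given by the orthogonal
projections. -/
def Line : Type _ := {V : Subspaces K d // Module.finrank K V = 1}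

lemma continuous_rankOne_self :
    Continuous (fun x : 𝔼 => InnerProductSpace.rankOne K x x) := by
  rw [continuous_clm_apply]
  intro y
  simp only [InnerProductSpace.rankOne_apply]
  fun_prop

namespace Line

/-- The orthogonal projection onto a line. -/
def proj (V : Line K d) : 𝔼 →L[K] 𝔼 := V.1.starProjection

lemma proj_injective : Function.Injective (proj : Line K d → _) := by
  intro V W h
  apply Subtype.ext
  ext v
  rw [← Submodule.starProjection_eq_self_iff, ← Submodule.starProjection_eq_self_iff]
  change V.proj v = v ↔ W.proj v = v
  rw [h]

instance : MetricSpace (Line K d) := MetricSpace.induced proj proj_injective inferInstance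

lemma dist_eq (V W : Line K d) : dist V W = ‖V.proj - W.proj‖ := by
  change dist V.proj W.proj = _
  rw [dist_eq_norm]

lemma isInducing_proj : IsInducing (proj : Line K d → _) := ⟨rfl⟩

lemma continuous_proj : Continuous (proj : Line K d → _) := isInducing_proj.continuous

lemma continuous_val : Continuous (fun V : Line K d => (V.1 : Subspaces K d)) :=
  continuous_induced_rng.2 continuous_proj

lemma continuous_orthogonal : Continuous (fun V : Line K d => (V.1ᗮ : Subspaces K d)) := by
  refine continuous_induced_rng.2 ?_
  have : (fun V : Subspaces K d => V.starProjection) ∘ (fun V : Line K d => V.1ᗮ) =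
      fun V => ContinuousLinearMap.id K 𝔼 - V.proj := by
    funext V
    simp [proj, Submodule.starProjection_orthogonal]
  rw [this]
  exact continuous_const.sub continuous_proj

/-- The line spanned by a nonzero vector. -/
def mk (v : 𝔼) (hv : v ≠ 0) : Line K d := ⟨K ∙ v, finrank_span_singleton hv⟩

lemma exists_mem (V : Line K d) : ∃ v : 𝔼, v ≠ 0 ∧ v ∈ V.1 ∧ ∀ w ∈ V.1, ∃ c : K, w = c • v := by
  obtain ⟨v, hv, h⟩ := finrank_eq_one_iff'.1 V.2
  refine ⟨v, fun h0 => hv (Subtype.ext h0), v.2, fun w hw => ?_⟩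
  obtain ⟨c, hc⟩ := h ⟨w, hw⟩
  exact ⟨c, by rw [← Submodule.coe_smul, hc]⟩

lemma exists_unit (V : Line K d) :
    ∃ v : 𝔼, ‖v‖ = 1 ∧ v ∈ V.1 ∧ ∀ w ∈ V.1, ∃ c : K, w = c • v := by
  obtain ⟨v, hv, hm, h⟩ := V.exists_mem
  have hn : (‖v‖ : K) ≠ 0 := by simpa using hv
  refine ⟨(‖v‖ : K)⁻¹ • v, ?_, V.1.smul_mem _ hm, fun w hw => ?_⟩
  · rw [norm_smul, norm_inv, RCLike.norm_ofReal, abs_norm, inv_mul_cancel₀ (norm_ne_zero_iff.2 hv)]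
  · obtain ⟨c, rfl⟩ := h w hw
    exact ⟨c * ‖v‖, by rw [smul_smul, mul_assoc, mul_inv_cancel₀ hn, mul_one]⟩

lemma eq_mk {V : Line K d} {v : 𝔼} (hv : v ≠ 0) (h : v ∈ V.1) : V = mk v hv := by
  obtain ⟨w, hw, hm, hs⟩ := V.exists_mem
  apply Subtype.ext
  change V.1 = K ∙ v
  apply le_antisymm
  · intro x hx
    obtain ⟨c, rfl⟩ := hs x hx
    obtain ⟨a, rfl⟩ := hs v h
    have ha : a ≠ 0 := by rintro rfl; simp at hv
    rw [Submodule.mem_span_singleton]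
    exact ⟨c * a⁻¹, by rw [smul_smul, mul_assoc, inv_mul_cancel₀ ha, mul_one]⟩
  · rwa [Submodule.span_singleton_le_iff_mem]

lemma mem_mk {v : 𝔼} (hv : v ≠ 0) : v ∈ (mk v hv).1 := Submodule.mem_span_singleton_self v

lemma proj_mk {v : 𝔼} (hv : v ≠ 0) :
    (mk v hv).proj = ((‖v‖ : K) ^ 2)⁻¹ • InnerProductSpace.rankOne K v v := by
  ext1 w
  change (K ∙ v).starProjection w = _
  rw [Submodule.starProjection_singleton]
  simp [InnerProductSpace.rankOne_apply, smul_smul, div_eq_inv_mul]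

lemma proj_mem (V : Line K d) (v : 𝔼) : V.proj v ∈ V.1 := Submodule.starProjection_apply_mem _ _

lemma proj_eq_self {V : Line K d} {v : 𝔼} : V.proj v = v ↔ v ∈ V.1 :=
  Submodule.starProjection_eq_self_iff

lemma tendsto_mk {ι : Type*} {l : Filter ι} {v : ι → 𝔼} {V : ι → Line K d} {w : 𝔼} {W : Line K d}
    (hv : ∀ i, v i ∈ (V i).1) (hw : w ∈ W.1) (hw0 : w ≠ 0) (h : Tendsto v l (𝓝 w)) :
    Tendsto V l (𝓝 W) := by
  rw [isInducing_proj.tendsto_nhds_iff]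
  have h0 : ∀ᶠ i in l, v i ≠ 0 := h.eventually_ne hw0
  have h1 : Tendsto (fun i => ((‖v i‖ : K) ^ 2)⁻¹ • InnerProductSpace.rankOne K (v i) (v i)) l
      (𝓝 (((‖w‖ : K) ^ 2)⁻¹ • InnerProductSpace.rankOne K w w)) := by
    refine Tendsto.smul ?_ ?_
    · refine Tendsto.inv₀ ?_ (by simpa using hw0)
      exact (((RCLike.continuous_ofReal (K := K)).tendsto _).comp h.norm).pow 2
    · have : Continuous (fun x : 𝔼 => InnerProductSpace.rankOne K x x) :=
      continuous_rankOne_self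
      exact (this.tendsto w).comp h
  rw [eq_mk hw0 hw, proj_mk]
  refine h1.congr' ?_
  filter_upwards [h0] with i hi
  rw [Function.comp, eq_mk hi (hv i), proj_mk]

instance : CompactSpace (Line K d) := by
  constructor
  rw [isInducing_proj.isCompact_iff]
  have : proj '' (Set.univ : Set (Line K d)) =
      (fun v : 𝔼 => InnerProductSpace.rankOne K v v) '' Metric.sphere 0 1 := by
    ext T
    constructor
    · rintro ⟨V, -, rfl⟩
      obtain ⟨v, hv, hm, -⟩ := V.exists_unit
      have hv0 : v ≠ 0 := by rintro rfl; simp at hv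
      refine ⟨v, by simpa using hv, ?_⟩
      rw [eq_mk hv0 hm, proj_mk, hv]; simp
    · rintro ⟨v, hv, rfl⟩
      have hv : ‖v‖ = 1 := by simpa using hv
      have hv0 : v ≠ 0 := by rintro rfl; simp at hv
      refine ⟨mk v hv0, trivial, ?_⟩
      rw [proj_mk, hv]; simp
  rw [this]
  exact (isCompact_sphere _ _).image continuous_rankOne_self

/-- The defect of a unit vector of one line from another line is bounded by their distance. -/
lemma norm_sub_proj_le {V W : Line K d} {x : 𝔼} (hx : x ∈ V.1) :
    ‖x - W.proj x‖ ≤ dist V W * ‖x‖ := by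
  rw [dist_eq]
  calc ‖x - W.proj x‖ = ‖(V.proj - W.proj) x‖ := by
        rw [_root_.sub_apply, proj_eq_self.2 hx]
    _ ≤ _ := ContinuousLinearMap.le_opNorm _ _

lemma inner_proj_left (V : Line K d) (x y : 𝔼) : inner K (V.proj x) y = inner K x (V.proj y) :=
  Submodule.starProjection_isSymmetric V.1 x y

lemma proj_apply_unit {V : Line K d} {v : 𝔼} (hv : ‖v‖ = 1) (hm : v ∈ V.1) (x : 𝔼) :
    V.proj x = (inner K v x) • v := by
  have hv0 : v ≠ 0 := by rintro rfl; simp at hv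
  rw [eq_mk hv0 hm, proj_mk, hv]
  simp

/-- A bound of the distance of two lines by the defect of one unit vector. -/
lemma dist_le_two_mul {V W : Line K d} {x : 𝔼} (hx : ‖x‖ = 1) (hm : x ∈ V.1) :
    dist V W ≤ 2 * ‖x - W.proj x‖ := by
  obtain ⟨y, hy, hym, -⟩ := W.exists_unit
  rw [dist_eq]
  set s := ‖x - W.proj x‖ with hs
  have hPW : ∀ w, W.proj (W.proj w) = W.proj w := fun w => proj_eq_self.2 (W.proj_mem w)
  -- the square of the defect is symmetric in the two lines
  have key : ∀ (a b : 𝔼) (c : K), ‖a‖ = 1 → ‖b‖ = 1 → c = inner K b a →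
      ‖a - c • b‖ ^ 2 = 1 - ‖inner K b a‖ ^ 2 := by
    intro a b c ha hb hc
    rw [@norm_sub_sq K, ha, norm_smul, hb, inner_smul_right, hc, ← inner_conj_symm a b,
      RCLike.mul_conj]
    norm_cast
    simp
    ring
  have e1 : s ^ 2 = 1 - ‖inner K y x‖ ^ 2 := by
    rw [hs, proj_apply_unit hy hym]; exact key x y _ hx hy rfl
  have e2 : ‖y - V.proj y‖ ^ 2 = 1 - ‖inner K x y‖ ^ 2 := by
    rw [proj_apply_unit hx hm]; exact key y x _ hy hx rfl
  have e3 : ‖y - V.proj y‖ = s := by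
    have : ‖y - V.proj y‖ ^ 2 = s ^ 2 := by rw [e1, e2, norm_inner_symm]
    exact (pow_left_inj₀ (norm_nonneg _) (norm_nonneg _) two_ne_zero).1 this
  refine ContinuousLinearMap.opNorm_le_bound _ (by positivity) fun z => ?_
  have h1 : (V.proj - W.proj) z = V.proj (z - W.proj z) - (W.proj z - V.proj (W.proj z)) := by
    simp
  have h2 : ‖V.proj (z - W.proj z)‖ ≤ s * ‖z‖ := by
    rw [proj_apply_unit hx hm, norm_smul, hx, mul_one]
    have : inner K x (z - W.proj z) = inner K (x - W.proj x) z := by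
      rw [inner_sub_right, inner_sub_left, inner_proj_left]
    rw [this]
    exact norm_inner_le_norm _ _
  have h3 : ‖W.proj z - V.proj (W.proj z)‖ ≤ s * ‖z‖ := by
    rw [proj_apply_unit hy hym z, map_smul, ← smul_sub, norm_smul, e3, mul_comm]
    gcongr
    simpa [hy] using norm_inner_le_norm (𝕜 := K) y z
  rw [h1]
  calc _ ≤ _ := norm_sub_le _ _
    _ ≤ _ := by linarith

end Line

end Lines

end

end RelAnosov

namespace RelAnosov

noncomputable section

/-! ### The action of `SL(d, K)` on lines and on pairs of lines -/

section Action

variable {K : Type*} [RCLike K] {d : ℕ}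

local notation "𝔼" => EuclideanSpace K (Fin d)
local notation "SL" => Matrix.SpecialLinearGroup (Fin d) K

lemma tendsto_clm_apply {ι : Type*} {l : Filter ι} {A : ι → 𝔼 →L[K] 𝔼} {v : ι → 𝔼}
    {T : 𝔼 →L[K] 𝔼} {w : 𝔼} (hA : Tendsto A l (𝓝 T)) (hv : Tendsto v l (𝓝 w)) :
    Tendsto (fun i => A i (v i)) l (𝓝 (T w)) :=
  ((isBoundedBilinearMap_apply (𝕜 := K) (E := 𝔼) (F := 𝔼)).continuous.tendsto (T, w)).comp
    (hA.prodMk_nhds hv)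

lemma toLin_mul (g h : SL) : toLin (g * h) = toLin g ∘ₗ toLin h := by
  ext1 v
  simp [toLin, Matrix.toLpLin_apply, Matrix.mulVec_mulVec]

lemma toLin_one : toLin (1 : SL) = LinearMap.id := by
  ext1 v
  simp [toLin]

variable (K d) in
/-- The action of `SL(d, K)` on `K^d` by continuous linear maps. -/
def cl : SL →* (𝔼 →L[K] 𝔼) where
  toFun g := LinearMap.toContinuousLinearMap (toLin g)
  map_one' := by ext1 v; simp [toLin_one]
  map_mul' g h := by ext1 v; simp [toLin_mul]

@[simp] lemma cl_apply (g : SL) (v : 𝔼) : cl K d g v = toLin g v := rfl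

lemma cl_inv_cl (g : SL) (v : 𝔼) : cl K d g⁻¹ (cl K d g v) = v := by
  rw [← mul_apply_eq_comp, ← map_mul, inv_mul_cancel, map_one,
    one_apply_eq_self]

lemma cl_injective (g : SL) : Function.Injective (cl K d g) :=
  Function.LeftInverse.injective (cl_inv_cl g)

variable (K d) in
/-- The automorphism `g ↦ (g*)⁻¹` of `SL(d, K)`; it gives the action on hyperplanes in terms of
their normal lines. -/
def dual : SL →* SL where
  toFun g := ⟨((g⁻¹ : SL) : Matrix (Fin d) (Fin d) K).conjTranspose, by
    rw [Matrix.det_conjTranspose, Matrix.SpecialLinearGroup.det_coe, star_one]⟩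
  map_one' := by
    apply Subtype.ext
    change Matrix.conjTranspose _ = 1
    rw [inv_one, Matrix.SpecialLinearGroup.coe_one, Matrix.conjTranspose_one]
  map_mul' g h := by
    apply Subtype.ext
    change Matrix.conjTranspose _ = Matrix.conjTranspose _ * Matrix.conjTranspose _
    rw [← Matrix.conjTranspose_mul, ← Matrix.SpecialLinearGroup.coe_mul, mul_inv_rev]

lemma toLin_dual (g : SL) : toLin (dual K d g) = LinearMap.adjoint (toLin g⁻¹) :=
  Matrix.toEuclideanLin_conjTranspose_eq_adjoint _

lemma toLin_dual_inv (g : SL) : toLin (dual K d g⁻¹) = LinearMap.adjoint (toLin g) := by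
  rw [toLin_dual, inv_inv]

lemma cl_dual_inv (g : SL) : cl K d (dual K d g⁻¹) = ContinuousLinearMap.adjoint (cl K d g) := by
  ext1 v
  rw [cl_apply, toLin_dual_inv]
  rfl

lemma inner_dual (g : SL) (v w : 𝔼) :
    inner K (toLin g v) (toLin (dual K d g) w) = inner K v w := by
  rw [toLin_dual, LinearMap.adjoint_inner_right]
  congr 1
  exact cl_inv_cl g v

namespace Line

instance : MulAction SL (Line K d) where
  smul g V := ⟨V.1.map (toLin g), 
    (Submodule.equivMapOfInjective _ (cl_injective g) V.1).finrank_eq.symm.trans V.2⟩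
  one_smul V := by
    apply Subtype.ext
    change V.1.map (toLin 1) = V.1
    rw [toLin_one, Submodule.map_id]
  mul_smul g h V := by
    apply Subtype.ext
    change V.1.map (toLin (g * h)) = (V.1.map (toLin h)).map (toLin g)
    rw [toLin_mul, Submodule.map_comp]

lemma smul_val (g : SL) (V : Line K d) : (g • V).1 = act g V.1 := rfl

lemma cl_mem {g : SL} {V : Line K d} {v : 𝔼} (hv : v ∈ V.1) : cl K d g v ∈ (g • V).1 :=
  Submodule.mem_map_of_mem hv

lemma tendsto_smul_const (g : SL) {ι : Type*} {l : Filter ι} {V : ι → Line K d} {W : Line K d}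
    (h : Tendsto V l (𝓝 W)) : Tendsto (fun i => g • V i) l (𝓝 (g • W)) := by
  obtain ⟨v, hv, hm, -⟩ := W.exists_mem
  have h1 : Tendsto (fun i => (V i).proj v) l (𝓝 v) := by
    have := tendsto_clm_apply ((continuous_proj.tendsto W).comp h) (tendsto_const_nhds (x := v))
    rwa [proj_eq_self.2 hm] at this
  refine tendsto_mk (fun i => cl_mem ((V i).proj_mem v)) (cl_mem hm) ?_
    (((cl K d g).continuous.tendsto v).comp h1)
  intro h0
  exact hv (cl_injective g (by rw [h0, map_zero]))

instance : ContinuousConstSMul SL (Line K d) where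
  continuous_const_smul g := continuous_iff_continuousAt.2 fun _ =>
    tendsto_smul_const g tendsto_id

/-- Orthogonal lines. In terms of the hyperplane with normal line `W`, the line `V` lies in it. -/
def Perp (V W : Line K d) : Prop := V.1 ≤ W.1ᗮ

lemma perp_iff {V W : Line K d} {v w : 𝔼} (hv0 : v ≠ 0) (hv : v ∈ V.1) (hw0 : w ≠ 0)
    (hw : w ∈ W.1) : Perp V W ↔ inner K v w = 0 := by
  have h1 := congrArg Subtype.val (eq_mk hv0 hv)
  have h2 := congrArg Subtype.val (eq_mk hw0 hw)
  change V.1 = K ∙ v at h1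
  change W.1 = K ∙ w at h2
  rw [Perp, h1, h2, Submodule.span_singleton_le_iff_mem, Submodule.mem_orthogonal_singleton_iff_inner_left]

lemma perp_comm {V W : Line K d} : Perp V W ↔ Perp W V := by
  obtain ⟨v, hv0, hv, -⟩ := V.exists_mem
  obtain ⟨w, hw0, hw, -⟩ := W.exists_mem
  rw [perp_iff hv0 hv hw0 hw, perp_iff hw0 hw hv0 hv, inner_eq_zero_symm]

lemma perp_smul (g : SL) (V W : Line K d) : Perp (g • V) (dual K d g • W) ↔ Perp V W := by
  obtain ⟨v, hv0, hv, -⟩ := V.exists_mem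
  obtain ⟨w, hw0, hw, -⟩ := W.exists_mem
  have hne : ∀ (h : SL) (x : 𝔼), x ≠ 0 → cl K d h x ≠ 0 := fun h x hx h0 =>
    hx (cl_injective h (by rw [h0, map_zero]))
  rw [perp_iff hv0 hv hw0 hw, perp_iff (hne g v hv0) (cl_mem hv) (hne _ w hw0) (cl_mem hw)]
  exact Eq.congr_left (inner_dual g v w)

lemma not_perp_iff {V W : Line K d} : ¬ Perp V W ↔ V.proj ∘L W.proj ≠ 0 := by
  obtain ⟨v, hv1, hv, -⟩ := V.exists_unit
  obtain ⟨w, hw1, hw, -⟩ := W.exists_unit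
  have hv0 : v ≠ 0 := by rintro rfl; simp at hv1
  have hw0 : w ≠ 0 := by rintro rfl; simp at hw1
  rw [not_iff_not, perp_iff hv0 hv hw0 hw]
  constructor
  · intro h
    ext1 x
    simp [proj_apply_unit hw1 hw, proj_apply_unit hv1 hv, inner_smul_right, h]
  · intro h
    have := congrArg (fun T : 𝔼 →L[K] 𝔼 => T w) h
    simp only [ContinuousLinearMap.comp_apply, proj_eq_self.2 hw, proj_apply_unit hv1 hv] at this
    simpa [hv0] using this

lemma isOpen_not_perp : IsOpen {z : Line K d × Line K d | ¬ Perp z.1 z.2} := by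
  simp_rw [not_perp_iff]
  refine isOpen_ne_fun ?_ continuous_const
  exact (continuous_proj.comp continuous_fst).clm_comp (continuous_proj.comp continuous_snd)

lemma isCompl_orthogonal_iff {V W : Line K d} : IsCompl V.1 W.1ᗮ ↔ ¬ Perp V W := by
  obtain ⟨v, hv0, hv, hs⟩ := V.exists_mem
  obtain ⟨w, hw0, hw, -⟩ := W.exists_mem
  have hd : Disjoint V.1 W.1ᗮ ↔ ¬ Perp V W := by
    constructor
    · intro h hp
      exact hv0 (Submodule.disjoint_def.1 h v hv (hp hv))
    · intro h
      rw [Submodule.disjoint_def]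
      intro x hx hx'
      by_contra hx0
      exact h ((perp_iff hx0 hx hw0 hw).2 ((Submodule.mem_orthogonal' _ _).1 hx' w hw))
  rw [← hd]
  refine ⟨fun h => h.1, fun h => ?_⟩
  refine (Submodule.isCompl_iff_disjoint _ _ ?_).2 h
  have := Submodule.finrank_add_finrank_orthogonal W.1
  rw [W.2] at this
  rw [V.2, this]

end Line

/-! ### Sequences in `SL(d, K)` that converge projectively to a map of rank one -/

/-- Suitable multiples of `g n` converge to a map of rank one with range `p` and kernel `qᗮ`. -/
def RankOneLimit (g : ℕ → SL) (p q : Line K d) : Prop :=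
  ∃ (s : ℕ → K) (T : 𝔼 →L[K] 𝔼), Tendsto (fun n => s n • cl K d (g n)) atTop (𝓝 T) ∧ T ≠ 0 ∧
    (∀ v, T v ∈ p.1) ∧ ∀ v, T v = 0 ↔ v ∈ q.1ᗮ

lemma RankOneLimit.comp {g : ℕ → SL} {p q : Line K d} (h : RankOneLimit g p q) {φ : ℕ → ℕ}
    (hφ : Tendsto φ atTop atTop) : RankOneLimit (g ∘ φ) p q := by
  obtain ⟨s, T, h1, h2⟩ := h
  exact ⟨s ∘ φ, T, h1.comp hφ, h2⟩

/-- Passing to adjoints exchanges range and normal line of the kernel. -/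
lemma RankOneLimit.adjoint {g : ℕ → SL} {p q : Line K d} (h : RankOneLimit g p q) :
    RankOneLimit (fun n => dual K d (g n)⁻¹) q p := by
  obtain ⟨s, T, h1, h2, h3, h4⟩ := h
  obtain ⟨v, hv0, hv, hs⟩ := p.exists_mem
  refine ⟨fun n => star (s n), ContinuousLinearMap.adjoint T, ?_, ?_, ?_, ?_⟩
  · have := (ContinuousLinearMap.adjoint (𝕜 := K) (E := 𝔼) (F := 𝔼)).continuous.tendsto T |>.comp h1
    refine this.congr fun n => ?_
    rw [Function.comp, cl_dual_inv, map_smulₛₗ]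
    rfl
  · simpa using h2
  · intro w
    rw [← Submodule.orthogonal_orthogonal q.1, Submodule.mem_orthogonal]
    intro x hx
    rw [ContinuousLinearMap.adjoint_inner_right, (h4 x).2 hx, inner_zero_left]
  · intro w
    constructor
    · intro h0
      obtain ⟨x, hx⟩ : ∃ x, T x ≠ 0 := by
        by_contra hcon
        push Not at hcon
        exact h2 (ContinuousLinearMap.ext hcon)
      rw [Submodule.mem_orthogonal]
      obtain ⟨c, hc⟩ := hs _ (h3 x)
      have hc0 : c ≠ 0 := by rintro rfl; exact hx (by rw [hc, zero_smul])
      have e : inner K (T x) w = 0 := by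
        rw [← ContinuousLinearMap.adjoint_inner_right, h0, inner_zero_right]
      intro y hy
      obtain ⟨b, rfl⟩ := hs y hy
      rw [hc, inner_smul_left] at e
      have := (mul_eq_zero.1 e).resolve_left (by simpa using hc0)
      rw [inner_smul_left, this, mul_zero]
    · intro hw
      refine ext_inner_left K fun x => ?_
      rw [ContinuousLinearMap.adjoint_inner_right, inner_zero_right]
      exact (Submodule.mem_orthogonal _ _).1 hw _ (h3 x)

lemma RankOneLimit.ne_zero {q : Line K d} {T : 𝔼 →L[K] 𝔼} (h4 : ∀ v, T v = 0 ↔ v ∈ q.1ᗮ)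
    {V : Line K d} (hV : ¬ V.Perp q) {v : 𝔼} (hv0 : v ≠ 0) (hv : v ∈ V.1) : T v ≠ 0 := by
  intro h
  obtain ⟨w, hw0, hw, -⟩ := q.exists_mem
  exact hV ((Line.perp_iff hv0 hv hw0 hw).2 ((Submodule.mem_orthogonal' _ _).1 ((h4 v).1 h) w hw))

lemma RankOneLimit.tendsto {g : ℕ → SL} {p q : Line K d} (h : RankOneLimit g p q)
    {V : ℕ → Line K d} {W : Line K d} (hV : Tendsto V atTop (𝓝 W)) (hW : ¬ W.Perp q) :
    Tendsto (fun n => g n • V n) atTop (𝓝 p) := by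
  obtain ⟨s, T, h1, h2, h3, h4⟩ := h
  obtain ⟨w, hw0, hw, -⟩ := W.exists_mem
  have e1 : Tendsto (fun n => (V n).proj w) atTop (𝓝 w) := by
    have := tendsto_clm_apply ((Line.continuous_proj.tendsto W).comp hV)
      (tendsto_const_nhds (x := w))
    rwa [Line.proj_eq_self.2 hw] at this
  refine Line.tendsto_mk (v := fun n => (s n • cl K d (g n)) ((V n).proj w)) (fun n => ?_) (h3 w)
    (RankOneLimit.ne_zero h4 hW hw0 hw) (tendsto_clm_apply h1 e1)
  exact Submodule.smul_mem _ _ (Line.cl_mem ((V n).proj_mem w))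

/-- The quantitative heart of the ping-pong: near a limit of rank one, the action on lines is
strongly contracting on compact sets that avoid the kernel of the limit. -/
lemma RankOneLimit.eventually_dist_le {g : ℕ → SL} {p q : Line K d} (h : RankOneLimit g p q)
    {D : Set (Line K d)} (hD : IsCompact D) (hDq : ∀ V ∈ D, ¬ V.Perp q) {δ : ℝ} (hδ : 0 < δ) :
    ∀ᶠ n in atTop, ∀ V ∈ D, ∀ W ∈ D, dist (g n • V) (g n • W) ≤ δ * dist V W := by
  obtain ⟨s, T, h1, h2, h3, h4⟩ := h
  rcases D.eq_empty_or_nonempty with rfl | hne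
  · simp
  -- `m` is a lower bound of `‖T v‖` for unit vectors `v` of lines in `D`
  obtain ⟨V₀, hV₀, hmin⟩ := hD.exists_isMinOn hne (f := fun V : Line K d => ‖T ∘L V.proj‖)
    ((continuous_const.clm_comp Line.continuous_proj).norm.continuousOn)
  set m := ‖T ∘L V₀.proj‖ with hm
  have hmle : ∀ V ∈ D, ∀ v ∈ V.1, m * ‖v‖ ≤ ‖T v‖ := by
    intro V hV v hv
    obtain ⟨u, hu1, hu, hs⟩ := V.exists_unit
    obtain ⟨c, rfl⟩ := hs v hv
    have hb : ‖T ∘L V.proj‖ ≤ ‖T u‖ := by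
      refine ContinuousLinearMap.opNorm_le_bound _ (norm_nonneg _) fun x => ?_
      rw [ContinuousLinearMap.comp_apply, Line.proj_apply_unit hu1 hu, map_smul, norm_smul, mul_comm]
      gcongr
      simpa [hu1] using norm_inner_le_norm (𝕜 := K) u x
    have : m ≤ ‖T u‖ := (hmin hV).trans hb
    rw [map_smul, norm_smul, norm_smul, hu1, mul_one, mul_comm]
    gcongr
  have hm0 : 0 < m := by
    obtain ⟨u, hu1, hu, -⟩ := V₀.exists_unit
    have hu0 : u ≠ 0 := by rintro rfl; simp at hu1
    have := RankOneLimit.ne_zero h4 (hDq V₀ hV₀) hu0 hu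
    refine norm_pos_iff.2 fun h0 => this ?_
    have := congrArg (fun S : 𝔼 →L[K] 𝔼 => S u) h0
    simpa [Line.proj_eq_self.2 hu] using this
  set C := 1 + ‖T‖ / m with hC
  have hC0 : 0 < C := by positivity
  set ε := min (m / 2) (δ * m / (4 * C)) with hε
  have hε0 : 0 < ε := by positivity
  have e1 : ∀ᶠ n in atTop, ‖s n • cl K d (g n) - T‖ < ε := by
    have := (tendsto_iff_norm_sub_tendsto_zero.1 h1).eventually (gt_mem_nhds hε0)
    exact this
  filter_upwards [e1] with n hn V hV W hW
  set A := s n • cl K d (g n) with hA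
  set η := ‖A - T‖ with hη
  obtain ⟨x, hx1, hx, -⟩ := V.exists_unit
  obtain ⟨y, hy1, hy, hys⟩ := W.exists_unit
  have hTy : T y ≠ 0 := by
    have := hmle W hW y hy
    rw [hy1, mul_one] at this
    exact norm_pos_iff.1 (hm0.trans_le this)
  have hAsub : ∀ v, ‖A v - T v‖ ≤ η * ‖v‖ := fun v => (A - T).le_opNorm v
  set z := x - W.proj x with hz
  have hzn : ‖z‖ ≤ dist V W := by
    have := Line.norm_sub_proj_le (W := W) hx
    rwa [hx1, mul_one] at this
  -- as `T` has rank one, `T z` is a multiple of `T y`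
  obtain ⟨t, ht⟩ : ∃ t : K, T z = t • T y := by
    obtain ⟨v, hv0, hv, hs⟩ := p.exists_mem
    obtain ⟨a, ha⟩ := hs _ (h3 y)
    obtain ⟨b, hb⟩ := hs _ (h3 z)
    have ha0 : a ≠ 0 := by rintro rfl; exact hTy (by rw [ha, zero_smul])
    exact ⟨b * a⁻¹, by rw [ha, hb, smul_smul, mul_assoc, inv_mul_cancel₀ ha0, mul_one]⟩
  have htn : ‖t‖ ≤ ‖T‖ * ‖z‖ / m := by
    rw [le_div_iff₀ hm0]
    have e2 : ‖t‖ * ‖T y‖ ≤ ‖T‖ * ‖z‖ := by rw [← norm_smul, ← ht]; exact T.le_opNorm z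
    have e3 : m ≤ ‖T y‖ := by simpa [hy1] using hmle W hW y hy
    exact (mul_le_mul_of_nonneg_left e3 (norm_nonneg _)).trans e2
  have hdiff : ‖A z - t • A y‖ ≤ η * C * ‖z‖ := by
    have e2 : A z - t • A y = (A z - T z) - t • (A y - T y) := by
      rw [smul_sub, ← ht]; abel
    rw [e2]
    calc _ ≤ ‖A z - T z‖ + ‖t • (A y - T y)‖ := norm_sub_le _ _
      _ ≤ η * ‖z‖ + (‖T‖ * ‖z‖ / m) * (η * 1) := by
          rw [norm_smul]
          gcongr
          · exact hAsub z
          · simpa [hy1] using hAsub y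
      _ = η * C * ‖z‖ := by rw [hC]; field_simp
  have hAx : m / 2 ≤ ‖A x‖ := by
    have e2 : m ≤ ‖T x‖ := by simpa [hx1] using hmle V hV x hx
    have e3 : ‖A x - T x‖ ≤ m / 2 := by
      have := hAsub x
      rw [hx1, mul_one] at this
      exact this.trans (hn.le.trans (min_le_left _ _))
    have e4 : ‖T x‖ ≤ ‖A x‖ + ‖A x - T x‖ := by
      have := norm_sub_le (A x) (A x - T x)
      rwa [sub_sub_cancel] at this
    linarith
  have hAx0 : 0 < ‖A x‖ := lt_of_lt_of_le (by positivity) hAx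
  have hAxm : A x ∈ (g n • V).1 := Submodule.smul_mem _ _ (Line.cl_mem hx)
  have hAym : A y ∈ (g n • W).1 := Submodule.smul_mem _ _ (Line.cl_mem hy)
  set Q := (g n • W).proj with hQ
  have hdef : ‖A x - Q (A x)‖ ≤ η * C * ‖z‖ := by
    -- `A x` and `A z - t A y` differ by an element of `g n • W`
    have e2 : A x - (A z - t • A y) ∈ (g n • W).1 := by
      obtain ⟨c, hc⟩ := hys _ (W.proj_mem x)
      have e : A x - (A z - t • A y) = (c + t) • A y := by
        rw [hz, map_sub, hc, map_smul, add_smul]; abel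
      rw [e]
      exact Submodule.smul_mem _ _ hAym
    have e3 := (Line.proj_eq_self (V := g n • W)).2 e2
    have e4 : A x - Q (A x) = (A z - t • A y) - Q (A z - t • A y) := by
      rw [← hQ, map_sub] at e3
      rw [sub_eq_sub_iff_sub_eq_sub, ← e3]
    rw [e4]
    refine le_trans ?_ hdiff
    have := Submodule.starProjection_orthogonal_val (K := (g n • W).1) (A z - t • A y)
    change _ = A z - t • A y - Q (A z - t • A y) at this
    rw [← this]
    refine (ContinuousLinearMap.le_opNorm _ _).trans ?_
    exact mul_le_of_le_one_left (norm_nonneg _) (Submodule.starProjection_norm_le _)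
  set c : K := ((‖A x‖ : ℝ) : K)⁻¹ with hc
  have hcn : ‖c‖ = ‖A x‖⁻¹ := by rw [hc, norm_inv, RCLike.norm_ofReal, abs_norm]
  have hu : ‖c • A x‖ = 1 := by rw [norm_smul, hcn, inv_mul_cancel₀ hAx0.ne']
  refine (Line.dist_le_two_mul hu (Submodule.smul_mem _ _ hAxm)).trans ?_
  rw [← hQ, map_smul, ← smul_sub, norm_smul, hcn]
  have hd : 0 ≤ dist V W := dist_nonneg
  calc 2 * (‖A x‖⁻¹ * ‖A x - Q (A x)‖) ≤ 2 * ((m / 2)⁻¹ * (δ * m / (4 * C) * C * dist V W)) := by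
        gcongr
        refine hdef.trans ?_
        have : η ≤ δ * m / (4 * C) := hn.le.trans (min_le_right _ _)
        gcongr
    _ = δ * dist V W := by field_simp; ring

end Action

end

end RelAnosov

namespace RelAnosov

noncomputable section

/-! ### Dynamics on pairs of lines -/

section Dynamics

variable {K : Type*} [RCLike K] {d : ℕ}

local notation "𝔼" => EuclideanSpace K (Fin d)
local notation "SL" => Matrix.SpecialLinearGroup (Fin d) K

namespace Line

/-- A small perturbation of the line `V` in the direction `v`. -/
lemma exists_perturb (V : Line K d) {x : 𝔼} (hx0 : x ≠ 0) (hx : x ∈ V.1) (v : 𝔼) {r : ℝ}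
    (hr : 0 < r) : ∃ (c : K) (W : Line K d), c ≠ 0 ∧ x + c • v ≠ 0 ∧ x + c • v ∈ W.1 ∧
      dist W V < r := by
  have h1 : Tendsto (fun n : ℕ => x + ((1 / ((n : ℝ) + 1) : ℝ) : K) • v) atTop (𝓝 x) := by
    have h2 : Tendsto (fun n : ℕ => ((1 / ((n : ℝ) + 1) : ℝ) : K)) atTop (𝓝 0) := by
      have := ((RCLike.continuous_ofReal (K := K)).tendsto 0).comp
        tendsto_one_div_add_atTop_nhds_zero_nat
      simpa [Function.comp_def] using this
    simpa using tendsto_const_nhds.add (h2.smul_const v)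
  classical
  set W : ℕ → Line K d := fun n =>
    if h : x + ((1 / ((n : ℝ) + 1) : ℝ) : K) • v = 0 then V else mk _ h with hW
  have hWm : ∀ n, x + ((1 / ((n : ℝ) + 1) : ℝ) : K) • v ∈ (W n).1 := by
    intro n
    by_cases h : x + ((1 / ((n : ℝ) + 1) : ℝ) : K) • v = 0
    · rw [h]; exact Submodule.zero_mem _
    · simp only [hW, dif_neg h]; exact mem_mk h
  have h3 := (tendsto_mk hWm hx hx0 h1).eventually (Metric.ball_mem_nhds V hr)
  obtain ⟨n, hn, hn'⟩ := (h3.and (h1.eventually_ne hx0)).exists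
  refine ⟨_, W n, ?_, hn', hWm n, hn⟩
  have : (0 : ℝ) < 1 / ((n : ℝ) + 1) := by positivity
  exact_mod_cast this.ne'

lemma exists_not_perp (V p : Line K d) {r : ℝ} (hr : 0 < r) :
    ∃ W : Line K d, dist W V < r ∧ ¬ W.Perp p := by
  by_cases h : V.Perp p
  · obtain ⟨x, hx0, hx, -⟩ := V.exists_mem
    obtain ⟨v, hv0, hv, -⟩ := p.exists_mem
    obtain ⟨c, W, hc, h1, h2, h3⟩ := V.exists_perturb hx0 hx v hr
    refine ⟨W, h3, ?_⟩
    rw [perp_iff h1 h2 hv0 hv, inner_add_left, (perp_iff hx0 hx hv0 hv).1 h, inner_smul_left]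
    simp [hc, hv0]
  · exact ⟨V, by simpa using hr, h⟩

end Line

/-- If `g n` contracts a ball of lines to a point, then a subsequence converges projectively to a
map of rank one. -/
lemma exists_rankOneLimit {g : ℕ → SL} {V₀ p : Line K d} {r : ℝ} (hr : 0 < r)
    (h : ∀ V, dist V V₀ < r → Tendsto (fun n => g n • V) atTop (𝓝 p)) :
    ∃ φ : ℕ → ℕ, StrictMono φ ∧ ∃ q, RankOneLimit (g ∘ φ) p q := by
  obtain ⟨x, hx0, hx, -⟩ := V₀.exists_mem
  have hne : ∀ n, cl K d (g n) ≠ 0 := by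
    intro n h0
    refine hx0 (cl_injective (g n) ?_)
    rw [h0]; simp
  set s : ℕ → K := fun n => ((‖cl K d (g n)‖ : ℝ) : K)⁻¹
  have hsph : ∀ n, s n • cl K d (g n) ∈ Metric.sphere (0 : 𝔼 →L[K] 𝔼) 1 := by
    intro n
    rw [mem_sphere_zero_iff_norm, norm_smul, norm_inv, RCLike.norm_ofReal, abs_norm,
      inv_mul_cancel₀ (norm_ne_zero_iff.2 (hne n))]
  have : ProperSpace (𝔼 →L[K] 𝔼) := FiniteDimensional.proper K _
  obtain ⟨T, hT, φ, hφ, hlim⟩ := (isCompact_sphere (0 : 𝔼 →L[K] 𝔼) 1).tendsto_subseq hsph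
  have hT0 : T ≠ 0 := by rintro rfl; simp at hT
  have hball : ∀ V, dist V V₀ < r → ∀ v ∈ V.1, T v ∈ p.1 := by
    intro V hV v hv
    by_cases h0 : T v = 0
    · rw [h0]; exact Submodule.zero_mem _
    have h1 : Tendsto (fun n => g (φ n) • V) atTop (𝓝 (Line.mk _ h0)) := by
      refine Line.tendsto_mk (v := fun n => (s (φ n) • cl K d (g (φ n))) v) (fun n => ?_)
        (Line.mem_mk h0) h0 (tendsto_clm_apply hlim tendsto_const_nhds)
      exact Submodule.smul_mem _ _ (Line.cl_mem hv)
    rw [tendsto_nhds_unique ((h V hV).comp hφ.tendsto_atTop) h1]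
    exact Line.mem_mk h0
  have hrange : ∀ v, T v ∈ p.1 := by
    intro v
    obtain ⟨c, W, hc, h1, h2, h3⟩ := V₀.exists_perturb hx0 hx v hr
    have e1 := hball W h3 _ h2
    have e2 := hball V₀ (by simpa using hr) _ hx
    rw [map_add, Submodule.add_mem_iff_right _ e2, map_smul, Submodule.smul_mem_iff _ hc] at e1
    exact e1
  obtain ⟨w, hw1, hw, hs⟩ := p.exists_unit
  have hw0 : w ≠ 0 := by rintro rfl; simp at hw1
  set f := ContinuousLinearMap.adjoint T w with hf
  have hTf : ∀ v, T v = (inner K f v) • w := by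
    intro v
    rw [hf, ContinuousLinearMap.adjoint_inner_left, ← Line.proj_apply_unit hw1 hw]
    exact (Line.proj_eq_self.2 (hrange v)).symm
  have hf0 : f ≠ 0 := by
    intro h0
    refine hT0 (ContinuousLinearMap.ext fun v => ?_)
    rw [hTf, h0]; simp
  refine ⟨φ, hφ, Line.mk f hf0, s ∘ φ, T, hlim, hT0, hrange, fun v => ?_⟩
  change _ ↔ v ∈ (K ∙ f)ᗮ
  rw [hTf, Submodule.mem_orthogonal_singleton_iff_inner_right]
  simp [hw0]

/-- The image of the limit of the inverses lies in the kernel of the limit: otherwise multiples of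
`g n * (g n)⁻¹ = 1` would converge to a map of rank one, which is impossible for `d ≥ 2`. -/
lemma RankOneLimit.perp (hd : 2 ≤ d) {g : ℕ → SL} {p q p' q' : Line K d}
    (h : RankOneLimit g p q) (h' : RankOneLimit (fun n => (g n)⁻¹) p' q') : p'.Perp q := by
  by_contra hcon
  obtain ⟨s, T, h1, h2, h3, h4⟩ := h
  obtain ⟨t, T', k1, k2, k3, k4⟩ := h'
  have hlim : ∀ v, Tendsto (fun n => (s n * t n) • v) atTop (𝓝 (T (T' v))) := by
    intro v
    refine (tendsto_clm_apply h1 (tendsto_clm_apply k1 (tendsto_const_nhds (x := v)))).congr ?_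
    intro n
    simp only [_root_.smul_apply, map_smul, smul_smul]
    have := cl_inv_cl (g n)⁻¹ v
    rw [inv_inv] at this
    rw [this, mul_comm]
  obtain ⟨u, hu0, hu⟩ : ∃ u : 𝔼, u ≠ 0 ∧ u ∈ q'.1ᗮ := by
    have := Submodule.finrank_add_finrank_orthogonal q'.1
    rw [q'.2, finrank_euclideanSpace_fin] at this
    have hpos : 0 < Module.finrank K q'.1ᗮ := by omega
    have := Module.finrank_pos_iff.1 hpos
    obtain ⟨u, hu⟩ := exists_ne (0 : q'.1ᗮ)
    exact ⟨u, fun h => hu (Subtype.ext h), u.2⟩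
  have hst : Tendsto (fun n => s n * t n) atTop (𝓝 0) := by
    have := hlim u
    rw [(k4 u).2 hu, map_zero] at this
    rw [tendsto_zero_iff_norm_tendsto_zero] at this ⊢
    simp only [norm_smul] at this
    have h5 := this.mul_const ‖u‖⁻¹
    simpa [mul_assoc, hu0] using h5
  obtain ⟨v, hv⟩ : ∃ v, T' v ≠ 0 := by
    by_contra hc
    push Not at hc
    exact k2 (ContinuousLinearMap.ext hc)
  have h5 := hlim v
  have h6 := hst.smul_const v
  rw [zero_smul] at h6
  exact RankOneLimit.ne_zero h4 hcon hv (k3 v) (tendsto_nhds_unique h5 h6)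

variable (K d) in
/-- Pairs of lines. The pair `(p, q)` encodes the line `p` together with the hyperplane `qᗮ`;
accordingly `g` acts by `g` on the first and by `(g*)⁻¹` on the second line. -/
def FlagPair : Type _ := Line K d × Line K d

namespace FlagPair

/-- The pair with given components. -/
def mk (p q : Line K d) : FlagPair K d := (p, q)

instance : MetricSpace (FlagPair K d) := inferInstanceAs (MetricSpace (Line K d × Line K d))

instance : CompactSpace (FlagPair K d) := inferInstanceAs (CompactSpace (Line K d × Line K d))

instance : MulAction SL (FlagPair K d) where
  smul g z := (g • z.1, dual K d g • z.2)
  one_smul z := by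
    change ((1 : SL) • z.1, dual K d 1 • z.2) = z
    rw [map_one, one_smul, one_smul]
    rfl
  mul_smul g h z := by
    change ((g * h) • z.1, dual K d (g * h) • z.2) =
      (g • (h • z.1), dual K d g • (dual K d h • z.2))
    rw [map_mul, mul_smul, mul_smul]

lemma smul_fst (g : SL) (z : FlagPair K d) : (g • z).1 = g • z.1 := rfl

lemma smul_snd (g : SL) (z : FlagPair K d) : (g • z).2 = dual K d g • z.2 := rfl

lemma continuous_fst : Continuous (fun z : FlagPair K d => z.1) := _root_.continuous_fst

lemma continuous_snd : Continuous (fun z : FlagPair K d => z.2) := _root_.continuous_snd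

lemma tendsto_iff {ι : Type*} {l : Filter ι} {z : ι → FlagPair K d} {w : FlagPair K d} :
    Tendsto z l (𝓝 w) ↔ Tendsto (fun i => (z i).1) l (𝓝 w.1) ∧
      Tendsto (fun i => (z i).2) l (𝓝 w.2) :=
  Prod.tendsto_iff z w

lemma dist_eq (z w : FlagPair K d) : dist z w = max (dist z.1 w.1) (dist z.2 w.2) := rfl

instance : ContinuousConstSMul SL (FlagPair K d) where
  continuous_const_smul g := by
    have h1 : Continuous fun z : FlagPair K d => g • z.1 := continuous_fst.const_smul g
    have h2 : Continuous fun z : FlagPair K d => dual K d g • z.2 :=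
      continuous_snd.const_smul (dual K d g)
    exact h1.prodMk h2

/-- Transversality of pairs, corresponding to that of the flags they encode. -/
def Opp (z w : FlagPair K d) : Prop := ¬ z.1.Perp w.2 ∧ ¬ w.1.Perp z.2

lemma Opp.symm {z w : FlagPair K d} (h : Opp z w) : Opp w z := ⟨h.2, h.1⟩

lemma opp_smul {g : SL} {z w : FlagPair K d} : Opp (g • z) (g • w) ↔ Opp z w := by
  rw [Opp, smul_fst, smul_fst, smul_snd, smul_snd, Line.perp_smul, Line.perp_smul]
  rfl

lemma isOpen_opp : IsOpen {z : FlagPair K d × FlagPair K d | Opp z.1 z.2} := by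
  have h1 : Continuous fun z : FlagPair K d × FlagPair K d => (z.1.1, z.2.2) :=
    (continuous_fst.comp _root_.continuous_fst).prodMk
      (continuous_snd.comp _root_.continuous_snd)
  have h2 : Continuous fun z : FlagPair K d × FlagPair K d => (z.2.1, z.1.2) :=
    (continuous_fst.comp _root_.continuous_snd).prodMk
      (continuous_snd.comp _root_.continuous_fst)
  exact (Line.isOpen_not_perp.preimage h1).inter (Line.isOpen_not_perp.preimage h2)

end FlagPair

open FlagPair

/-- Suitable multiples of `g n` converge to a map of rank one with image `x.1` and kernel `y.2ᗮ`, and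
suitable multiples of `(g n)⁻¹` to one with image `y.1` and kernel `x.2ᗮ`. Consequently `g n`
converges to `x` locally uniformly on the pairs transverse to `y`, and `(g n)⁻¹` to `y` locally
uniformly on the pairs transverse to `x`. -/
def Dyn (g : ℕ → SL) (x y : FlagPair K d) : Prop :=
  RankOneLimit g x.1 y.2 ∧ RankOneLimit (fun n => (g n)⁻¹) y.1 x.2

namespace Dyn

variable {g : ℕ → Matrix.SpecialLinearGroup (Fin d) K} {x y : FlagPair K d}

lemma symm (h : Dyn g x y) : Dyn (fun n => (g n)⁻¹) y x :=
  ⟨h.2, by simpa using h.1⟩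

lemma comp (h : Dyn g x y) {φ : ℕ → ℕ} (hφ : Tendsto φ atTop atTop) : Dyn (g ∘ φ) x y :=
  ⟨h.1.comp hφ, h.2.comp hφ⟩

lemma snd (h : Dyn g x y) : RankOneLimit (fun n => dual K d (g n)) x.2 y.1 := by
  simpa using h.2.adjoint

lemma perp_left (hd : 2 ≤ d) (h : Dyn g x y) : x.1.Perp x.2 := by
  have := h.symm
  exact RankOneLimit.perp hd this.1 this.2

lemma tendsto (h : Dyn g x y) {z : ℕ → FlagPair K d} {w : FlagPair K d}
    (hz : Tendsto z atTop (𝓝 w)) (hw : Opp w y) : Tendsto (fun n => g n • z n) atTop (𝓝 x) := by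
  rw [tendsto_iff] at hz ⊢
  exact ⟨h.1.tendsto hz.1 hw.1, h.snd.tendsto hz.2 (fun hp => hw.2 (Line.perp_comm.1 hp))⟩

lemma eventually_mapsTo (h : Dyn g x y) {D : Set (FlagPair K d)} (hD : IsCompact D)
    (hDy : ∀ z ∈ D, Opp z y) {W : Set (FlagPair K d)} (hW : W ∈ 𝓝 x) :
    ∀ᶠ n in atTop, ∀ z ∈ D, g n • z ∈ W := by
  by_contra hcon
  obtain ⟨φ, hφ, hφ'⟩ := extraction_of_frequently_atTop (not_eventually.1 hcon)
  push Not at hφ'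
  choose z hz hzW using hφ'
  obtain ⟨w, hw, ψ, hψ, hlim⟩ := hD.tendsto_subseq hz
  have := (h.comp (hφ.comp hψ).tendsto_atTop).tendsto hlim (hDy w hw)
  obtain ⟨n, hn⟩ := (this.eventually hW).exists
  exact hzW _ hn

lemma eventually_dist_le (h : Dyn g x y) {D : Set (FlagPair K d)} (hD : IsCompact D)
    (hDy : ∀ z ∈ D, Opp z y) {δ : ℝ} (hδ : 0 < δ) :
    ∀ᶠ n in atTop, ∀ z ∈ D, ∀ w ∈ D, dist (g n • z) (g n • w) ≤ δ * dist z w := by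
  have h1 := h.1.eventually_dist_le (hD.image FlagPair.continuous_fst) (by
    rintro _ ⟨z, hz, rfl⟩; exact (hDy z hz).1) hδ
  have h2 := h.snd.eventually_dist_le (hD.image FlagPair.continuous_snd) (by
    rintro _ ⟨z, hz, rfl⟩; exact fun hp => (hDy z hz).2 (Line.perp_comm.1 hp)) hδ
  filter_upwards [h1, h2] with n hn1 hn2 z hz w hw
  rw [FlagPair.dist_eq, FlagPair.dist_eq, mul_max_of_nonneg _ _ hδ.le]
  exact max_le_max (hn1 _ ⟨z, hz, rfl⟩ _ ⟨w, hw, rfl⟩) (hn2 _ ⟨z, hz, rfl⟩ _ ⟨w, hw, rfl⟩)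

/-- Contraction of balls to points by a sequence and by its inverses is enough. -/
lemma exists_subseq {z₀ w₀ : FlagPair K d} {r : ℝ} (hr : 0 < r)
    (h : ∀ z, dist z z₀ < r → Tendsto (fun n => g n • z) atTop (𝓝 x))
    (h' : ∀ z, dist z w₀ < r → Tendsto (fun n => (g n)⁻¹ • z) atTop (𝓝 y)) :
    ∃ φ : ℕ → ℕ, StrictMono φ ∧ Dyn (g ∘ φ) x y := by
  have hb : ∀ {z₀ : FlagPair K d} {V}, dist V z₀.1 < r → dist (FlagPair.mk V z₀.2) z₀ < r := by
    intro z₀ V hV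
    rw [FlagPair.dist_eq]
    exact max_lt hV (by rw [FlagPair.mk, dist_self]; exact hr)
  have hb' : ∀ {z₀ : FlagPair K d} {V}, dist V z₀.2 < r → dist (FlagPair.mk z₀.1 V) z₀ < r := by
    intro z₀ V hV
    rw [FlagPair.dist_eq]
    exact max_lt (by rw [FlagPair.mk, dist_self]; exact hr) hV
  obtain ⟨φ, hφ, q, hq⟩ := exists_rankOneLimit (g := g) (V₀ := z₀.1) (p := x.1) hr
    fun V hV => (tendsto_iff.1 (h (.mk V z₀.2) (hb hV))).1
  obtain ⟨ψ, hψ, q', hq'⟩ := exists_rankOneLimit (g := fun n => (g (φ n))⁻¹) (V₀ := w₀.1)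
    (p := y.1) hr
    fun V hV => ((tendsto_iff.1 (h' (.mk V w₀.2) (hb hV))).1).comp hφ.tendsto_atTop
  have e1 : q = y.2 := by
    obtain ⟨W, hW, hWp⟩ := Line.exists_not_perp w₀.2 x.1 hr
    have k1 := hq.adjoint.tendsto (tendsto_const_nhds (x := W)) hWp
    have k2 := ((tendsto_iff.1 (h' (.mk w₀.1 W) (hb' hW))).2).comp hφ.tendsto_atTop
    exact tendsto_nhds_unique k1 k2
  have e2 : q' = x.2 := by
    obtain ⟨W, hW, hWp⟩ := Line.exists_not_perp z₀.2 y.1 hr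
    have k1 := hq'.adjoint.tendsto (tendsto_const_nhds (x := W)) hWp
    have k2 := ((tendsto_iff.1 (h (.mk z₀.1 W) (hb' hW))).2).comp (hφ.comp hψ).tendsto_atTop
    refine tendsto_nhds_unique k1 (k2.congr fun n => ?_)
    simp only [Function.comp, inv_inv]
    rfl
  subst e1 e2
  exact ⟨φ ∘ ψ, hφ.comp hψ, hq.comp hψ.tendsto_atTop, hq'⟩

end Dyn

end Dynamics

end

end RelAnosov

namespace RelAnosov

/-! ### Reduced words and ping-pong -/

section Words

variable {G : Type*} [Group G]

/-- Reduced words in two subgroups `H false` and `H true`: lists of nontrivial elements taken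
alternately from the two subgroups. The first two arguments record the subgroups that contain the
first and the last letter. -/
inductive Red (H : Bool → Subgroup G) : Bool → Bool → List G → Prop
  | single {b : Bool} {h : G} (hb : h ∈ H b) (h1 : h ≠ 1) : Red H b b [h]
  | cons {b e : Bool} {h : G} {l : List G} (hb : h ∈ H b) (h1 : h ≠ 1) (hl : Red H (!b) e l) :
      Red H b e (h :: l)

/-- The subgroup generated by two subgroups. -/
def gen (H : Bool → Subgroup G) : Subgroup G := Subgroup.closure {g | ∃ b, g ∈ H b}

variable {H : Bool → Subgroup G}

lemma mem_gen {b : Bool} {h : G} (hb : h ∈ H b) : h ∈ gen H := Subgroup.subset_closure ⟨b, hb⟩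

namespace Red

lemma prod_mem {b e : Bool} {l : List G} (hl : Red H b e l) : l.prod ∈ gen H := by
  induction hl with
  | single hb h1 => simpa using mem_gen hb
  | cons hb h1 hl ih => rw [List.prod_cons]; exact mul_mem (mem_gen hb) ih

lemma append {b c e : Bool} {l m : List G} (hl : Red H b c l) (hm : Red H (!c) e m) :
    Red H b e (l ++ m) := by
  induction hl with
  | single hb h1 => exact .cons hb h1 hm
  | cons hb h1 hl ih => exact .cons hb h1 (ih hm)

lemma inv {b e : Bool} {l : List G} (hl : Red H b e l) :
    Red H e b (l.map (·⁻¹)).reverse := by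
  induction hl with
  | single hb h1 => exact .single (inv_mem hb) (inv_ne_one.2 h1)
  | cons hb h1 hl ih =>
    rw [List.map_cons, List.reverse_cons]
    refine ih.append ?_
    rw [Bool.not_not]
    exact .single (inv_mem hb) (inv_ne_one.2 h1)

lemma prod_inv {l : List G} : (l.map (·⁻¹)).reverse.prod = l.prod⁻¹ :=
  (List.prod_inv_reverse l).symm

lemma snoc {b e : Bool} {l : List G} (hl : Red H b e l) :
    (∃ k, l = [k] ∧ b = e ∧ k ∈ H e ∧ k ≠ 1) ∨
      ∃ m k, Red H b (!e) m ∧ k ∈ H e ∧ k ≠ 1 ∧ l = m ++ [k] := by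
  induction hl with
  | single hb h1 => exact Or.inl ⟨_, rfl, rfl, hb, h1⟩
  | @cons b e h l hb h1 hl ih =>
    right
    rcases ih with ⟨k, rfl, he, hk, hk1⟩ | ⟨m, k, hm, hk, hk1, rfl⟩
    · subst he
      exact ⟨[h], k, by rw [Bool.not_not]; exact .single hb h1, hk, hk1, rfl⟩
    · exact ⟨h :: m, k, .cons hb h1 hm, hk, hk1, rfl⟩

lemma length_pos {b e : Bool} {l : List G} (hl : Red H b e l) : 0 < l.length := by
  cases hl <;> simp

end Red

/-- The element `g` is represented by a reduced word, possibly the empty one. -/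
def IsReduced (H : Bool → Subgroup G) (g : G) : Prop := g = 1 ∨ ∃ b e l, Red H b e l ∧ l.prod = g

lemma IsReduced.mul_left {g h : G} (hg : IsReduced H g) {b : Bool} (hb : h ∈ H b) :
    IsReduced H (h * g) := by
  by_cases h1 : h = 1
  · rwa [h1, one_mul]
  rcases hg with rfl | ⟨c, e, l, hl, rfl⟩
  · exact Or.inr ⟨b, b, [h], .single hb h1, by simp⟩
  by_cases hc : c = b
  · subst hc
    -- the first letter merges with `h`
    cases hl with
    | @single _ k hk hk1 =>
      by_cases h2 : h * k = 1
      · exact Or.inl (by simpa using h2)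
      · exact Or.inr ⟨_, _, [h * k], .single (mul_mem hb hk) h2, by simp⟩
    | @cons _ _ k l hk hk1 hl =>
      by_cases h2 : h * k = 1
      · exact Or.inr ⟨_, _, l, hl, by rw [List.prod_cons, ← mul_assoc, h2, one_mul]⟩
      · exact Or.inr ⟨_, _, (h * k) :: l, .cons (mul_mem hb hk) h2 hl, by simp [mul_assoc]⟩
  · have hc' : c = !b := by cases b <;> cases c <;> simp_all
    subst hc'
    exact Or.inr ⟨_, _, h :: l, .cons hb h1 hl, by simp⟩

lemma isReduced_of_mem {g : G} (hg : g ∈ gen H) : IsReduced H g := by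
  induction hg using Subgroup.closure_induction_left with
  | one => exact Or.inl rfl
  | mul_left x hx y _ ih => obtain ⟨b, hb⟩ := hx; exact ih.mul_left hb
  | inv_mul_cancel x hx y _ ih => obtain ⟨b, hb⟩ := hx; exact ih.mul_left (inv_mem hb)

/-- Cyclic reduction: up to conjugation, an element lies in one of the two subgroups or is given by
a reduced word whose first and last letters lie in different subgroups. -/
lemma Red.exists_conj {b e : Bool} {l : List G} (hl : Red H b e l) :
    ∃ x ∈ gen H, (∃ c, x⁻¹ * l.prod * x ∈ H c) ∨
      ∃ c m, Red H c (!c) m ∧ m.prod = x⁻¹ * l.prod * x := by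
  induction hn : l.length using Nat.strong_induction_on generalizing b e l with
  | _ n ih =>
  by_cases hbe : e = b
  · subst hbe
    cases hl with
    | @single _ h hh h1 =>
      exact ⟨1, one_mem _, Or.inl ⟨_, by simpa using hh⟩⟩
    | @cons _ _ h l' hh h1 hl' =>
      rcases hl'.snoc with ⟨k, -, he, -, -⟩ | ⟨m, k, hm, hk, hk1, rfl⟩
      · cases e <;> simp at he
      · have hconj : h⁻¹ * (h :: (m ++ [k])).prod * h = m.prod * (k * h) := by
          simp [mul_assoc]
        by_cases hkh : k * h = 1
        · obtain ⟨x, hx, h3⟩ := ih m.length (by rw [← hn]; simp) hm rfl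
          refine ⟨h * x, mul_mem (mem_gen hh) hx, ?_⟩
          have : (h * x)⁻¹ * (h :: (m ++ [k])).prod * (h * x) = x⁻¹ * m.prod * x := by
            rw [mul_inv_rev]
            calc _ = x⁻¹ * (h⁻¹ * (h :: (m ++ [k])).prod * h) * x := by simp only [mul_assoc]
              _ = _ := by rw [hconj, hkh, mul_one]
          rwa [this]
        · refine ⟨h, mem_gen hh, Or.inr ⟨!e, m ++ [k * h], ?_, ?_⟩⟩
          · refine hm.append ?_
            rw [Bool.not_not]
            exact .single (mul_mem hk hh) hkh
          · rw [hconj]; simp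
  · have : e = !b := by cases b <;> cases e <;> simp_all
    subst this
    exact ⟨1, one_mem _, Or.inr ⟨b, l, hl, by simp⟩⟩

end Words

section PingPong

variable {G X : Type*} [Group G] [MetricSpace X] [MulAction G X]

/-- Contracting ping-pong: nontrivial elements of `H b` map `D (!b)` into `D b`, contract it by the
factor `1/2`, and do so ever more strongly, converging to the set `L b` of limit points. -/
structure PingPong (H : Bool → Subgroup G) (D L : Bool → Set X) : Prop where
  isClosed : ∀ b, IsClosed (D b)
  disjoint : ∀ b, Disjoint (D b) (D !b)
  nontrivial : ∀ b, (D b).Nontrivial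
  limit_subset : ∀ b, L b ⊆ D b
  limit_closed : ∀ b, IsClosed (L b)
  limit_nonempty : ∀ b, (L b).Nonempty
  smul_limit : ∀ b, ∀ h ∈ H b, ∀ z ∈ L b, h • z ∈ L b
  mapsTo : ∀ b, ∀ h ∈ H b, h ≠ 1 → ∀ z ∈ D !b, h • z ∈ D b
  contract : ∀ b, ∀ h ∈ H b, h ≠ 1 → ∀ z ∈ D !b, ∀ w ∈ D !b,
    dist (h • z) (h • w) ≤ 1 / 2 * dist z w
  finite_near : ∀ b, ∀ W : Set X, IsOpen W → L b ⊆ W →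
    {h | h ∈ H b ∧ ¬ ∀ z ∈ D !b, h • z ∈ W}.Finite
  finite_contract : ∀ b, ∀ δ : ℝ, 0 < δ →
    {h | h ∈ H b ∧ ¬ ∀ z ∈ D !b, ∀ w ∈ D !b, dist (h • z) (h • w) ≤ δ * dist z w}.Finite

/-- The limit set of a ping-pong group. -/
def pingPongLimit (H : Bool → Subgroup G) (L : Bool → Set X) : Set X :=
  closure {z | ∃ g ∈ gen H, ∃ b, ∃ w ∈ L b, z = g • w}

namespace PingPong

variable {H : Bool → Subgroup G} {D L : Bool → Set X} (P : PingPong H D L)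
include P

lemma not_mem_not {b : Bool} {z : X} (hz : z ∈ D b) : z ∉ D !b :=
  Set.disjoint_left.1 (P.disjoint b) hz

lemma eq_of_mem {b c : Bool} {z : X} (hz : z ∈ D b) (hz' : z ∈ D c) : c = b := by
  by_contra h
  have : c = !b := by cases b <;> cases c <;> simp_all
  subst this
  exact P.not_mem_not hz hz'

lemma word_mapsTo {b e : Bool} {l : List G} (hl : Red H b e l) {z : X} (hz : z ∈ D !e) :
    l.prod • z ∈ D b := by
  induction hl with
  | single hb h1 => simpa using P.mapsTo _ _ hb h1 z hz
  | cons hb h1 hl ih =>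
    rw [List.prod_cons, mul_smul]
    exact P.mapsTo _ _ hb h1 _ (ih hz)

lemma word_dist_le {b e : Bool} {l : List G} (hl : Red H b e l) {z w : X} (hz : z ∈ D !e)
    (hw : w ∈ D !e) : dist (l.prod • z) (l.prod • w) ≤ (1 / 2) ^ l.length * dist z w := by
  induction hl with
  | single hb h1 => simpa using P.contract _ _ hb h1 z hz w hw
  | cons hb h1 hl ih =>
    rw [List.prod_cons, mul_smul, mul_smul, List.length_cons, pow_succ, mul_comm (_ ^ _), mul_assoc]
    refine (P.contract _ _ hb h1 _ (P.word_mapsTo hl hz) _ (P.word_mapsTo hl hw)).trans ?_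
    exact mul_le_mul_of_nonneg_left (ih hz hw) (by norm_num)

lemma word_dist_le_self {b e : Bool} {l : List G} (hl : Red H b e l) {z w : X} (hz : z ∈ D !e)
    (hw : w ∈ D !e) : dist (l.prod • z) (l.prod • w) ≤ 1 / 2 * dist z w := by
  refine (P.word_dist_le hl hz hw).trans (mul_le_mul_of_nonneg_right ?_ dist_nonneg)
  exact pow_le_of_le_one (by norm_num) (by norm_num) hl.length_pos.ne'

lemma prod_ne_one {b e : Bool} {l : List G} (hl : Red H b e l) : l.prod ≠ 1 := by
  intro h
  obtain ⟨z, hz, w, hw, hzw⟩ := P.nontrivial !e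
  have h1 := P.word_dist_le_self hl hz hw
  rw [h, one_smul, one_smul] at h1
  have := dist_pos.2 hzw
  linarith

/-- All but finitely many reduced words contract by the factor `δ`: a long word contracts by a power
of `1 / 2`, and so does a word with a letter that contracts by `δ`. -/
lemma finite_word (δ : ℝ) (hδ : 0 < δ) :
    {g | ∃ b e l, Red H b e l ∧ l.prod = g ∧
      ¬ ∀ z ∈ D !e, ∀ w ∈ D !e, dist (g • z) (g • w) ≤ δ * dist z w}.Finite := by
  set F : Set G := ⋃ b, {h | h ∈ H b ∧ ¬ ∀ z ∈ D !b, ∀ w ∈ D !b,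
    dist (h • z) (h • w) ≤ δ * dist z w} with hF
  have hFfin : F.Finite := Set.finite_iUnion fun b => P.finite_contract b δ hδ
  obtain ⟨n, hn⟩ := exists_pow_lt_of_lt_one hδ (by norm_num : (1 / 2 : ℝ) < 1)
  have hlist : ∀ m : ℕ, {g | ∃ l : List G, (∀ x ∈ l, x ∈ F) ∧ l.length ≤ m ∧ l.prod = g}.Finite := by
    intro m
    induction m with
    | zero =>
      refine (Set.finite_singleton (1 : G)).subset ?_
      rintro g ⟨l, -, hl, rfl⟩
      simp [List.length_eq_zero_iff.1 (Nat.le_zero.1 hl)]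
    | succ m ih =>
      refine ((Set.finite_singleton (1 : G)).union (Set.Finite.image2 (· * ·) hFfin ih)).subset ?_
      rintro g ⟨l, hl, hlen, rfl⟩
      cases l with
      | nil => exact Or.inl (by simp)
      | cons x l =>
        refine Or.inr ⟨x, hl x (by simp), l.prod, ⟨l, fun y hy => hl y (by simp [hy]), ?_, rfl⟩, ?_⟩
        · simpa using hlen
        · simp
  refine (hlist n).subset ?_
  rintro g ⟨b, e, l, hl, rfl, hbad⟩
  refine ⟨l, ?_, ?_, rfl⟩
  · -- one strongly contracting letter makes the whole word strongly contracting
    intro x hx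
    by_contra hxF
    apply hbad
    clear hbad
    induction hl with
    | @single b h hb h1 =>
      have hxh : x = h := by simpa using hx
      subst hxh
      have : x ∉ {h | h ∈ H b ∧ ¬ ∀ z ∈ D !b, ∀ w ∈ D !b,
        dist (h • z) (h • w) ≤ δ * dist z w} := fun hm => hxF (Set.mem_iUnion.2 ⟨b, hm⟩)
      simpa [hb] using this
    | @cons b e h l hb h1 hl ih =>
      intro z hz w hw
      rw [List.prod_cons, mul_smul, mul_smul]
      have hz' := P.word_mapsTo hl hz
      have hw' := P.word_mapsTo hl hw
      rcases List.mem_cons.1 hx with rfl | hx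
      · have : x ∉ {h | h ∈ H b ∧ ¬ ∀ z ∈ D !b, ∀ w ∈ D !b,
          dist (h • z) (h • w) ≤ δ * dist z w} := fun hm => hxF (Set.mem_iUnion.2 ⟨b, hm⟩)
        simp only [Set.mem_ofPred_eq, not_and, not_not] at this
        refine (this hb _ hz' _ hw').trans (mul_le_mul_of_nonneg_left ?_ hδ.le)
        refine (P.word_dist_le_self hl hz hw).trans ?_
        have := dist_nonneg (x := z) (y := w)
        linarith
      · refine (P.contract _ _ hb h1 _ hz' _ hw').trans ?_
        have h2 := ih hx z hz w hw
        have := dist_nonneg (x := l.prod • z) (y := l.prod • w)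
        linarith
  · by_contra hlen
    push Not at hlen
    apply hbad
    intro z hz w hw
    refine (P.word_dist_le hl hz hw).trans (mul_le_mul_of_nonneg_right ?_ dist_nonneg)
    exact (pow_le_pow_of_le_one (by norm_num) (by norm_num) hlen.le).trans hn.le

lemma word_smul_limit {b e : Bool} {l : List G} (hl : Red H b e l) {c : Bool} {w : X}
    (hw : w ∈ L c) : l.prod • w ∈ D b := by
  induction hl with
  | @single b h hb h1 =>
    rw [List.prod_singleton]
    by_cases hc : c = b
    · subst hc
      exact P.limit_subset _ (P.smul_limit _ _ hb _ hw)
    · have : c = !b := by cases b <;> cases c <;> simp_all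
      subst this
      exact P.mapsTo _ _ hb h1 _ (P.limit_subset _ hw)
  | cons hb h1 hl ih =>
    rw [List.prod_cons, mul_smul]
    exact P.mapsTo _ _ hb h1 _ ih

omit P in
lemma limit_subset_limitSet (b : Bool) : L b ⊆ pingPongLimit H L := fun z hz =>
  subset_closure ⟨1, one_mem _, b, z, hz, (one_smul _ _).symm⟩

omit P in
lemma isClosed_limitSet : IsClosed (pingPongLimit H L) := isClosed_closure

omit P in
lemma smul_mem_limitSet [ContinuousConstSMul G X] {g : G} (hg : g ∈ gen H) {z : X}
    (hz : z ∈ pingPongLimit H L) : g • z ∈ pingPongLimit H L := by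
  refine map_mem_closure (continuous_const_smul g) hz ?_
  rintro _ ⟨k, hk, b, w, hw, rfl⟩
  exact ⟨g * k, mul_mem hg hk, b, w, hw, (mul_smul _ _ _).symm⟩

lemma orbit_decomp {b : Bool} {z : X} (hz : z ∈ D b) {g : G} (hg : g ∈ gen H) {c : Bool} {w : X}
    (hw : w ∈ L c) (hzw : z = g • w) :
    z ∈ L b ∨ ∃ h ∈ H b, h ≠ 1 ∧ ∃ z' ∈ D !b, (∃ g ∈ gen H, ∃ c, ∃ w ∈ L c, z' = g • w) ∧
      z = h • z' := by
  rcases isReduced_of_mem hg with rfl | ⟨b', e, l, hl, rfl⟩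
  · rw [one_smul] at hzw
    subst hzw
    have := P.eq_of_mem hz (P.limit_subset _ hw)
    subst this
    exact Or.inl hw
  · have : b' = b := P.eq_of_mem hz (hzw ▸ P.word_smul_limit hl hw)
    subst this
    cases hl with
    | @single _ h hb h1 =>
      rw [List.prod_singleton] at hzw
      by_cases hc : c = b'
      · subst hc
        exact Or.inl (hzw ▸ P.smul_limit _ _ hb _ hw)
      · have : c = !b' := by cases b' <;> cases c <;> simp_all
        subst this
        exact Or.inr ⟨h, hb, h1, w, P.limit_subset _ hw, ⟨1, one_mem _, _, w, hw,
          (one_smul _ _).symm⟩, hzw⟩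
    | @cons _ _ h l hb h1 hl =>
      refine Or.inr ⟨h, hb, h1, l.prod • w, P.word_smul_limit hl hw,
        ⟨_, hl.prod_mem, c, w, hw, rfl⟩, ?_⟩
      rw [hzw, List.prod_cons, mul_smul]

lemma mem_union {z : X} (hz : z ∈ pingPongLimit H L) : ∃ b, z ∈ D b := by
  have h1 : IsClosed (D false ∪ D true) := (P.isClosed _).union (P.isClosed _)
  have h2 : pingPongLimit H L ⊆ D false ∪ D true := by
    refine closure_minimal ?_ h1
    rintro _ ⟨g, hg, b, w, hw, rfl⟩
    have : ∃ c, g • w ∈ D c := by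
      rcases isReduced_of_mem hg with rfl | ⟨b', e, l, hl, rfl⟩
      · exact ⟨b, by rw [one_smul]; exact P.limit_subset _ hw⟩
      · exact ⟨b', P.word_smul_limit hl hw⟩
    obtain ⟨c, hc⟩ := this
    cases c
    · exact Or.inl hc
    · exact Or.inr hc
  rcases h2 hz with h | h
  exacts [⟨_, h⟩, ⟨_, h⟩]

/-- A point of the limit set in `D b` is a limit point of `H b` itself or the image of a point of the
limit set on the other side: only finitely many elements of `H b` move `D (!b)` away from `L b`, so
that the decomposition of orbit points passes to their limits. -/
lemma decomp [ContinuousConstSMul G X] {b : Bool} {z : X} (hz : z ∈ pingPongLimit H L)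
    (hzb : z ∈ D b) :
    z ∈ L b ∨ ∃ h ∈ H b, h ≠ 1 ∧ ∃ z' ∈ pingPongLimit H L, z' ∈ D (!b) ∧ z = h • z' := by
  by_cases hzL : z ∈ L b
  · exact Or.inl hzL
  right
  obtain ⟨W, hW, hLW, hWz⟩ := normal_exists_closure_subset (P.limit_closed b)
    (isOpen_compl_singleton (x := z)) (fun w hw h => hzL (h ▸ hw))
  set F := {h | h ∈ H b ∧ ¬ ∀ z ∈ D !b, h • z ∈ W} with hF
  have hFfin : F.Finite := P.finite_near b W hW hLW
  set S := ⋃ h ∈ F ∩ {1}ᶜ, (h • ·) '' (pingPongLimit H L ∩ D !b) with hS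
  have hSc : IsClosed S := by
    refine (hFfin.inter_of_left _).isClosed_biUnion fun h hh => ?_
    exact (isClosedMap_smul h) _ (isClosed_limitSet.inter (P.isClosed _))
  have hmem : z ∈ closure W ∪ S := by
    have hcl : IsClosed (closure W ∪ S) := isClosed_closure.union hSc
    refine closure_minimal (s := {z | ∃ g ∈ gen H, ∃ b, ∃ w ∈ L b, z = g • w} ∩ (D !b)ᶜ) ?_ hcl ?_
    · rintro y ⟨⟨g, hg, c, w, hw, hy⟩, hyD⟩
      obtain ⟨b', hb'⟩ := P.mem_union (subset_closure ⟨g, hg, c, w, hw, hy⟩ :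
        y ∈ pingPongLimit H L)
      have : b' = b := by
        by_contra h
        have : b' = !b := by cases b <;> cases b' <;> simp_all
        exact hyD (this ▸ hb')
      subst this
      rcases P.orbit_decomp hb' hg hw hy with h | ⟨h, hh, h1, y', hy', ho, rfl⟩
      · exact Or.inl (subset_closure (hLW h))
      · by_cases hhF : h ∈ F
        · exact Or.inr (Set.mem_biUnion (show h ∈ F ∩ {1}ᶜ from ⟨hhF, h1⟩)
            ⟨y', ⟨subset_closure ho, hy'⟩, rfl⟩)
        · simp only [hF, Set.mem_ofPred_eq, not_and, not_not] at hhF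
          exact Or.inl (subset_closure (hhF hh _ hy'))
    · rw [Set.inter_comm]
      exact (P.isClosed _).isOpen_compl.inter_closure ⟨P.not_mem_not hzb, hz⟩
  rcases hmem with h | h
  · exact absurd rfl (hWz h)
  · simp only [hS, Set.mem_iUnion, Set.mem_image] at h
    obtain ⟨h, ⟨hh, h1⟩, z', ⟨hz', hzD'⟩, rfl⟩ := h
    exact ⟨h, hh.1, h1, z', hz', hzD', rfl⟩

/-- Distinct points of the limit set are in general position: they are separated by the ping-pong
after the removal of a common initial word, as words contract. -/
lemma opp_of_ne [ContinuousConstSMul G X] [CompactSpace X] {R : X → X → Prop}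
    (hsymm : ∀ z w, R z w → R w z) (hR : ∀ (g : G) z w, R (g • z) (g • w) ↔ R z w)
    (hD : ∀ b, ∀ z ∈ D b, ∀ w ∈ D !b, R z w) (hL : ∀ b, ∀ z ∈ L b, ∀ w ∈ L b, z ≠ w → R z w)
    {z w : X} (hz : z ∈ pingPongLimit H L) (hw : w ∈ pingPongLimit H L) (hne : z ≠ w) : R z w := by
  by_contra hcon
  have key : ∀ n : ℕ, ∀ z ∈ pingPongLimit H L, ∀ w ∈ pingPongLimit H L, ¬ R z w →
      dist z w ≤ (1 / 2) ^ n * Metric.diam (Set.univ : Set X) := by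
    intro n
    induction n with
    | zero =>
      intro z _ w _ _
      simpa using Metric.dist_le_diam_of_mem (isCompact_univ.isBounded) (Set.mem_univ z)
        (Set.mem_univ w)
    | succ n ih =>
      intro z hz w hw hzw
      have hnn : 0 ≤ (1 / 2 : ℝ) ^ (n + 1) * Metric.diam (Set.univ : Set X) :=
        mul_nonneg (by positivity) Metric.diam_nonneg
      obtain ⟨b, hzb⟩ := P.mem_union hz
      obtain ⟨c, hwc⟩ := P.mem_union hw
      have hcb : c = b := by
        by_contra h
        have : c = !b := by cases b <;> cases c <;> simp_all
        subst this
        exact hzw (hD _ _ hzb _ hwc)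
      subst hcb
      rcases P.decomp hz hzb with hzL | ⟨h, hh, h1, z', hz', hzD', rfl⟩
      · rcases P.decomp hw hwc with hwL | ⟨k, hk, k1, w', hw', hwD', rfl⟩
        · by_cases e : z = w
          · rw [e, dist_self]; exact hnn
          · exact absurd (hL _ _ hzL _ hwL e) hzw
        · refine absurd ?_ hzw
          rw [← hR k⁻¹, inv_smul_smul]
          exact hD _ _ (P.limit_subset _ (P.smul_limit _ _ (inv_mem hk) _ hzL)) _ hwD'
      · rcases P.decomp hw hwc with hwL | ⟨k, hk, k1, w', hw', hwD', rfl⟩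
        · refine absurd (hsymm _ _ ?_) hzw
          rw [← hR h⁻¹, inv_smul_smul]
          exact hD _ _ (P.limit_subset _ (P.smul_limit _ _ (inv_mem hh) _ hwL)) _ hzD'
        · by_cases hhk : h = k
          · subst hhk
            rw [hR] at hzw
            refine (P.contract _ _ hh h1 _ hzD' _ hwD').trans ?_
            rw [pow_succ]
            have := ih _ hz' _ hw' hzw
            linarith
          · refine absurd (hsymm _ _ ?_) hzw
            rw [← hR h⁻¹, inv_smul_smul, ← mul_smul]
            refine hD _ _ (P.mapsTo _ _ (mul_mem (inv_mem hh) hk) ?_ _ hwD') _ hzD'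
            rwa [Ne, inv_mul_eq_one]
  have hlim : Tendsto (fun n : ℕ => (1 / 2 : ℝ) ^ n * Metric.diam (Set.univ : Set X)) atTop
      (𝓝 (0 * Metric.diam (Set.univ : Set X))) :=
    (tendsto_pow_atTop_nhds_zero_of_lt_one (by norm_num) (by norm_num)).mul_const _
  rw [zero_mul] at hlim
  exact (dist_pos.2 hne).not_ge (ge_of_tendsto' hlim fun n => key n z hz w hw hcon)

end PingPong

end PingPong

end RelAnosov

namespace RelAnosov

/-! ### The limit set of a ping-pong group as a Bowditch boundary -/

section Bowditch

variable {G X : Type*} [Group G] [MetricSpace X] [MulAction G X]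

/-- Ping-pong of an infinite group `H false` fixing a point `p` and a torsion free group `H true`
with north-south dynamics on the limit set, with poles `q₁` and `q₂`. -/
structure ParabolicPingPong (H : Bool → Subgroup G) (D L : Bool → Set X) (p q₁ q₂ : X) : Prop
    extends PingPong H D L where
  infinite : Infinite (H false)
  limit_false : L false = {p}
  limit_true : L true = {q₁, q₂}
  ne : q₁ ≠ q₂
  torsionFree : ∀ h ∈ H true, h ≠ 1 → ¬ IsOfFinOrder h
  fix₁ : ∀ h ∈ H true, h • q₁ = q₁
  fix₂ : ∀ h ∈ H true, h • q₂ = q₂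
  northSouth : ∃ h : ℕ → G, (∀ n, h n ∈ H true) ∧
    (∀ z ∈ pingPongLimit H L, z ≠ q₁ → Tendsto (fun n => h n • z) atTop (𝓝 q₂)) ∧
    (∀ z ∈ pingPongLimit H L, z ≠ q₂ → Tendsto (fun n => (h n)⁻¹ • z) atTop (𝓝 q₁))

/-- An equivariant embedding of a space `M` with an action of the group generated by `H` onto the
limit set. -/
structure LimitModel (H : Bool → Subgroup G) (L : Bool → Set X) {M : Type*} [TopologicalSpace M]
    [MulAction (gen H) M] (ι : M → X) : Prop where
  isEmbedding : IsEmbedding ι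
  range_eq : Set.range ι = pingPongLimit H L
  map_smul : ∀ (g : gen H) (m : M), ι (g • m) = (g : G) • ι m

lemma IsConicalLimitPoint.smul {Γ M : Type*} [Group Γ] [TopologicalSpace M] [MulAction Γ M]
    {x : M} (h : IsConicalLimitPoint Γ x) (k : Γ) : IsConicalLimitPoint Γ (k • x) := by
  obtain ⟨g, a, b, hab, h1, h2⟩ := h
  refine ⟨fun n => g n * k⁻¹, a, b, hab, by simpa [mul_smul] using h1, fun y hy => ?_⟩
  simpa [mul_smul] using h2 (k⁻¹ • y) (fun h => hy (by rw [← h, smul_inv_smul]))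

lemma IsLoxodromic.of_conj {Γ M : Type*} [Group Γ] [MulAction Γ M] {g x : Γ}
    (h : IsLoxodromic M (x⁻¹ * g * x)) : IsLoxodromic M g := by
  refine ⟨fun hg => h.1 ?_, ?_⟩
  · obtain ⟨n, hn, hn'⟩ := isOfFinOrder_iff_pow_eq_one.1 hg
    refine isOfFinOrder_iff_pow_eq_one.2 ⟨n, hn, ?_⟩
    have := conj_pow (i := n) (a := x⁻¹) (b := g)
    rw [inv_inv] at this
    rw [this, hn']; simp
  · rw [← h.2]
    have : MulAction.fixedBy M g = (x • ·) '' MulAction.fixedBy M (x⁻¹ * g * x) := by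
      ext m
      constructor
      · intro hm
        refine ⟨x⁻¹ • m, ?_, smul_inv_smul x m⟩
        rw [MulAction.mem_fixedBy] at hm ⊢
        simp [mul_smul, hm]
      · rintro ⟨y, hy, rfl⟩
        rw [MulAction.mem_fixedBy] at hy ⊢
        rw [mul_smul, mul_smul, inv_smul_eq_iff] at hy
        exact hy
    rw [this, Set.ncard_image_of_injective _ (MulAction.injective x)]

namespace PingPong

variable {H : Bool → Subgroup G} {D L : Bool → Set X} (P : PingPong H D L)
include P

/-- A reduced word that contracts `D b` has a fixed point there, namely a point of the limit set at
which the displacement is minimal. -/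
lemma exists_fixed [ContinuousConstSMul G X] [CompactSpace X] {b : Bool} {l : List G}
    (hl : Red H b (!b) l) : ∃ z ∈ pingPongLimit H L, z ∈ D b ∧ l.prod • z = z := by
  have hne : (pingPongLimit H L ∩ D b).Nonempty := by
    obtain ⟨z, hz⟩ := P.limit_nonempty b
    exact ⟨z, limit_subset_limitSet b hz, P.limit_subset b hz⟩
  have hK : IsCompact (pingPongLimit H L ∩ D b) :=
    (isClosed_limitSet.inter (P.isClosed b)).isCompact
  have hmaps : ∀ z ∈ D b, l.prod • z ∈ D b := fun z hz =>
    P.word_mapsTo hl (by rwa [Bool.not_not])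
  obtain ⟨z, ⟨hz, hzD⟩, hmin⟩ := hK.exists_isMinOn hne (f := fun z => dist z (l.prod • z))
    (continuous_id.dist (continuous_const_smul _)).continuousOn
  refine ⟨z, hz, hzD, ?_⟩
  have h1 : dist z (l.prod • z) ≤ dist (l.prod • z) (l.prod • l.prod • z) :=
    hmin ⟨smul_mem_limitSet hl.prod_mem hz, hmaps z hzD⟩
  have h2 := P.word_dist_le_self hl (z := z) (w := l.prod • z) (by rwa [Bool.not_not])
    (by rw [Bool.not_not]; exact hmaps z hzD)
  have h3 : dist z (l.prod • z) = 0 := by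
    have := dist_nonneg (x := z) (y := l.prod • z)
    linarith
  exact (dist_eq_zero.1 h3).symm

lemma fixed_unique {b : Bool} {l : List G} (hl : Red H b (!b) l) {z w : X} (hz : z ∈ D b)
    (hw : w ∈ D b) (hz' : l.prod • z = z) (hw' : l.prod • w = w) : z = w := by
  have h2 := P.word_dist_le_self hl (z := z) (w := w) (by rwa [Bool.not_not])
    (by rwa [Bool.not_not])
  rw [hz', hw'] at h2
  refine dist_eq_zero.1 ?_
  have := dist_nonneg (x := z) (y := w)
  linarith

lemma not_isOfFinOrder_prod {b : Bool} {l : List G} (hl : Red H b (!b) l) :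
    ¬ IsOfFinOrder l.prod := by
  intro h
  obtain ⟨n, hn, h1⟩ := isOfFinOrder_iff_pow_eq_one.1 h
  have key : ∀ m : ℕ, ∃ l' : List G, Red H b (!b) l' ∧ l'.prod = l.prod ^ (m + 1) := by
    intro m
    induction m with
    | zero => exact ⟨l, hl, by simp⟩
    | succ m ih =>
      obtain ⟨l', hl', h2⟩ := ih
      exact ⟨l' ++ l, hl'.append (by rwa [Bool.not_not]), by
        rw [List.prod_append, h2, pow_succ l.prod (m + 1)]⟩
  obtain ⟨l', hl', h2⟩ := key (n - 1)
  rw [Nat.sub_add_cancel hn, h1] at h2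
  exact P.prod_ne_one hl' h2

/-- A nontrivial element of `H b` fixes no point of the limit set outside `L b`. -/
lemma mem_limit_of_fixed [ContinuousConstSMul G X] {b : Bool} {h : G} (hh : h ∈ H b) (h1 : h ≠ 1)
    {z : X} (hz : z ∈ pingPongLimit H L) (hf : h • z = z) : z ∈ L b := by
  have key : ∀ k ∈ H b, k ≠ 1 → ∀ w ∈ D !b, k • w ≠ w := fun k hk k1 w hw he =>
    P.not_mem_not (P.mapsTo b k hk k1 w hw) (by rwa [he])
  obtain ⟨c, hc⟩ := P.mem_union hz
  by_cases hcb : c = b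
  · subst hcb
    rcases P.decomp hz hc with hzL | ⟨k, hk, k1, w, hw, hwD, rfl⟩
    · exact hzL
    · refine absurd ?_ (key (k⁻¹ * h * k) (mul_mem (mul_mem (inv_mem hk) hh) hk) ?_ w hwD)
      · rw [mul_smul, mul_smul, hf, inv_smul_smul]
      · intro he
        apply h1
        have : h = k * (k⁻¹ * h * k) * k⁻¹ := by group
        rw [this, he]; group
  · have : c = !b := by cases b <;> cases c <;> simp_all
    subst this
    exact absurd hf (key h hh h1 z hc)

end PingPong

namespace ParabolicPingPong

variable {H : Bool → Subgroup G} {D L : Bool → Set X} {p q₁ q₂ : X}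
  (P : ParabolicPingPong H D L p q₁ q₂)
include P

lemma p_mem_limit : p ∈ L false := by rw [P.limit_false]; rfl

lemma p_mem : p ∈ D false := P.limit_subset _ P.p_mem_limit

lemma p_mem_limitSet : p ∈ pingPongLimit H L := PingPong.limit_subset_limitSet _ P.p_mem_limit

lemma q₁_mem_limit : q₁ ∈ L true := by rw [P.limit_true]; simp

lemma q₂_mem_limit : q₂ ∈ L true := by rw [P.limit_true]; simp

lemma smul_p {u : G} (hu : u ∈ H false) : u • p = p := by
  have := P.smul_limit _ _ hu _ P.p_mem_limit
  rwa [P.limit_false] at this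

lemma p_ne {z : X} (hz : z ∈ D true) : z ≠ p := by
  rintro rfl
  exact P.not_mem_not hz P.p_mem

lemma mem_of_smul_p {g : G} (hg : g ∈ gen H) (h : g • p = p) : g ∈ H false := by
  rcases isReduced_of_mem hg with rfl | ⟨b, e, l, hl, rfl⟩
  · exact one_mem _
  -- remove a last letter from `H false`
  have key : ∀ (b : Bool) (m : List G), Red H b true m → m.prod • p = p → False := by
    intro b m hm he
    have h1 : m.prod • p ∈ D b := P.word_mapsTo hm P.p_mem
    have hb : b = false := P.eq_of_mem P.p_mem (he ▸ h1)
    subst hb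
    cases hm with
    | @cons _ _ u m hu u1 hm =>
      have h2 := P.word_mapsTo hm P.p_mem
      rw [List.prod_cons, mul_smul] at he
      have h3 : m.prod • p = p := (eq_inv_smul_iff.2 he).trans (P.smul_p (inv_mem hu))
      exact P.p_ne h2 h3
  cases e with
  | true => exact (key b l hl h).elim
  | false =>
    rcases hl.snoc with ⟨k, rfl, rfl, hk, k1⟩ | ⟨m, k, hm, hk, k1, rfl⟩
    · simpa using hk
    · refine (key b m hm ?_).elim
      rw [List.prod_append, List.prod_singleton, mul_smul, P.smul_p hk] at h
      exact h

lemma exists_seq_parabolic : ∃ u : ℕ → G, Function.Injective u ∧ ∀ n, u n ∈ H false ∧ u n ≠ 1 := by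
  have := P.infinite
  have : Infinite {u : H false // u ≠ 1} := by
    refine Set.infinite_coe_iff.2 ?_
    have h := (Set.finite_singleton (1 : H false)).infinite_compl
    exact h
  obtain ⟨f⟩ := Infinite.natEmbedding {u : H false // u ≠ 1} |> Nonempty.intro
  refine ⟨fun n => ((f n).1 : G), fun m n h => f.injective (Subtype.ext (Subtype.ext h)),
    fun n => ⟨(f n).1.2, fun h => (f n).2 (Subtype.ext h)⟩⟩

/-- Points of the limit set are not isolated in it. -/
lemma exists_near [ContinuousConstSMul G X] {z : X} (hz : z ∈ pingPongLimit H L) {ε : ℝ}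
    (hε : 0 < ε) : ∃ w ∈ pingPongLimit H L, w ≠ z ∧ dist w z < ε := by
  -- limit points of the two factors are limits of distinct points
  have key : ∀ b, ∀ q ∈ L b, ∃ w : ℕ → X, (∀ n, w n ∈ pingPongLimit H L ∧ w n ≠ q) ∧
      Tendsto w atTop (𝓝 q) := by
    obtain ⟨h, hh, h1, h2⟩ := P.northSouth
    have hpq : ∀ k ∈ H true, ∀ q, q ∈ L true → k • p ≠ q := by
      intro k hk q hq he
      have : p = k⁻¹ • q := by rw [← he, inv_smul_smul]
      have h3 := P.limit_subset _ (P.smul_limit _ _ (inv_mem hk) _ hq)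
      rw [← this] at h3
      exact P.p_ne h3 rfl
    have hp1 : p ≠ q₁ := fun e => hpq 1 (one_mem _) q₁ P.q₁_mem_limit (by simpa using e)
    have hp2 : p ≠ q₂ := fun e => hpq 1 (one_mem _) q₂ P.q₂_mem_limit (by simpa using e)
    intro b q hq
    cases b with
    | false =>
      rw [P.limit_false] at hq
      obtain rfl : q = p := hq
      obtain ⟨u, hu, hu1⟩ := P.exists_seq_parabolic
      refine ⟨fun n => u n • q₁, fun n => ⟨?_, fun e => ?_⟩, ?_⟩
      · exact PingPong.smul_mem_limitSet (mem_gen (hu1 n).1)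
          (PingPong.limit_subset_limitSet _ P.q₁_mem_limit)
      · have : q₁ = q := by
          rw [← P.smul_p (inv_mem (hu1 n).1), ← e, inv_smul_smul]
        exact hp1 this.symm
      · rw [tendsto_nhds]
        intro W hW hqW
        have hfin := P.finite_near false W hW (by rw [P.limit_false]; simpa using hqW)
        have := hu.tendsto_cofinite.eventually hfin.compl_mem_cofinite
        rw [Nat.cofinite_eq_atTop] at this
        filter_upwards [this] with n hn
        by_contra hcon
        exact hn ⟨(hu1 n).1, fun h => hcon (h _ (P.limit_subset _ P.q₁_mem_limit))⟩
    | true =>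
      rw [P.limit_true] at hq
      rcases hq with rfl | rfl
      · exact ⟨fun n => (h n)⁻¹ • p, fun n => ⟨PingPong.smul_mem_limitSet
          (mem_gen (inv_mem (hh n))) P.p_mem_limitSet, hpq _ (inv_mem (hh n)) _ P.q₁_mem_limit⟩,
          h2 p P.p_mem_limitSet hp2⟩
      · exact ⟨fun n => h n • p, fun n => ⟨PingPong.smul_mem_limitSet
          (mem_gen (hh n)) P.p_mem_limitSet, hpq _ (hh n) _ P.q₂_mem_limit⟩,
          h1 p P.p_mem_limitSet hp1⟩
  obtain ⟨y, ⟨g, hg, b, q, hq, rfl⟩, hy⟩ := Metric.mem_closure_iff.1 hz ε hε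
  by_cases he : g • q = z
  · obtain ⟨w, hw, hlim⟩ := key b q hq
    have h3 : Tendsto (fun n => g • w n) atTop (𝓝 z) := he ▸ hlim.const_smul g
    obtain ⟨n, hn⟩ := (h3.eventually (Metric.ball_mem_nhds z hε)).exists
    refine ⟨g • w n, PingPong.smul_mem_limitSet hg (hw n).1, fun h => (hw n).2 ?_, hn⟩
    exact MulAction.injective g (h.trans he.symm)
  · exact ⟨g • q, PingPong.smul_mem_limitSet hg (PingPong.limit_subset_limitSet b hq), he,
      by rwa [dist_comm]⟩

section Model

variable {M : Type*} [TopologicalSpace M] [MulAction (gen H) M] {ι : M → X}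
  (hM : LimitModel H L ι)

omit P in
lemma _root_.RelAnosov.LimitModel.mem {G X : Type*} [Group G] [MetricSpace X] [MulAction G X]
    {H : Bool → Subgroup G} {L : Bool → Set X} {M : Type*} [TopologicalSpace M]
    [MulAction (gen H) M] {ι : M → X} (hM : LimitModel H L ι) (m : M) :
    ι m ∈ pingPongLimit H L := hM.range_eq ▸ Set.mem_range_self m

omit P in
lemma _root_.RelAnosov.LimitModel.exists_eq {G X : Type*} [Group G] [MetricSpace X] [MulAction G X]
    {H : Bool → Subgroup G} {L : Bool → Set X} {M : Type*} [TopologicalSpace M]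
    [MulAction (gen H) M] {ι : M → X} (hM : LimitModel H L ι) {z : X}
    (hz : z ∈ pingPongLimit H L) : ∃ m, ι m = z := by
  rw [← hM.range_eq] at hz; exact hz

include hM

omit P in
lemma _root_.RelAnosov.LimitModel.compactSpace [CompactSpace X] : CompactSpace M := by
  refine isCompact_univ_iff.1 ?_
  rw [hM.isEmbedding.isInducing.isCompact_iff, Set.image_univ, hM.range_eq]
  exact PingPong.isClosed_limitSet.isCompact

lemma perfectSpace [ContinuousConstSMul G X] : PerfectSpace M := by
  constructor
  intro m _
  rw [accPt_iff_nhds]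
  intro W hW
  rw [hM.isEmbedding.isInducing.nhds_eq_comap, Filter.mem_comap] at hW
  obtain ⟨V, hV, hVW⟩ := hW
  obtain ⟨ε, hε, hball⟩ := Metric.mem_nhds_iff.1 hV
  obtain ⟨w, hw, hne, hd⟩ := P.exists_near (hM.mem m) hε
  obtain ⟨m', rfl⟩ := hM.exists_eq hw
  exact ⟨m', ⟨hVW (hball hd), trivial⟩, fun h => hne (by rw [h])⟩

lemma isLoxodromic_of_red [ContinuousConstSMul G X] [CompactSpace X] {b : Bool} {l : List G}
    (hl : Red H b (!b) l) {g : gen H} (hg : (g : G) = l.prod) : IsLoxodromic M g := by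
  constructor
  · intro h
    refine P.not_isOfFinOrder_prod hl ?_
    rw [← hg]
    exact (gen H).subtype.isOfFinOrder h
  · obtain ⟨z, hz, hzD, hzf⟩ := P.exists_fixed hl
    have hl' : Red H (!b) (!!b) (l.map (·⁻¹)).reverse := by rw [Bool.not_not]; exact hl.inv
    obtain ⟨w, hw, hwD, hwf⟩ := P.exists_fixed hl'
    rw [Red.prod_inv] at hwf
    obtain ⟨m, rfl⟩ := hM.exists_eq hz
    obtain ⟨n, rfl⟩ := hM.exists_eq hw
    rw [Set.ncard_eq_two]
    refine ⟨m, n, fun h => P.not_mem_not hzD (h ▸ hwD), ?_⟩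
    ext k
    rw [MulAction.mem_fixedBy, ← hM.isEmbedding.injective.eq_iff, hM.map_smul, hg]
    constructor
    · intro hk
      obtain ⟨c, hc⟩ := P.mem_union (hM.mem k)
      by_cases hcb : c = b
      · subst hcb
        exact Or.inl (hM.isEmbedding.injective (P.fixed_unique hl hc hzD hk hzf))
      · have : c = !b := by cases b <;> cases c <;> simp_all
        subst this
        refine Or.inr (hM.isEmbedding.injective (P.fixed_unique hl' hc hwD ?_ ?_))
        · rw [Red.prod_inv, inv_smul_eq_iff, hk]
        · rw [Red.prod_inv, hwf]
    · rintro (rfl | rfl)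
      · exact hzf
      · rw [← inv_smul_eq_iff.1 hwf]

lemma isLoxodromic_of_mem [ContinuousConstSMul G X] {g : gen H} (hg : (g : G) ∈ H true)
    (g1 : g ≠ 1) : IsLoxodromic M g := by
  have g1' : (g : G) ≠ 1 := fun h => g1 (Subtype.ext h)
  constructor
  · intro h
    exact P.torsionFree _ hg g1' ((gen H).subtype.isOfFinOrder h)
  · obtain ⟨m, hm⟩ := hM.exists_eq (PingPong.limit_subset_limitSet true P.q₁_mem_limit)
    obtain ⟨n, hn⟩ := hM.exists_eq (PingPong.limit_subset_limitSet true P.q₂_mem_limit)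
    rw [Set.ncard_eq_two]
    refine ⟨m, n, fun h => P.ne (by rw [← hm, ← hn, h]), ?_⟩
    ext k
    rw [MulAction.mem_fixedBy, ← hM.isEmbedding.injective.eq_iff, hM.map_smul]
    constructor
    · intro hk
      have := P.mem_limit_of_fixed hg g1' (hM.mem k) hk
      rw [P.limit_true] at this
      rcases this with h | h
      · exact Or.inl (hM.isEmbedding.injective (h.trans hm.symm))
      · exact Or.inr (hM.isEmbedding.injective (h.trans hn.symm))
    · rintro (rfl | rfl)
      · rw [hm, P.fix₁ _ hg]
      · rw [hn, P.fix₂ _ hg]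

lemma exists_conj_of_not_isLoxodromic [ContinuousConstSMul G X] [CompactSpace X] {g : gen H}
    (hg : ¬ IsLoxodromic M g) : ∃ x : gen H, ((x⁻¹ * g * x : gen H) : G) ∈ H false := by
  rcases isReduced_of_mem g.2 with h | ⟨b, e, l, hl, hlg⟩
  · exact ⟨1, by simp [h]⟩
  obtain ⟨x, hx, h⟩ := hl.exists_conj
  have hc : ((⟨x, hx⟩⁻¹ * g * ⟨x, hx⟩ : gen H) : G) = x⁻¹ * l.prod * x := by rw [hlg]; rfl
  rcases h with ⟨c, hc'⟩ | ⟨c, m, hm, hmp⟩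
  · rw [← hc] at hc'
    cases c with
    | false => exact ⟨_, hc'⟩
    | true =>
      by_cases h1 : (⟨x, hx⟩⁻¹ * g * ⟨x, hx⟩ : gen H) = 1
      · exact ⟨⟨x, hx⟩, by rw [h1]; exact one_mem _⟩
      · exact absurd (P.isLoxodromic_of_mem hM hc' h1).of_conj hg
  · exact absurd (P.isLoxodromic_of_red hM hm (hc.trans hmp.symm)).of_conj hg

/-- The fixed point of the parabolic factor in the model. -/
lemma exists_p : ∃ m : M, ι m = p := hM.exists_eq P.p_mem_limitSet

lemma smul_eq_iff {m : M} (hm : ι m = p) (x g : gen H) :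
    g • x • m = x • m ↔ ((x⁻¹ * g * x : gen H) : G) ∈ H false := by
  rw [← inv_smul_eq_iff, ← mul_smul, ← mul_smul, ← hM.isEmbedding.injective.eq_iff, hM.map_smul,
    hm]
  exact ⟨P.mem_of_smul_p (SetLike.coe_mem _), fun h => P.smul_p h⟩

lemma stabilizer_eq {m : M} (hm : ι m = p) (x : gen H) : MulAction.stabilizer (gen H) (x • m) =
    ((H false).subgroupOf (gen H)).map (MulAut.conj x).toMonoidHom := by
  ext g
  rw [MulAction.mem_stabilizer_iff, P.smul_eq_iff hM hm, Subgroup.mem_map]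
  constructor
  · intro h
    exact ⟨x⁻¹ * g * x, Subgroup.mem_subgroupOf.2 h, by simp [MulAut.conj_apply, mul_assoc]⟩
  · rintro ⟨u, hu, rfl⟩
    simpa [MulAut.conj_apply, mul_assoc] using Subgroup.mem_subgroupOf.1 hu

lemma le_stabilizer_of_parabolic [ContinuousConstSMul G X] [CompactSpace X] {m : M} (hm : ι m = p)
    {A : Subgroup (gen H)} (hA : IsParabolicSubgroup M A) :
    ∃ x : gen H, A ≤ MulAction.stabilizer (gen H) (x • m) := by
  obtain ⟨hinf, ⟨n, hn⟩, hlox⟩ := hA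
  obtain ⟨a, ha⟩ := exists_ne (1 : A)
  obtain ⟨x, hx⟩ := P.exists_conj_of_not_isLoxodromic hM (hlox a a.2)
  have h1 : ((x⁻¹ * a * x : gen H) : G) ≠ 1 := by
    intro h
    have h2 : (x⁻¹ * a * x : gen H) = 1 := Subtype.ext h
    apply ha
    apply Subtype.ext
    have : (a : gen H) = x * (x⁻¹ * a * x) * x⁻¹ := by group
    rw [this, h2]; simp
  have h2 : ι (x⁻¹ • n) ∈ L false := by
    refine P.mem_limit_of_fixed hx h1 (hM.mem _) ?_
    rw [← hM.map_smul, ← mul_smul, mul_assoc, mul_inv_cancel, mul_one, mul_smul, hn a a.2]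
  rw [P.limit_false] at h2
  have h3 : n = x • m := by
    rw [← inv_smul_eq_iff]
    exact hM.isEmbedding.injective (h2.trans hm.symm)
  exact ⟨x, fun k hk => by rw [MulAction.mem_stabilizer_iff, ← h3]; exact hn k hk⟩

lemma isParabolicSubgroup_stabilizer [ContinuousConstSMul G X] {m : M} (hm : ι m = p)
    (x : gen H) : IsParabolicSubgroup M (MulAction.stabilizer (gen H) (x • m)) := by
  refine ⟨?_, ⟨x • m, fun h hh => hh⟩, fun g hg hlox => ?_⟩
  · rw [P.stabilizer_eq hM hm]
    have := P.infinite
    have h2 : Infinite ((H false).subgroupOf (gen H)) :=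
      (Subgroup.subgroupOfEquivOfLe (fun u hu => mem_gen hu : H false ≤ gen H)).toEquiv.infinite_iff.2
        this
    exact (((H false).subgroupOf (gen H)).equivMapOfInjective _
      (MulAut.conj x).injective).toEquiv.infinite_iff.1 h2
  · rw [MulAction.mem_stabilizer_iff, P.smul_eq_iff hM hm] at hg
    by_cases h1 : ((x⁻¹ * g * x : gen H) : G) = 1
    · have h2 : (x⁻¹ * g * x : gen H) = 1 := Subtype.ext h1
      have h3 : g = x * (x⁻¹ * g * x) * x⁻¹ := by group
      rw [h2, mul_one, mul_inv_cancel] at h3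
      exact hlox.1 (h3 ▸ IsOfFinOrder.one)
    · obtain ⟨k₁, k₂, hne, hk⟩ := Set.ncard_eq_two.1 hlox.2
      have key : ∀ k ∈ MulAction.fixedBy M g, k = x • m := by
        intro k hk
        rw [MulAction.mem_fixedBy] at hk
        have h2 : ι (x⁻¹ • k) ∈ L false := by
          refine P.mem_limit_of_fixed hg h1 (hM.mem _) ?_
          rw [← hM.map_smul, ← mul_smul, mul_assoc, mul_inv_cancel, mul_one, mul_smul, hk]
        rw [P.limit_false] at h2
        rw [← inv_smul_eq_iff]
        exact hM.isEmbedding.injective (h2.trans hm.symm)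
      exact hne ((key k₁ (by rw [hk]; simp)).trans (key k₂ (by rw [hk]; simp)).symm)

lemma maximal_parabolic_iff [ContinuousConstSMul G X] [CompactSpace X] (A : Subgroup (gen H)) :
    Maximal (IsParabolicSubgroup M) A ↔
      ∃ x : gen H, A = ((H false).subgroupOf (gen H)).map (MulAut.conj x).toMonoidHom := by
  obtain ⟨m, hm⟩ := P.exists_p hM
  simp_rw [← P.stabilizer_eq hM hm]
  constructor
  · intro h
    obtain ⟨x, hx⟩ := P.le_stabilizer_of_parabolic hM hm h.1
    exact ⟨x, h.eq_of_le (P.isParabolicSubgroup_stabilizer hM hm x) hx⟩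
  · rintro ⟨x, rfl⟩
    have h0 := P.isParabolicSubgroup_stabilizer hM hm x
    refine ⟨h0, fun B hB hle => ?_⟩
    obtain ⟨y, hy⟩ := P.le_stabilizer_of_parabolic hM hm hB
    -- the stabilizer fixes only one point of the orbit
    obtain ⟨hinf, -, -⟩ := h0
    obtain ⟨a, ha⟩ := exists_ne (1 : MulAction.stabilizer (gen H) (x • m))
    have hax := (P.smul_eq_iff hM hm x a).1 a.2
    have hay : (a : gen H) • y • m = y • m := hy (hle a.2)
    have h1 : ((x⁻¹ * a * x : gen H) : G) ≠ 1 := by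
      intro h
      have h2 : (x⁻¹ * a * x : gen H) = 1 := Subtype.ext h
      apply ha
      apply Subtype.ext
      have : (a : gen H) = x * (x⁻¹ * a * x) * x⁻¹ := by group
      rw [this, h2]; simp
    have h2 : ι (x⁻¹ • y • m) ∈ L false := by
      refine P.mem_limit_of_fixed hax h1 (hM.mem _) ?_
      rw [← hM.map_smul, ← mul_smul, mul_assoc, mul_inv_cancel, mul_one, mul_smul, hay]
    rw [P.limit_false] at h2
    have h3 : y • m = x • m := by
      rw [← inv_smul_eq_iff]
      exact hM.isEmbedding.injective (h2.trans hm.symm)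
    rw [← h3]
    exact hy

lemma isBoundedParabolicPoint [ContinuousConstSMul G X] [CompactSpace X] {m : M} (hm : ι m = p)
    (x : gen H) : IsBoundedParabolicPoint (gen H) (x • m) := by
  refine ⟨P.isParabolicSubgroup_stabilizer hM hm x,
    ι ⁻¹' ((fun z => (x : G) • z) '' (pingPongLimit H L ∩ D true)), ?_, ?_, ?_⟩
  · rw [hM.isEmbedding.isInducing.isCompact_iff, Set.image_preimage_eq_inter_range, hM.range_eq]
    exact ((((isClosedMap_smul (x : G)) _
      (PingPong.isClosed_limitSet.inter (P.isClosed _))).inter PingPong.isClosed_limitSet)).isCompact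
  · rintro ⟨z, ⟨hz, hzD⟩, he⟩
    rw [hM.map_smul, hm] at he
    exact P.p_ne hzD (MulAction.injective _ he)
  · intro k hk
    have hk' : ι (x⁻¹ • k) ≠ p := by
      intro h
      apply hk
      rw [← inv_smul_eq_iff]
      exact hM.isEmbedding.injective (h.trans hm.symm)
    have hst : ∀ u : gen H, (u : G) ∈ H false →
        x * u * x⁻¹ ∈ MulAction.stabilizer (gen H) (x • m) := by
      intro u hu
      rw [MulAction.mem_stabilizer_iff, P.smul_eq_iff hM hm]
      simpa [mul_assoc] using hu
    have hmem : ∀ u : gen H, ι (u • x⁻¹ • k) ∈ D true → (x * u * x⁻¹) • k ∈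
        ι ⁻¹' ((fun z => (x : G) • z) '' (pingPongLimit H L ∩ D true)) := by
      intro u hu
      refine ⟨_, ⟨hM.mem _, hu⟩, ?_⟩
      rw [mul_smul, mul_smul, hM.map_smul x]
    obtain ⟨c, hc⟩ := P.mem_union (hM.mem (x⁻¹ • k))
    cases c with
    | true => exact ⟨x * 1 * x⁻¹, hst 1 (one_mem _), hmem 1 (by rwa [one_smul])⟩
    | false =>
      rcases P.decomp (hM.mem _) hc with h | ⟨u, hu, u1, z, hz, hzD, he⟩
      · rw [P.limit_false] at h
        exact absurd h hk'
      · refine ⟨x * ⟨u, mem_gen hu⟩⁻¹ * x⁻¹, hst _ (inv_mem hu), hmem _ ?_⟩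
        rw [hM.map_smul, he]
        simpa using hzD

/-- If the `g n` keep `x` in `D true` and two other points in `D false`, then `x` is conical: one of
the two points converges to the attracting point, which thus lies in `D false`, so that `x` has to be
the repelling point. -/
lemma isConicalLimitPoint_of_seq [CompactSpace X]
    (hconv : IsConvergenceAction (gen H) M) {x z₁ z₂ : M} (hz : z₁ ≠ z₂) {g : ℕ → gen H}
    (hg : Function.Injective g) (hx : ∀ n, ι (g n • x) ∈ D true)
    (h₁ : ∀ n, ι (g n • z₁) ∈ D false) (h₂ : ∀ n, ι (g n • z₂) ∈ D false) :
    IsConicalLimitPoint (gen H) x := by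
  obtain ⟨φ, hφ, b, c, hbc⟩ := hconv.2 g hg
  have hpt : ∀ y : M, y ≠ c → Tendsto (fun n => g (φ n) • y) atTop (𝓝 b) := by
    intro y hy
    rw [tendsto_def]
    intro V hV
    filter_upwards [hbc {y} isCompact_singleton (by simpa using hy.symm) V hV] with n hn
    exact hn y rfl
  have hcl : ∀ i, ∀ y : M, y ≠ c → (∀ n, ι (g n • y) ∈ D i) → ι b ∈ D i := by
    intro i y hy h
    exact (P.isClosed i).mem_of_tendsto ((hM.isEmbedding.continuous.tendsto b).comp (hpt y hy))
      (Eventually.of_forall fun n => h (φ n))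
  have hb : ι b ∈ D false := by
    by_cases h : z₁ = c
    · exact hcl _ z₂ (fun h' => hz (h.trans h'.symm)) h₂
    · exact hcl _ z₁ h h₁
  have hxc : x = c := by
    by_contra h
    exact P.not_mem_not hb (hcl _ x h hx)
  subst hxc
  have hcomp := PingPong.isClosed_limitSet (H := H) (L := L) |>.isCompact
  obtain ⟨a', ha', ψ, hψ, hlim⟩ := hcomp.tendsto_subseq (x := fun n => ι (g (φ n) • x))
    (fun n => hM.mem _)
  obtain ⟨a, rfl⟩ := hM.exists_eq ha'
  have haD : ι a ∈ D true := (P.isClosed true).mem_of_tendsto hlim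
    (Eventually.of_forall fun n => hx _)
  refine ⟨fun n => g (φ (ψ n)), a, b, fun h => P.not_mem_not hb (h ▸ haD), ?_, fun y hy => ?_⟩
  · rw [hM.isEmbedding.isInducing.tendsto_nhds_iff]; exact hlim
  · exact (hpt y hy).comp hψ.tendsto_atTop

lemma isConicalLimitPoint_pole {x : M} (hx : ι x ∈ L true) : IsConicalLimitPoint (gen H) x := by
  obtain ⟨h, hh, h1, h2⟩ := P.northSouth
  obtain ⟨y₁, hy₁⟩ := hM.exists_eq (PingPong.limit_subset_limitSet true P.q₁_mem_limit)
  obtain ⟨y₂, hy₂⟩ := hM.exists_eq (PingPong.limit_subset_limitSet true P.q₂_mem_limit)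
  have hne : y₁ ≠ y₂ := fun h => P.ne (by rw [← hy₁, ← hy₂, h])
  have hfix : ∀ g : gen H, (g : G) ∈ H true → g • y₁ = y₁ ∧ g • y₂ = y₂ := by
    intro g hg
    constructor
    · apply hM.isEmbedding.injective
      rw [hM.map_smul, hy₁, P.fix₁ _ hg]
    · apply hM.isEmbedding.injective
      rw [hM.map_smul, hy₂, P.fix₂ _ hg]
  have hxy : x = y₁ ∨ x = y₂ := by
    rw [P.limit_true] at hx
    rcases hx with h | h
    · exact Or.inl (hM.isEmbedding.injective (h.trans hy₁.symm))
    · exact Or.inr (hM.isEmbedding.injective (h.trans hy₂.symm))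
  rcases hxy with rfl | rfl
  · refine ⟨fun n => ⟨h n, mem_gen (hh n)⟩, x, y₂, hne, ?_, fun y hy => ?_⟩
    · simp_rw [(hfix ⟨h _, mem_gen (hh _)⟩ (hh _)).1]
      exact tendsto_const_nhds
    · rw [hM.isEmbedding.isInducing.tendsto_nhds_iff, hy₂]
      have := h1 (ι y) (hM.mem y) (fun e => hy (hM.isEmbedding.injective (e.trans hy₁.symm)))
      simpa [Function.comp_def, hM.map_smul] using this
  · refine ⟨fun n => ⟨h n, mem_gen (hh n)⟩⁻¹, x, y₁, hne.symm, ?_, fun y hy => ?_⟩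
    · simp_rw [(hfix (⟨h _, mem_gen (hh _)⟩⁻¹) (inv_mem (hh _))).2]
      exact tendsto_const_nhds
    · rw [hM.isEmbedding.isInducing.tendsto_nhds_iff, hy₁]
      have := h2 (ι y) (hM.mem y) (fun e => hy (hM.isEmbedding.injective (e.trans hy₂.symm)))
      simpa [Function.comp_def, hM.map_smul] using this

/-- A point of the limit set that is no translate of a limit point of the factors is described by
an infinite reduced word. The inverses of its initial words show that it is conical. -/
lemma isConicalLimitPoint_of_mem_true [ContinuousConstSMul G X] [CompactSpace X]
    (hconv : IsConvergenceAction (gen H) M) {x : M} (hxD : ι x ∈ D true)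
    (hx : ∀ g : gen H, ∀ b, ι (g • x) ∉ L b) : IsConicalLimitPoint (gen H) x := by
  have step : ∀ y : {y : M // ι y ∈ D true ∧ ∀ g : gen H, ∀ b, ι (g • y) ∉ L b},
      ∃ v : gen H, (∃ l, Red H true false l ∧ l.prod = v) ∧ ι (v⁻¹ • y.1) ∈ D true := by
    rintro ⟨y, hyD, hy⟩
    rcases P.decomp (hM.mem y) hyD with h | ⟨h, hh, h1, z, hz, hzD, he⟩
    · exact absurd (by rwa [one_smul]) (hy 1 true)
    obtain ⟨w, rfl⟩ := hM.exists_eq hz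
    have hyw : (⟨h, mem_gen hh⟩ : gen H)⁻¹ • y = w := by
      rw [inv_smul_eq_iff]
      apply hM.isEmbedding.injective
      rw [he, hM.map_smul]
    rcases P.decomp hz hzD with h' | ⟨u, hu, u1, z, hz, hzD, he'⟩
    · exact absurd (by rwa [hyw]) (hy (⟨h, mem_gen hh⟩⁻¹) false)
    refine ⟨⟨h, mem_gen hh⟩ * ⟨u, mem_gen hu⟩, ⟨[h, u], .cons hh h1 (.single hu u1), by simp⟩, ?_⟩
    rw [mul_inv_rev, mul_smul, hyw, hM.map_smul, he']
    simpa using hzD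
  choose v hv hvD using step
  let f : {y : M // ι y ∈ D true ∧ ∀ g : gen H, ∀ b, ι (g • y) ∉ L b} →
      {y : M // ι y ∈ D true ∧ ∀ g : gen H, ∀ b, ι (g • y) ∉ L b} := fun y =>
    ⟨(v y)⁻¹ • y.1, hvD y, fun g b => by rw [← mul_smul]; exact y.2.2 _ b⟩
  let s : ℕ → {y : M // ι y ∈ D true ∧ ∀ g : gen H, ∀ b, ι (g • y) ∉ L b} := fun n =>
    f^[n] ⟨x, hxD, hx⟩
  have hs : ∀ n, s (n + 1) = f (s n) := fun n => Function.iterate_succ_apply' f n _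
  obtain ⟨w, h0, hw⟩ : ∃ w : ℕ → gen H, w 0 = 1 ∧ ∀ n, w (n + 1) = w n * v (s n) :=
    ⟨fun n => Nat.rec 1 (fun n g => g * v (s n)) n, rfl, fun n => rfl⟩
  have hws : ∀ n, (w n)⁻¹ • x = (s n).1 := by
    intro n
    induction n with
    | zero => rw [h0, inv_one, one_smul]; rfl
    | succ n ih => rw [hw, mul_inv_rev, mul_smul, ih, hs]
  have hred : ∀ n k, ∃ l, Red H true false l ∧ (l.prod : G) = ((w n)⁻¹ * w (n + k + 1) : gen H) := by
    intro n k
    induction k with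
    | zero =>
      obtain ⟨l, hl, h⟩ := hv (s n)
      exact ⟨l, hl, by rw [h, Nat.add_zero, hw, inv_mul_cancel_left]⟩
    | succ k ih =>
      obtain ⟨l, hl, h⟩ := ih
      obtain ⟨l', hl', h'⟩ := hv (s (n + k + 1))
      refine ⟨l ++ l', hl.append hl', ?_⟩
      rw [List.prod_append, h, h', ← Nat.add_assoc, hw (n + k + 1), ← mul_assoc]
      rfl
  obtain ⟨z₁, hz₁⟩ := hM.exists_eq P.p_mem_limitSet
  -- a second point of the limit set in `D false`
  obtain ⟨u, -, hu⟩ := P.exists_seq_parabolic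
  obtain ⟨z₂, hz₂⟩ := hM.exists_eq (PingPong.smul_mem_limitSet (mem_gen (hu 0).1)
    (PingPong.limit_subset_limitSet true P.q₁_mem_limit))
  have hq := P.limit_subset _ P.q₁_mem_limit
  have hz₂D : ι z₂ ∈ D false := by
    rw [hz₂]; exact P.mapsTo false _ (hu 0).1 (hu 0).2 _ hq
  have hne : z₁ ≠ z₂ := by
    rintro rfl
    refine P.p_ne hq ?_
    rw [← P.smul_p (inv_mem (hu 0).1), ← hz₁, hz₂, inv_smul_smul]
  have hmaps : ∀ n, ∀ z : M, ι z ∈ D false → ι ((w (n + 1))⁻¹ • z) ∈ D false := by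
    intro n z hz
    obtain ⟨l, hl, h⟩ := hred 0 n
    rw [h0, inv_one, one_mul, zero_add] at h
    have := P.word_mapsTo hl.inv (z := ι z) hz
    rwa [Red.prod_inv, h, ← Subgroup.coe_inv, ← hM.map_smul] at this
  refine P.isConicalLimitPoint_of_seq hM hconv hne (g := fun n => (w (n + 1))⁻¹) ?_ ?_
    (fun n => hmaps n _ (by rw [hz₁]; exact P.p_mem)) (fun n => hmaps n _ hz₂D)
  · have key : ∀ m n, m < n → w (m + 1) ≠ w (n + 1) := by
      intro m n hmn he
      obtain ⟨k, rfl⟩ := Nat.exists_eq_add_of_lt hmn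
      obtain ⟨l, hl, h⟩ := hred (m + 1) k
      refine P.prod_ne_one hl ?_
      have : m + 1 + k + 1 = m + k + 1 + 1 := by ring
      rw [h, this, ← he, inv_mul_cancel]; rfl
    intro m n h
    have h : w (m + 1) = w (n + 1) := inv_injective h
    by_contra hmn
    rcases lt_or_gt_of_ne hmn with h' | h'
    · exact key m n h' h
    · exact key n m h' h.symm
  · intro n
    rw [hws]
    exact (s (n + 1)).2.1

theorem isBowditchBoundary [ContinuousConstSMul G X] [CompactSpace X]
    (hconv : IsConvergenceAction (gen H) M) :
    IsBowditchBoundary M {(H false).subgroupOf (gen H)} := by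
  obtain ⟨m, hm⟩ := P.exists_p hM
  refine ⟨⟨m⟩, hM.compactSpace, hM.isEmbedding.metrizableSpace, P.perfectSpace hM,
    ⟨hconv, fun x => ?_⟩, fun A => ?_⟩
  · by_cases h : ∃ (g : gen H) (b : Bool), ι (g • x) ∈ L b
    · obtain ⟨g, b, h⟩ := h
      cases b with
      | false =>
        rw [P.limit_false] at h
        right
        have : x = g⁻¹ • m := by
          rw [eq_inv_smul_iff]
          exact hM.isEmbedding.injective (h.trans hm.symm)
        rw [this]
        exact P.isBoundedParabolicPoint hM hm _
      | true =>
        left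
        have := (P.isConicalLimitPoint_pole hM h).smul g⁻¹
        rwa [inv_smul_smul] at this
    · push Not at h
      left
      obtain ⟨c, hc⟩ := P.mem_union (hM.mem x)
      cases c with
      | true => exact P.isConicalLimitPoint_of_mem_true hM hconv hc h
      | false =>
        rcases P.decomp (hM.mem x) hc with h' | ⟨u, hu, u1, z, hz, hzD, he⟩
        · exact absurd (by rwa [one_smul]) (h 1 false)
        obtain ⟨y, rfl⟩ := hM.exists_eq hz
        have hxy : x = (⟨u, mem_gen hu⟩ : gen H) • y := by
          apply hM.isEmbedding.injective
          rw [he, hM.map_smul]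
        rw [hxy]
        refine (P.isConicalLimitPoint_of_mem_true hM hconv hzD fun g b hgb => ?_).smul _
        refine h (g * (⟨u, mem_gen hu⟩ : gen H)⁻¹) b ?_
        rwa [hxy, mul_smul, inv_smul_smul]
  · rw [P.maximal_parabolic_iff hM]
    simp

end Model

end ParabolicPingPong

end Bowditch

end RelAnosov

namespace RelAnosov

/-! ### Finite generation of nilpotent groups -/

open scoped commutatorElement

theorem Subgroup.fg_of_commutative {Q : Type*} [Group Q] [Group.FG Q]
    (hQ : ∀ a b : Q, a * b = b * a) (H : Subgroup Q) : H.FG := by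
  let _ : CommGroup Q := { (inferInstance : Group Q) with mul_comm := hQ }
  have h1 : AddGroup.FG (Additive Q) := GroupFG.iff_add_fg.1 ‹_›
  have h2 : Module.Finite ℤ (Additive Q) := Module.Finite.iff_addGroup_fg.2 h1
  rw [Subgroup.fg_iff_add_fg]
  have h3 : (AddSubgroup.toIntSubmodule H.toAddSubgroup).FG := IsNoetherian.noetherian _
  have h4 := Module.Finite.iff_fg.2 h3
  have h5 : AddGroup.FG H.toAddSubgroup := Module.Finite.iff_addGroup_fg.1 h4
  exact (AddGroup.fg_iff_addSubgroup_fg _).1 h5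

/-- A subgroup is finitely generated if it maps to a finitely generated abelian group with kernel
inside a finitely generated subgroup of it. -/
theorem Subgroup.fg_of_hom {G Q : Type*} [Group G] [Group Q] [Group.FG Q]
    (hQ : ∀ a b : Q, a * b = b * a) {B C : Subgroup G} (hCB : C ≤ B) (hC : C.FG)
    (f : B →* Q) (hf : ∀ b, f b = 1 → (b : G) ∈ C) : B.FG := by
  obtain ⟨T, hT⟩ := Subgroup.fg_of_commutative hQ f.range
  obtain ⟨S, hS⟩ := hC
  have hTr : ∀ t : T, ∃ b : B, f b = t := fun t => by
    have : (t : Q) ∈ f.range := hT ▸ Subgroup.subset_closure t.2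
    exact this
  choose r hr using hTr
  rw [Subgroup.fg_iff]
  refine ⟨(S : Set G) ∪ Set.range (fun t => (r t : G)), ?_,
    S.finite_toSet.union (Set.finite_range _)⟩
  apply le_antisymm
  · rw [Subgroup.closure_le]
    rintro x (hx | ⟨t, rfl⟩)
    · exact hCB (hS ▸ Subgroup.subset_closure hx)
    · exact (r t).2
  · intro b hb
    set L := Subgroup.closure ((S : Set G) ∪ Set.range (fun t => (r t : G)))
    have h1 : f.range ≤ (L.subgroupOf B).map f := by
      rw [← hT, Subgroup.closure_le]
      intro t ht
      refine ⟨r ⟨t, ht⟩, ?_, hr ⟨t, ht⟩⟩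
      exact Subgroup.subset_closure (Or.inr ⟨⟨t, ht⟩, rfl⟩)
    obtain ⟨l, hl, hlb⟩ := h1 ⟨⟨b, hb⟩, rfl⟩
    have hCL : C ≤ L := by
      rw [← hS]; exact Subgroup.closure_mono Set.subset_union_left
    have h2 : ((l⁻¹ * ⟨b, hb⟩ : B) : G) ∈ C := hf _ (by simp [hlb])
    have h3 := L.mul_mem (show (l : G) ∈ L from hl) (hCL h2)
    simpa using h3

/-- An abelian normal subgroup that is maximal among abelian normal subgroups of a nilpotent group
is its own centralizer. -/
theorem exists_selfCentralizing {G : Type*} [Group G] (N : ℕ → Subgroup G) (m : ℕ)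
    (h0 : N 0 = ⊤) (hm : N m = ⊥) (hc : ∀ k, ∀ g : G, ∀ h ∈ N k, ⁅g, h⁆ ∈ N (k + 1)) :
    ∃ A : Subgroup G, (∀ a ∈ A, ∀ b ∈ A, a * b = b * a) ∧ (∀ a ∈ A, ∀ g, g * a * g⁻¹ ∈ A) ∧
      ∀ g, (∀ a ∈ A, g * a = a * g) → g ∈ A := by
  obtain ⟨A, -, hA⟩ := zorn_le_nonempty₀ {A : Subgroup G | (∀ a ∈ A, ∀ b ∈ A, a * b = b * a) ∧
      (∀ a ∈ A, ∀ g, g * a * g⁻¹ ∈ A)} (by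
    intro c hc hch y hy
    refine ⟨sSup c, ?_, fun z hz => le_sSup hz⟩
    have hdir := hch.directedOn
    constructor
    · intro a ha b hb
      obtain ⟨A, hA, haA⟩ := (Subgroup.mem_sSup_of_directedOn ⟨y, hy⟩ hdir).1 ha
      obtain ⟨B, hB, hbB⟩ := (Subgroup.mem_sSup_of_directedOn ⟨y, hy⟩ hdir).1 hb
      obtain ⟨C, hC, hAC, hBC⟩ := hdir A hA B hB
      exact (hc hC).1 a (hAC haA) b (hBC hbB)
    · intro a ha g
      obtain ⟨A, hA, haA⟩ := (Subgroup.mem_sSup_of_directedOn ⟨y, hy⟩ hdir).1 ha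
      exact le_sSup hA ((hc hA).2 a haA g)) ⊥ (by
        constructor
        · simp
        · simp)
  obtain ⟨⟨hAc, hAn⟩, hmax⟩ := hA
  refine ⟨A, hAc, hAn, ?_⟩
  -- the elements of the centralizer lie in `A`, by descending induction along the chain
  have key : ∀ k j, j + k = m → ∀ g ∈ N j, (∀ a ∈ A, g * a = a * g) → g ∈ A := by
    intro k
    induction k with
    | zero =>
      intro j hj g hg _
      obtain rfl : j = m := by simpa using hj
      rw [hm, Subgroup.mem_bot] at hg
      rw [hg]; exact A.one_mem
    | succ k ih =>
      intro j hj x hx hxA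
      have hxg : ∀ g : G, ⁅g, x⁆ ∈ A := by
        intro g
        refine ih (j + 1) (by omega) _ (hc j g x hx) ?_
        intro a ha
        have e1 : g⁻¹ * a * g ∈ A := by simpa using hAn a ha g⁻¹
        have e2 : x * (g⁻¹ * a * g) = (g⁻¹ * a * g) * x := hxA _ e1
        have e3 : x⁻¹ * a = a * x⁻¹ := by
          rw [inv_mul_eq_iff_eq_mul, ← mul_assoc, hxA a ha, mul_assoc, mul_inv_cancel, mul_one]
        rw [commutatorElement_def]
        calc g * x * g⁻¹ * x⁻¹ * a = g * x * g⁻¹ * (x⁻¹ * a) := by group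
          _ = g * (x * (g⁻¹ * a * g)) * g⁻¹ * x⁻¹ := by rw [e3]; group
          _ = a * (g * x * g⁻¹ * x⁻¹) := by rw [e2]; group
      have hle : A ≤ A ⊔ Subgroup.zpowers x := le_sup_left
      have hin : A ⊔ Subgroup.zpowers x ∈ {A : Subgroup G | (∀ a ∈ A, ∀ b ∈ A, a * b = b * a) ∧
          (∀ a ∈ A, ∀ g, g * a * g⁻¹ ∈ A)} := by
        rw [← A.closure_eq, Subgroup.zpowers_eq_closure, ← Subgroup.closure_union]
        have hgen : ∀ y ∈ (A : Set G) ∪ {x}, ∀ z ∈ (A : Set G) ∪ {x}, y * z = z * y := by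
          rintro y (hy | rfl) z (hz | rfl)
          · exact hAc y hy z hz
          · exact (hxA y hy).symm
          · exact hxA z hz
          · rfl
        constructor
        · intro a ha b hb
          have h1 := Subgroup.closure_le_centralizer_centralizer ((A : Set G) ∪ {x}) ha
          rw [Subgroup.mem_centralizer_iff] at h1
          refine (h1 b ?_).symm
          have : Subgroup.closure ((A : Set G) ∪ {x}) ≤
              Subgroup.centralizer ((A : Set G) ∪ {x}) := by
            rw [Subgroup.closure_le]
            intro y hy
            rw [SetLike.mem_coe, Subgroup.mem_centralizer_iff]
            exact fun z hz => hgen z hz y hy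
          exact this hb
        · intro a ha g
          have : Subgroup.closure ((A : Set G) ∪ {x}) ≤
              (Subgroup.closure ((A : Set G) ∪ {x})).comap (MulAut.conj g).toMonoidHom := by
            rw [Subgroup.closure_le]
            rintro y (hy | rfl)
            · exact Subgroup.subset_closure (Or.inl (hAn y hy g))
            · have h1 := Subgroup.subset_closure (k := (A : Set G) ∪ {y}) (Or.inl (hxg g))
              have h2 := Subgroup.subset_closure (k := (A : Set G) ∪ {y}) (Or.inr rfl)
              have h3 := Subgroup.mul_mem _ h1 h2
              simpa [commutatorElement_def] using h3
          exact this ha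
      exact hmax hin hle ((le_sup_right : _ ≤ A ⊔ Subgroup.zpowers x) (Subgroup.mem_zpowers x))
  intro g hg
  exact key m 0 (by simp) g (by rw [h0]; trivial) hg

/-- A nilpotent group all of whose abelian subgroups are finitely generated is finitely
generated. -/
theorem fg_of_central_chain {G : Type*} [Group G] (N : ℕ → Subgroup G) (m : ℕ)
    (h0 : N 0 = ⊤) (hm : N m = ⊥) (hanti : ∀ k, N (k + 1) ≤ N k)
    (hc : ∀ k, ∀ g : G, ∀ h ∈ N k, ⁅g, h⁆ ∈ N (k + 1))
    (hab : ∀ A : Subgroup G, (∀ a ∈ A, ∀ b ∈ A, a * b = b * a) → A.FG) : Group.FG G := by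
  obtain ⟨A, hAc, hAn, hAself⟩ := exists_selfCentralizing N m h0 hm hc
  have hAfg := hab A hAc
  obtain ⟨s, hs⟩ := hAfg
  have hsA : ∀ a ∈ s, a ∈ A := fun a ha => hs ▸ Subgroup.subset_closure ha
  have hcA : ∀ g : G, ∀ a ∈ A, ⁅g, a⁆ ∈ A := fun g a ha =>
    A.mul_mem (hAn a ha g) (A.inv_mem ha)
  have hNn : ∀ k, ∀ h ∈ N k, ∀ g : G, g * h * g⁻¹ ∈ N k := by
    intro k h hh g
    have := (N k).mul_mem (hanti k (hc k g h hh)) hh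
    simpa [commutatorElement_def] using this
  have hmul : ∀ g a b : G, ⁅g, a * b⁆ = ⁅g, a⁆ * (a * ⁅g, b⁆ * a⁻¹) := by
    intro g a b; simp only [commutatorElement_def]; group
  have hmul' : ∀ g h a : G, ⁅g * h, a⁆ = g * ⁅h, a⁆ * g⁻¹ * ⁅g, a⁆ := by
    intro g h a; simp only [commutatorElement_def]; group
  have hinv : ∀ g a : G, ⁅g⁻¹, a⁆ = g⁻¹ * ⁅g, a⁆⁻¹ * g := by
    intro g a; simp only [commutatorElement_def]; group
  -- the elements that move `A` only within `N j`
  let B : ℕ → Subgroup G := fun j =>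
    { carrier := {g | ∀ a ∈ A, ⁅g, a⁆ ∈ N j}
      one_mem' := fun a _ => by simp
      mul_mem' := by
        intro g h hg hh a ha
        rw [hmul']
        exact (N j).mul_mem (hNn j _ (hh a ha) g) (hg a ha)
      inv_mem' := by
        intro g hg a ha
        rw [hinv]
        simpa using hNn j _ ((N j).inv_mem (hg a ha)) g⁻¹ }
  have hB : ∀ j g, g ∈ B j ↔ ∀ a ∈ A, ⁅g, a⁆ ∈ N j := fun j g => Iff.rfl
  have hBfg : ∀ k j, j + k = m → (B j).FG := by
    intro k
    induction k with
    | zero =>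
      intro j hj
      obtain rfl : j = m := by simpa using hj
      have : B j = A := by
        ext g
        rw [hB, hm]
        constructor
        · intro hg
          refine hAself g fun a ha => ?_
          exact commutatorElement_eq_one_iff_mul_comm.1 (Subgroup.mem_bot.1 (hg a ha))
        · intro hg a ha
          exact Subgroup.mem_bot.2 (commutatorElement_eq_one_iff_mul_comm.2 (hAc g hg a ha))
      rw [this]; exact ⟨s, hs⟩
    | succ k ih =>
      intro j hj
      have hC := ih (j + 1) (by omega)
      have : (N (j + 1)).Normal := ⟨fun h hh g => hNn _ h hh g⟩
      have : Group.FG A := (Group.fg_iff_subgroup_fg A).2 ⟨s, hs⟩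
      let Q := A ⧸ (N (j + 1)).subgroupOf A
      have hQ : Group.FG Q := inferInstance
      have hQc : ∀ a b : Q, a * b = b * a := by
        intro a b
        induction a using QuotientGroup.induction_on with | _ a
        induction b using QuotientGroup.induction_on with | _ b
        rw [← QuotientGroup.mk_mul, ← QuotientGroup.mk_mul]
        exact congrArg _ (Subtype.ext (hAc a a.2 b b.2))
      have hQs : Group.FG (s → Q) := by
        rw [Group.fg_def, ← Subgroup.pi_top Set.univ]
        exact Subgroup.FG.pi fun _ => Group.fg_def.1 hQ
      -- commutation with the generators of `A`, modulo `N (j+1)`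
      let f : B j →* (s → Q) := MonoidHom.mk'
        (fun g a => QuotientGroup.mk (⟨⁅(g : G), (a : G)⁆, hcA g a (hsA a a.2)⟩ : A)) (by
          intro g h
          funext a
          have h1 := hsA a a.2
          rw [Pi.mul_apply, hQc]
          refine QuotientGroup.eq.2 ?_
          rw [Subgroup.mem_subgroupOf]
          simp only [Subgroup.coe_mul, Subgroup.coe_inv]
          have h2 : ⁅(g : G), (⁅(h : G), (a : G)⁆)⁻¹⁆ ∈ N (j + 1) :=
            hc j g _ ((N j).inv_mem (h.2 a h1))
          have h4 := hNn (j + 1) _ h2 (⁅(g : G), (a : G)⁆)⁻¹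
          convert h4 using 1
          rw [hmul']
          simp only [commutatorElement_def]
          group)
      refine Subgroup.fg_of_hom (Q := s → Q) (fun a b => funext fun i => hQc _ _)
        (C := B (j + 1)) ?_ hC f ?_
      · intro g hg a ha
        exact hanti j (hg a ha)
      · intro g hg
        have h1 : ∀ a ∈ s, ⁅(g : G), a⁆ ∈ N (j + 1) := by
          intro a ha
          have h2 := congrFun hg ⟨a, ha⟩
          have h3 := (QuotientGroup.eq_one_iff _).1 h2
          exact h3
        intro a ha
        rw [← hs] at ha
        induction ha using Subgroup.closure_induction with
        | mem x hx => exact h1 x hx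
        | one => simp
        | mul x y _ _ hx hy =>
          rw [hmul]
          exact (N _).mul_mem hx (hNn _ _ hy x)
        | inv x _ hx =>
          have e : ⁅(g : G), x⁻¹⁆ = x⁻¹ * ⁅(g : G), x⁆⁻¹ * x⁻¹⁻¹ := by
            simp only [commutatorElement_def]; group
          rw [e]
          exact hNn _ _ ((N _).inv_mem hx) _
  rw [Group.fg_def]
  have : B 0 = ⊤ := by
    ext g; rw [hB, h0]; simp
  rw [← this]
  exact hBfg m 0 (by simp)

/-- A group with a finitely generated subgroup of finite index, given by finitely many left
translates, is finitely generated. -/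
theorem fg_of_finite_translates {G : Type*} [Group G] (H : Subgroup G) (hH : H.FG) (t : Set G)
    (ht : t.Finite) (hG : ∀ g : G, ∃ x ∈ t, x⁻¹ * g ∈ H) : Group.FG G := by
  obtain ⟨s, hs⟩ := hH
  refine Group.fg_iff.2 ⟨(s : Set G) ∪ t, ?_, s.finite_toSet.union ht⟩
  refine eq_top_iff.2 fun g _ => ?_
  obtain ⟨x, hx, hxg⟩ := hG g
  have h1 : H ≤ Subgroup.closure ((s : Set G) ∪ t) := by
    rw [← hs]; exact Subgroup.closure_mono Set.subset_union_left
  have h2 : x ∈ Subgroup.closure ((s : Set G) ∪ t) := Subgroup.subset_closure (Or.inr hx)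
  simpa using Subgroup.mul_mem _ h2 (h1 hxg)

end RelAnosov

namespace RelAnosov

/-! ### Discrete abelian groups of matrices -/

section Exp

variable {B : Type*} [NormedRing B] [NormedAlgebra ℂ B] [FiniteDimensional ℂ B]

theorem finite_setOf_not_isUnit (w : B) : {z : ℂ | ¬ IsUnit (1 + z • w)}.Finite := by
  have hfin : (spectrum ℂ w).Finite := by
    refine Set.Finite.subset ((minpoly ℂ w).rootSet_finite ℂ) ?_
    intro z hz
    have hw : IsIntegral ℂ w := Algebra.IsIntegral.isIntegral w
    have h1 := spectrum.subset_polynomial_aeval w (minpoly ℂ w) ⟨z, hz, rfl⟩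
    rw [minpoly.aeval] at h1
    rw [Polynomial.mem_rootSet]
    refine ⟨minpoly.ne_zero hw, ?_⟩
    have : Nontrivial B := by
      by_contra h
      rw [not_nontrivial_iff_subsingleton] at h
      exact hz (isUnit_of_subsingleton _)
    simpa using h1
  have h2 : {z : ℂ | ¬ IsUnit (1 + z • w)} ⊆ (fun z : ℂ => -z⁻¹) '' spectrum ℂ w := by
    intro z hz
    have hz0 : z ≠ 0 := by
      rintro rfl
      simp at hz
    refine ⟨-z⁻¹, ?_, by simp⟩
    rw [spectrum.mem_iff]
    intro h
    apply hz
    have : (1 + z • w) = (Units.mk0 (-z) (neg_ne_zero.2 hz0)) • (algebraMap ℂ B (-z⁻¹) - w) := by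
      rw [Units.smul_def, Units.val_mk0, Algebra.algebraMap_eq_smul_one, smul_sub, smul_smul]
      simp [hz0]
    rw [this]
    exact (isUnit_smul_iff _ _).2 h
  exact (hfin.image _).subset h2

/-- In a finite-dimensional commutative complex algebra every unit is an exponential: the
exponentials form an open subgroup of the group of units, which is connected. -/
theorem exists_exp_eq (hB : ∀ a b : B, a * b = b * a) (u : Bˣ) :
    ∃ x : B, NormedSpace.exp x = u := by
  let _ : NormedAlgebra ℚ B := NormedAlgebra.restrictScalars ℚ ℂ B
  have : CompleteSpace B := FiniteDimensional.complete ℂ B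
  let S : Subgroup Bˣ :=
    { carrier := {u | ∃ x : B, NormedSpace.exp x = u}
      one_mem' := ⟨0, by simp⟩
      mul_mem' := by
        rintro a b ⟨x, hx⟩ ⟨y, hy⟩
        exact ⟨x + y, by rw [NormedSpace.exp_add_of_commute (hB x y), hx, hy, Units.val_mul]⟩
      inv_mem' := by
        rintro a ⟨x, hx⟩
        refine ⟨-x, ?_⟩
        have h : NormedSpace.exp (-x) * (a : B) = 1 := by
          rw [← hx, ← NormedSpace.exp_add_of_commute (hB _ _)]; simp
        exact (Units.inv_eq_of_mul_eq_one_left h).symm }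
  have hSo : IsOpen (S : Set Bˣ) := by
    refine S.isOpen_of_mem_nhds (g := 1) ?_
    have h1 : Filter.map (NormedSpace.exp : B → B) (𝓝 0) = 𝓝 (NormedSpace.exp 0) :=
      HasStrictFDerivAt.map_nhds_eq_of_equiv (𝕜 := ℂ) (f' := ContinuousLinearEquiv.refl ℂ B)
        (hasStrictFDerivAt_exp_zero (𝕂 := ℂ))
    rw [NormedSpace.exp_zero] at h1
    have h2 : Set.range (NormedSpace.exp : B → B) ∈ 𝓝 (1 : B) := by
      rw [← h1]; exact Filter.range_mem_map
    exact (Units.continuous_val.tendsto (1 : Bˣ)) h2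
  have hSc := S.isClosed_of_isOpen hSo
  let C : Set ℂ := {z : ℂ | ¬ IsUnit (1 + z • ((u : B) - 1))}ᶜ
  have hC : IsPreconnected C :=
    ((finite_setOf_not_isUnit ((u : B) - 1)).countable.isPathConnected_compl_of_one_lt_rank
      (by rw [Complex.rank_real_complex]; norm_num)).isConnected.isPreconnected
  have hCu : ∀ z : C, IsUnit (1 + (z : ℂ) • ((u : B) - 1)) := fun z => not_not.1 z.2
  let f : C → Bˣ := fun z => (hCu z).unit
  have hf : Continuous f := by
    refine Units.isOpenEmbedding_val.isInducing.continuous_iff.2 ?_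
    change Continuous fun z : C => 1 + (z : ℂ) • ((u : B) - 1)
    fun_prop
  have : PreconnectedSpace C := isPreconnected_iff_preconnectedSpace.1 hC
  have h1 : (1 : ℂ) ∈ C := by simp [C]
  have h0 : (0 : ℂ) ∈ C := by simp [C]
  have hsub := (isPreconnected_range hf).subset_isClopen ⟨hSc, hSo⟩
    ⟨1, ⟨⟨0, h0⟩, Units.ext (by simp [f])⟩, S.one_mem⟩
  have : u ∈ S := hsub ⟨⟨1, h1⟩, Units.ext (by simp [f])⟩
  exact this

/-- A discrete subgroup of the group of units of a finite-dimensional commutative complex algebra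
is finitely generated: its preimage under the exponential map is a discrete subgroup of a vector
space. -/
theorem fg_of_discrete_units (hB : ∀ a b : B, a * b = b * a) (A : Subgroup Bˣ) (V : Set B)
    (hV : V ∈ 𝓝 (1 : B)) (hA : ∀ a ∈ A, (a : B) ∈ V → a = 1) : A.FG := by
  let _ : NormedAlgebra ℚ B := NormedAlgebra.restrictScalars ℚ ℂ B
  let _ : NormedSpace ℝ B := NormedSpace.restrictScalars ℝ ℂ B
  have : CompleteSpace B := FiniteDimensional.complete ℂ B
  have : FiniteDimensional ℝ B := FiniteDimensional.trans ℝ ℂ B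
  have hstrict := hasStrictFDerivAt_exp_zero (𝕂 := ℂ) (𝔸 := B)
  let L : AddSubgroup B :=
    { carrier := {x | ∃ a ∈ A, NormedSpace.exp x = (a : B)}
      zero_mem' := ⟨1, A.one_mem, by simp⟩
      add_mem' := by
        rintro x y ⟨a, ha, hx⟩ ⟨b, hb, hy⟩
        exact ⟨a * b, A.mul_mem ha hb, by
          rw [NormedSpace.exp_add_of_commute (hB x y), hx, hy, Units.val_mul]⟩
      neg_mem' := by
        rintro x ⟨a, ha, hx⟩
        refine ⟨a⁻¹, A.inv_mem ha, ?_⟩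
        have h : NormedSpace.exp (-x) * (a : B) = 1 := by
          rw [← hx, ← NormedSpace.exp_add_of_commute (hB _ _)]; simp
        exact (Units.inv_eq_of_mul_eq_one_left h).symm }
  have hdisc : DiscreteTopology (AddSubgroup.toIntSubmodule L) := by
    have hinj : ∃ W ∈ 𝓝 (0 : B), Set.InjOn (NormedSpace.exp : B → B) W := by
      let e := HasStrictFDerivAt.toOpenPartialHomeomorph (NormedSpace.exp : B → B)
        (f' := ContinuousLinearEquiv.refl ℂ B) hstrict
      exact ⟨e.source, e.open_source.mem_nhds (HasStrictFDerivAt.mem_toOpenPartialHomeomorph_source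
        (f' := ContinuousLinearEquiv.refl ℂ B) hstrict), e.injOn⟩
    obtain ⟨W, hW, hWinj⟩ := hinj
    have hV' : (NormedSpace.exp : B → B) ⁻¹' V ∈ 𝓝 (0 : B) := by
      apply hstrict.continuousAt
      simpa using hV
    rw [discreteTopology_iff_isOpen_singleton_zero, isOpen_iff_mem_nhds]
    rintro x rfl
    rw [nhds_subtype_eq_comap]
    refine ⟨_, inter_mem hW hV', ?_⟩
    rintro ⟨y, a, ha, hy⟩ ⟨h1, h2⟩
    have h3 : a = 1 := hA a ha (by rw [← hy]; exact h2)
    refine Subtype.ext (hWinj h1 (mem_of_mem_nhds hW) ?_)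
    change NormedSpace.exp y = _
    rw [hy, h3]; simp
  have hfin : Module.Finite ℤ (AddSubgroup.toIntSubmodule L) := inferInstance
  have hfg : AddGroup.FG L := Module.Finite.iff_addGroup_fg.1 hfin
  have hfg' : Group.FG (Multiplicative L) := AddGroup.fg_iff_mul_fg.1 hfg
  have hex : ∀ x : L, ∃ a : A, NormedSpace.exp (x : B) = ((a : Bˣ) : B) := by
    rintro ⟨x, a, ha, h⟩; exact ⟨⟨a, ha⟩, h⟩
  choose F hF using hex
  let φ : Multiplicative L →* A := MonoidHom.mk' (fun x => F x.toAdd) (by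
    intro x y
    refine Subtype.ext (Units.ext ?_)
    rw [← hF, Subgroup.coe_mul, Units.val_mul, ← hF, ← hF,
      ← NormedSpace.exp_add_of_commute (hB _ _)]
    rfl)
  have hφ : Function.Surjective φ := by
    intro a
    obtain ⟨x, hx⟩ := exists_exp_eq hB (a : Bˣ)
    refine ⟨Multiplicative.ofAdd ⟨x, a, a.2, hx⟩, Subtype.ext (Units.ext ?_)⟩
    exact (hF _).symm.trans hx
  exact (Group.fg_iff_subgroup_fg A).1 (Group.fg_of_surjective hφ)

end Exp

/-- An abelian group with an injective representation of discrete image on a finite-dimensional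
complex space is finitely generated. -/
theorem fg_of_discrete_commutative {A R : Type*} [Group A] [NormedRing R] [NormedAlgebra ℂ R]
    [FiniteDimensional ℂ R] (f : A →* R) (hA : ∀ a b : A, a * b = b * a) (V : Set R)
    (hV : V ∈ 𝓝 (1 : R)) (hf : ∀ a, f a ∈ V → a = 1) : Group.FG A := by
  let B := Algebra.adjoin ℂ (Set.range f)
  have hB : ∀ a b : B, a * b = b * a := by
    have : IsMulCommutative B := Algebra.isMulCommutative_adjoin ℂ (by
      rintro _ ⟨a, rfl⟩ _ ⟨b, rfl⟩
      rw [← map_mul, hA, map_mul])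
    exact fun a b => this.is_comm.comm a b
  let f₁ : A →* B :=
    { toFun := fun a => ⟨f a, Algebra.subset_adjoin ⟨a, rfl⟩⟩
      map_one' := Subtype.ext (map_one f)
      map_mul' := fun a b => Subtype.ext (map_mul f a b) }
  let f₂ : A →* Bˣ := f₁.toHomUnits
  have hval : ∀ a, ((f₂ a : B) : R) = f a := fun a => rfl
  have hV' : ((↑) : B → R) ⁻¹' V ∈ 𝓝 (1 : B) := continuous_subtype_val.continuousAt hV
  have h1 := fg_of_discrete_units hB f₂.range _ hV' (by
    rintro _ ⟨a, rfl⟩ ha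
    rw [hf a (by rw [← hval]; exact ha), map_one])
  have hinj : Function.Injective f₂ := by
    rw [injective_iff_map_eq_one]
    intro a ha
    refine hf a ?_
    rw [← hval, ha]
    exact mem_of_mem_nhds hV
  have h2 := (Group.fg_iff_subgroup_fg _).2 h1
  exact Group.fg_of_surjective (f := (MonoidHom.ofInjective hinj).symm.toMonoidHom)
    (MonoidHom.ofInjective hinj).symm.surjective

end RelAnosov

namespace RelAnosov

/-! ### Block decompositions and contraction to the diagonal -/

/-- A complete system of `m` orthogonal idempotents of a ring, extended by `0`: the block
decomposition given by a flag with a choice of complements. -/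
structure IsBlocks {R : Type*} [Ring R] (q : ℕ → R) (m : ℕ) : Prop where
  idem : ∀ i, q i * q i = q i
  orth : ∀ i j, i ≠ j → q i * q j = 0
  zero : ∀ i, m ≤ i → q i = 0
  sum : ∑ i ∈ Finset.range m, q i = 1

/-- The elements of a ring with blocks that raise the block index by at least `k`; for `k = 0` these
are the (lower) block triangular ones. -/
def Raises {R : Type*} [Ring R] (q : ℕ → R) (k : ℕ) (x : R) : Prop :=
  ∀ i j, i < j + k → q i * x * q j = 0

/-- The part of `x` that raises the block index by exactly `k`; for `k = 0`, the block diagonal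
part. -/
def diagPart {R : Type*} [Ring R] (q : ℕ → R) (m k : ℕ) (x : R) : R :=
  ∑ j ∈ Finset.range m, q (j + k) * x * q j

section Ring

variable {R : Type*} [Ring R] {q : ℕ → R} {m : ℕ}

theorem Raises.mono {k l : ℕ} (hkl : k ≤ l) {x : R} (hx : Raises q l x) : Raises q k x :=
  fun i j h => hx i j (by omega)

theorem Raises.add {k : ℕ} {x y : R} (hx : Raises q k x) (hy : Raises q k y) :
    Raises q k (x + y) := fun i j h => by
  rw [mul_add, add_mul, hx i j h, hy i j h, add_zero]

theorem Raises.neg {k : ℕ} {x : R} (hx : Raises q k x) : Raises q k (-x) := fun i j h => by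
  rw [mul_neg, neg_mul, hx i j h, neg_zero]

theorem Raises.sub {k : ℕ} {x y : R} (hx : Raises q k x) (hy : Raises q k y) :
    Raises q k (x - y) := by
  rw [sub_eq_add_neg]; exact hx.add hy.neg

theorem Raises.zero (k : ℕ) : Raises q k (0 : R) := fun i j _ => by simp

theorem diagPart_sub (k : ℕ) (x y : R) :
    diagPart q m k (x - y) = diagPart q m k x - diagPart q m k y := by
  simp [diagPart, mul_sub, sub_mul, Finset.sum_sub_distrib]

theorem IsBlocks.split (hq : IsBlocks q m) (x y : R) :
    x * y = ∑ s ∈ Finset.range m, x * q s * (q s * y) := by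
  have : ∀ s, x * q s * (q s * y) = x * q s * y := fun s => by
    rw [mul_assoc, ← mul_assoc (q s) (q s), hq.idem, mul_assoc]
  simp_rw [this]
  rw [← Finset.sum_mul, ← Finset.mul_sum, hq.sum, mul_one]

theorem IsBlocks.raises_mul (hq : IsBlocks q m) {k l : ℕ} {x y : R} (hx : Raises q k x)
    (hy : Raises q l y) : Raises q (k + l) (x * y) := by
  intro i j hij
  have : q i * (x * y) * q j = (q i * x) * (y * q j) := by simp only [mul_assoc]
  rw [this, hq.split]
  refine Finset.sum_eq_zero fun s _ => ?_
  by_cases h : i < s + k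
  · rw [hx i s h, zero_mul]
  · rw [← mul_assoc (q s), hy s j (by omega), mul_zero]

theorem IsBlocks.raises_one (hq : IsBlocks q m) : Raises q 0 (1 : R) := fun i j h => by
  rw [mul_one, hq.orth i j (by omega)]

theorem IsBlocks.eq_zero_of_raises (hq : IsBlocks q m) {x : R} (hx : Raises q m x) : x = 0 := by
  have h1 : ∀ i j, q i * x * q j = 0 := fun i j => by
    by_cases h : i < m
    · exact hx i j (by omega)
    · rw [hq.zero i (by omega)]; simp
  calc x = (∑ i ∈ Finset.range m, q i) * x * ∑ j ∈ Finset.range m, q j := by rw [hq.sum]; simp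
    _ = 0 := by
      rw [Finset.sum_mul, Finset.sum_mul]
      refine Finset.sum_eq_zero fun i _ => ?_
      rw [Finset.mul_sum]
      exact Finset.sum_eq_zero fun j _ => h1 i j

theorem IsBlocks.diagPart_one (hq : IsBlocks q m) : diagPart q m 0 (1 : R) = 1 := by
  simp only [diagPart, add_zero, mul_one, hq.idem, hq.sum]

theorem diagPart_eq_zero {k : ℕ} {x : R} (hx : Raises q (k + 1) x) : diagPart q m k x = 0 :=
  Finset.sum_eq_zero fun j _ => hx _ _ (by omega)

theorem IsBlocks.diagPart_mul (hq : IsBlocks q m) {k l : ℕ} {x y : R} (hx : Raises q k x)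
    (hy : Raises q l y) :
    diagPart q m (k + l) (x * y) = diagPart q m k x * diagPart q m l y := by
  rw [diagPart, diagPart, diagPart, Finset.mul_sum]
  refine Finset.sum_congr rfl fun j hj => ?_
  rw [Finset.sum_mul]
  have e1 : ∀ s, q (s + k) * x * q s * (q (j + l) * y * q j) =
      if s = j + l then q (j + l + k) * x * q (j + l) * (y * q j) else 0 := by
    intro s
    split_ifs with h
    · subst h
      simp only [mul_assoc]
      rw [← mul_assoc (q (j + l)) (q (j + l)), hq.idem]
    · simp only [mul_assoc]
      rw [← mul_assoc (q s) (q (j + l)), hq.orth s _ h]; simp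
  have e2 : q (j + (k + l)) * (x * y) * q j =
      ∑ s ∈ Finset.range m, if s = j + l then q (j + l + k) * x * q (j + l) * (y * q j) else 0 := by
    have : q (j + (k + l)) * (x * y) * q j = (q (j + (k + l)) * x) * (y * q j) := by
      simp only [mul_assoc]
    rw [this, hq.split]
    refine Finset.sum_congr rfl fun s _ => ?_
    split_ifs with h
    · subst h
      rw [show j + (k + l) = j + l + k by ring]
      simp only [mul_assoc]
      rw [← mul_assoc (q (j + l)) (q (j + l)), hq.idem]
    · rcases lt_or_gt_of_ne h with h | h
      · rw [← mul_assoc (q s), hy s j h, mul_zero]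
      · rw [hx _ s (by omega), zero_mul]
  rw [e2]
  exact Finset.sum_congr rfl fun s _ => (e1 s).symm

theorem IsBlocks.raises_succ (hq : IsBlocks q m) {k : ℕ} {x : R} (hx : Raises q k x)
    (h : diagPart q m k x = 0) : Raises q (k + 1) x := by
  intro i j hij
  by_cases hi : i < j + k
  · exact hx i j hi
  obtain rfl : i = j + k := by omega
  by_cases hj : j < m
  · have h1 : q (j + k) * diagPart q m k x * q j = q (j + k) * x * q j := by
      rw [diagPart, Finset.mul_sum, Finset.sum_mul,
        Finset.sum_eq_single j]
      · simp only [mul_assoc]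
        rw [hq.idem, ← mul_assoc (q (j + k)) (q (j + k)), hq.idem]
      · intro s _ hs
        rw [mul_assoc, mul_assoc, hq.orth s j hs]; simp
      · intro h; simp at h; omega
    rw [← h1, h]; simp
  · rw [hq.zero j (by omega), mul_zero]

end Ring

section Normed

variable {R : Type*} [NormedRing R] [NormedAlgebra ℝ R] {q : ℕ → R} {m : ℕ}

/-- The element acting on the `i`-th block as multiplication by `t ^ i`. Conjugation by it contracts
the off-diagonal blocks as `t → ∞`. -/
def scaling (q : ℕ → R) (m : ℕ) (t : ℝ) : R := ∑ i ∈ Finset.range m, t ^ i • q i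

theorem IsBlocks.scaling_mul (hq : IsBlocks q m) (s t : ℝ) :
    scaling q m s * scaling q m t = scaling q m (s * t) := by
  rw [scaling, scaling, scaling, Finset.sum_mul]
  refine Finset.sum_congr rfl fun i hi => ?_
  rw [Finset.mul_sum, Finset.sum_eq_single i]
  · rw [smul_mul_smul_comm, hq.idem, mul_pow]
  · intro j _ hj
    rw [smul_mul_smul_comm, hq.orth i j hj.symm, smul_zero]
  · intro h; exact absurd hi h

theorem IsBlocks.scaling_one (hq : IsBlocks q m) : scaling q m (1 : ℝ) = 1 := by
  simp [scaling, hq.sum]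

theorem tendsto_conj_scaling {x : R} (hx : Raises q 0 x) :
    Tendsto (fun t : ℝ => scaling q m t⁻¹ * x * scaling q m t) atTop
      (𝓝 (diagPart q m 0 x)) := by
  have e : ∀ t : ℝ, scaling q m t⁻¹ * x * scaling q m t =
      ∑ i ∈ Finset.range m, ∑ j ∈ Finset.range m, (t⁻¹ ^ i * t ^ j) • (q i * x * q j) := by
    intro t
    rw [scaling, scaling, Finset.sum_mul, Finset.sum_mul]
    refine Finset.sum_congr rfl fun i _ => ?_
    rw [Finset.mul_sum]
    refine Finset.sum_congr rfl fun j _ => ?_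
    rw [smul_mul_assoc, smul_mul_smul_comm]
  have e2 : diagPart q m 0 x =
      ∑ i ∈ Finset.range m, ∑ j ∈ Finset.range m, if i = j then q i * x * q j else 0 := by
    refine Finset.sum_congr rfl fun i hi => ?_
    rw [Finset.sum_ite_eq, if_pos hi, add_zero]
  simp_rw [e]
  rw [e2]
  refine tendsto_finsetSum _ fun i _ => tendsto_finsetSum _ fun j _ => ?_
  split_ifs with h
  · subst h
    refine tendsto_const_nhds.congr' ?_
    filter_upwards [eventually_gt_atTop 0] with t ht
    rw [← mul_pow, inv_mul_cancel₀ ht.ne', one_pow, one_smul]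
  · rcases lt_or_gt_of_ne h with h | h
    · rw [hx i j (by omega)]
      simp
    · have h1 : Tendsto (fun t : ℝ => t⁻¹ ^ (i - j)) atTop (𝓝 0) := by
        have := (tendsto_inv_atTop_zero (𝕜 := ℝ)).pow (i - j)
        rwa [zero_pow (by omega)] at this
      have h2 := h1.smul_const (q i * x * q j)
      rw [zero_smul] at h2
      refine h2.congr' ?_
      filter_upwards [eventually_gt_atTop 0] with t ht
      congr 1
      rw [show i = (i - j) + j by omega, pow_add, mul_assoc, ← mul_pow, inv_mul_cancel₀ ht.ne',
        one_pow, mul_one, Nat.add_sub_cancel]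

end Normed

end RelAnosov

namespace RelAnosov

/-! ### Discrete groups that are block triangular with bounded diagonal part -/

open scoped commutatorElement

section Commutators

variable {G R : Type*} [Group G] [NormedRing R]

theorem norm_commutator_sub_one_le [NormOneClass R] (f : G →* R) {g h : G}
    (hg : ‖f g - 1‖ ≤ 1 / 16) (hh : ‖f h - 1‖ ≤ 1 / 16) :
    ‖f ⁅g, h⁆ - 1‖ ≤ 1 / 2 * ‖f h - 1‖ := by
  have hinv : ∀ x : G, ‖f x - 1‖ ≤ 1 / 16 → ‖f x⁻¹‖ ≤ 2 := by
    intro x hx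
    have e : f x⁻¹ = 1 - f x⁻¹ * (f x - 1) := by
      rw [mul_sub, ← map_mul, inv_mul_cancel, map_one, mul_one]; abel
    have h1 : ‖f x⁻¹‖ ≤ 1 + ‖f x⁻¹‖ * (1 / 16) := by
      calc ‖f x⁻¹‖ = ‖1 - f x⁻¹ * (f x - 1)‖ := by rw [← e]
        _ ≤ ‖(1 : R)‖ + ‖f x⁻¹ * (f x - 1)‖ := norm_sub_le _ _
        _ ≤ 1 + ‖f x⁻¹‖ * (1 / 16) := by
          rw [norm_one]
          gcongr
          exact (norm_mul_le _ _).trans (by gcongr)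
    linarith
  have e : f ⁅g, h⁆ - 1 =
      ((f g - 1) * (f h - 1) - (f h - 1) * (f g - 1)) * f g⁻¹ * f h⁻¹ := by
    have e1 : ((f g - 1) * (f h - 1) - (f h - 1) * (f g - 1)) = f g * f h - f h * f g := by
      noncomm_ring
    rw [e1, sub_mul, sub_mul, commutatorElement_def, map_mul, map_mul, map_mul]
    congr 1
    rw [mul_assoc (f h), ← map_mul f g, mul_inv_cancel, map_one, mul_one, ← map_mul,
      mul_inv_cancel, map_one]
  rw [e]
  calc _ ≤ ‖(f g - 1) * (f h - 1) - (f h - 1) * (f g - 1)‖ * ‖f g⁻¹‖ * ‖f h⁻¹‖ :=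
        (norm_mul_le _ _).trans (by gcongr; exact norm_mul_le _ _)
    _ ≤ (‖f g - 1‖ * ‖f h - 1‖ + ‖f h - 1‖ * ‖f g - 1‖) * 2 * 2 := by
        gcongr
        · exact (norm_sub_le _ _).trans (add_le_add (norm_mul_le _ _) (norm_mul_le _ _))
        · exact hinv g hg
        · exact hinv h hh
    _ ≤ 1 / 2 * ‖f h - 1‖ := by nlinarith [norm_nonneg (f h - 1), norm_nonneg (f g - 1)]

theorem norm_iterate_commutator_le [NormOneClass R] (f : G →* R) {g h : G}
    (hg : ‖f g - 1‖ ≤ 1 / 16) (hh : ‖f h - 1‖ ≤ 1 / 16) (n : ℕ) :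
    ‖f ((fun x => ⁅g, x⁆)^[n] h) - 1‖ ≤ (1 / 2) ^ n * ‖f h - 1‖ := by
  induction n with
  | zero => simp
  | succ n ih =>
    rw [Function.iterate_succ_apply']
    have h1 : ‖f ((fun x => ⁅g, x⁆)^[n] h) - 1‖ ≤ 1 / 16 := by
      refine ih.trans (le_trans ?_ hh)
      exact mul_le_of_le_one_left (norm_nonneg _) (pow_le_one₀ (by norm_num) (by norm_num))
    have h2 := norm_commutator_sub_one_le f hg h1
    rw [pow_succ]
    linarith

/-- A ring element all of whose powers are close to `1` is `1`. -/
theorem eq_one_of_norm_pow_sub_one_le {x : R} [NormedAlgebra ℝ R]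
    (hx : ∀ n : ℕ, ‖x ^ n - 1‖ ≤ 1 / 2) : x = 1 := by
  -- `‖x ^ n - 1‖ ≤ (1/2) (3/4) ^ k` for all `n`, by induction on `k`
  have key : ∀ k n : ℕ, ‖x ^ n - 1‖ ≤ 1 / 2 * (3 / 4) ^ k := by
    intro k
    induction k with
    | zero => simpa using hx
    | succ k ih =>
      intro n
      have e : (2 : ℝ) • (x ^ n - 1) = (x ^ (2 * n) - 1) - (x ^ n - 1) * (x ^ n - 1) := by
        rw [two_smul, two_mul, pow_add]; noncomm_ring
      have h1 : 2 * ‖x ^ n - 1‖ ≤ ‖x ^ (2 * n) - 1‖ + ‖x ^ n - 1‖ * ‖x ^ n - 1‖ := by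
        have := congrArg norm e
        rw [norm_smul, Real.norm_ofNat] at this
        rw [this]
        exact (norm_sub_le _ _).trans (by gcongr; exact norm_mul_le _ _)
      have h2 := ih (2 * n)
      have h3 := hx n
      have h4 := ih n
      rw [pow_succ]
      nlinarith [norm_nonneg (x ^ n - 1)]
  have h1 : Tendsto (fun k : ℕ => (1 / 2 : ℝ) * (3 / 4) ^ k) atTop (𝓝 (1 / 2 * 0)) :=
    (tendsto_pow_atTop_nhds_zero_of_lt_one (by norm_num) (by norm_num)).const_mul _
  have h2 : ‖x - 1‖ ≤ 1 / 2 * 0 := ge_of_tendsto' h1 fun k => by simpa using key k 1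
  rw [mul_zero] at h2
  exact sub_eq_zero.1 (norm_le_zero_iff.1 h2)

/-- In a bounded group of matrices, if `[g, h]` commutes with `g` and `h` is close to `1`, then
`[g, h] = 1`: from `gⁿ h g⁻ⁿ = [g, h]ⁿ h` all powers of `[g, h]` are close to `1`. -/
theorem map_commutator_eq_one [NormOneClass R] [NormedAlgebra ℝ R] (f : G →* R) {C : ℝ}
    (hC : ∀ g, ‖f g‖ ≤ C) {g h : G} (hh : ‖f h - 1‖ ≤ 1 / (4 * (C ^ 2 + 1)))
    (hgh : f ⁅g, ⁅g, h⁆⁆ = 1) : f ⁅g, h⁆ = 1 := by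
  have hC1 : 1 ≤ C := by simpa using hC 1
  have hcomm : f g * f ⁅g, h⁆ = f ⁅g, h⁆ * f g := by
    have e : ⁅g, ⁅g, h⁆⁆ * (⁅g, h⁆ * g) = g * ⁅g, h⁆ := by
      rw [commutatorElement_def g ⁅g, h⁆]; group
    rw [← map_mul, ← map_mul, ← e, map_mul, hgh, one_mul]
  have hpow : ∀ n : ℕ, f (g ^ n * h) = f (⁅g, h⁆ ^ n * h * g ^ n) := by
    intro n
    induction n with
    | zero => simp
    | succ n ih =>
      have hc : Commute (f g) (f (⁅g, h⁆ ^ n)) := by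
        rw [map_pow]; exact Commute.pow_right hcomm n
      calc f (g ^ (n + 1) * h) = f g * f (g ^ n * h) := by rw [← map_mul, pow_succ', mul_assoc]
        _ = f g * f (⁅g, h⁆ ^ n) * f (h * g ^ n) := by
          rw [ih, mul_assoc (⁅g, h⁆ ^ n), map_mul f (⁅g, h⁆ ^ n), mul_assoc]
        _ = f (⁅g, h⁆ ^ n) * f g * f (h * g ^ n) := by rw [hc.eq]
        _ = f (⁅g, h⁆ ^ (n + 1) * h * g ^ (n + 1)) := by
          rw [← map_mul, ← map_mul]
          congr 1
          rw [pow_succ, pow_succ', commutatorElement_def]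
          group
  have hε : (0 : ℝ) < 4 * (C ^ 2 + 1) := by positivity
  have hh2 : ‖f h⁻¹‖ ≤ C := hC _
  have hh3 : ‖f h⁻¹‖ ≤ 2 := by
    have e : f h⁻¹ = 1 - f h⁻¹ * (f h - 1) := by
      rw [mul_sub, ← map_mul, inv_mul_cancel, map_one, mul_one]; abel
    have h0 : 1 / (4 * (C ^ 2 + 1)) ≤ 1 / 8 := by
      apply one_div_le_one_div_of_le (by norm_num); nlinarith
    have h1 : ‖f h⁻¹‖ ≤ 1 + ‖f h⁻¹‖ * (1 / 8) := by
      calc ‖f h⁻¹‖ = ‖1 - f h⁻¹ * (f h - 1)‖ := by rw [← e]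
        _ ≤ ‖(1 : R)‖ + ‖f h⁻¹ * (f h - 1)‖ := norm_sub_le _ _
        _ ≤ 1 + ‖f h⁻¹‖ * (1 / 8) := by
          rw [norm_one]
          gcongr
          exact (norm_mul_le _ _).trans (by gcongr; exact hh.trans h0)
    linarith
  refine eq_one_of_norm_pow_sub_one_le fun n => ?_
  have e : f ⁅g, h⁆ ^ n - 1 = (f (g ^ n) * (f h - 1) * f (g ^ n)⁻¹ - (f h - 1)) * f h⁻¹ := by
    have e1 : f ⁅g, h⁆ ^ n = f (g ^ n) * f h * f (g ^ n)⁻¹ * f h⁻¹ := by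
      rw [← map_pow, ← map_mul f (g ^ n), hpow, ← map_mul, ← map_mul]
      congr 1
      group
    have e2 : f (g ^ n) * f (g ^ n)⁻¹ = 1 := by rw [← map_mul, mul_inv_cancel, map_one]
    have e3 : f h * f h⁻¹ = 1 := by rw [← map_mul, mul_inv_cancel, map_one]
    rw [e1, mul_sub, mul_one, sub_mul _ _ (f (g ^ n)⁻¹), e2]
    have : (f (g ^ n) * f h * f (g ^ n)⁻¹ - 1 - (f h - 1)) * f h⁻¹ =
        f (g ^ n) * f h * f (g ^ n)⁻¹ * f h⁻¹ - f h * f h⁻¹ := by noncomm_ring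
    rw [this, e3]
  rw [e]
  calc _ ≤ (‖f (g ^ n)‖ * ‖f h - 1‖ * ‖f (g ^ n)⁻¹‖ + ‖f h - 1‖) * ‖f h⁻¹‖ := by
        refine (norm_mul_le _ _).trans ?_
        gcongr
        refine (norm_sub_le _ _).trans ?_
        gcongr
        exact (norm_mul_le _ _).trans (by gcongr; exact norm_mul_le _ _)
    _ ≤ (C * ‖f h - 1‖ * C + ‖f h - 1‖) * 2 := by
        gcongr
        · exact hC _
        · exact hC _
    _ = 2 * (C ^ 2 + 1) * ‖f h - 1‖ := by ring
    _ ≤ 2 * (C ^ 2 + 1) * (1 / (4 * (C ^ 2 + 1))) := by gcongr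
    _ = 1 / 2 := by field_simp; norm_num

/-- If `y` is a vector with bounded orbit under conjugation by powers of `a`, then conjugation by
`a` has no nontrivial Jordan block on `y`. -/
theorem conj_sub_eq_zero [NormedAlgebra ℝ R] {a a' : R} {C : ℝ}
    (ha : ∀ n : ℕ, ‖a ^ n‖ ≤ C) (ha' : ∀ n : ℕ, ‖a' ^ n‖ ≤ C) {y : R}
    (hy : a * (a * y * a' - y) * a' - (a * y * a' - y) = 0) : a * y * a' - y = 0 := by
  set z := a * y * a' - y with hz
  have hz1 : a * z * a' = z := sub_eq_zero.1 hy
  have hy1 : a * y * a' = y + z := by rw [hz]; abel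
  have hn : ∀ n : ℕ, a ^ n * y * a' ^ n = y + (n : ℝ) • z := by
    intro n
    induction n with
    | zero => simp
    | succ n ih =>
      calc a ^ (n + 1) * y * a' ^ (n + 1) = a * (a ^ n * y * a' ^ n) * a' := by
            rw [pow_succ', pow_succ]; simp only [mul_assoc]
        _ = a * y * a' + (n : ℝ) • (a * z * a') := by
            rw [ih, mul_add, add_mul, mul_smul_comm, smul_mul_assoc]
        _ = y + ((n + 1 : ℕ) : ℝ) • z := by
            rw [hz1, hy1]; push_cast; rw [add_smul, one_smul]; abel
  have hC : 0 ≤ C := (norm_nonneg _).trans (ha 0)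
  by_contra hne
  have hpos : 0 < ‖z‖ := norm_pos_iff.2 hne
  obtain ⟨n, hlt⟩ := exists_nat_gt ((C * ‖y‖ * C + ‖y‖) / ‖z‖)
  rw [div_lt_iff₀ hpos] at hlt
  have e : (n : ℝ) • z = a ^ n * y * a' ^ n - y := by rw [hn]; abel
  have h1 : (n : ℝ) * ‖z‖ ≤ C * ‖y‖ * C + ‖y‖ := by
    calc (n : ℝ) * ‖z‖ = ‖(n : ℝ) • z‖ := by rw [norm_smul]; simp
      _ ≤ ‖a ^ n‖ * ‖y‖ * ‖a' ^ n‖ + ‖y‖ := by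
        rw [e]
        refine (norm_sub_le _ _).trans ?_
        gcongr
        exact (norm_mul_le _ _).trans (by gcongr; exact norm_mul_le _ _)
      _ ≤ _ := by gcongr; exacts [ha n, ha' n]
  linarith

end Commutators

section Triangular

variable {G R : Type*} [Group G] [NormedRing R] [NormedAlgebra ℝ R]
  {q : ℕ → R} {m : ℕ}

/-- The block diagonal part of a block triangular representation. -/
def diagHom (hq : IsBlocks q m) (f : G →* R) (hf : ∀ g, Raises q 0 (f g)) : G →* R where
  toFun g := diagPart q m 0 (f g)
  map_one' := by rw [map_one, hq.diagPart_one]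
  map_mul' g h := by rw [map_mul]; exact hq.diagPart_mul (hf g) (hf h)

omit [NormedAlgebra ℝ R] in
theorem diagHom_apply (hq : IsBlocks q m) (f : G →* R) (hf : ∀ g, Raises q 0 (f g)) (g : G) :
    diagHom hq f hf g = diagPart q m 0 (f g) := rfl

/-- The elements of a block triangular group that are the identity up to terms raising the block
index by at least `k`. -/
def congruenceSubgroup (hq : IsBlocks q m) (f : G →* R) (hf : ∀ g, Raises q 0 (f g)) (k : ℕ) :
    Subgroup G where
  carrier := {h | Raises q k (f h - 1)}
  one_mem' := by
    change Raises q k (f 1 - 1)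
    rw [map_one, sub_self]; exact Raises.zero k
  mul_mem' := by
    intro a b ha hb
    change Raises q k (f (a * b) - 1)
    have e : f (a * b) - 1 = (f a - 1) * f b + (f b - 1) := by rw [map_mul]; noncomm_ring
    rw [e]
    exact (hq.raises_mul ha (hf b)).add hb
  inv_mem' := by
    intro a ha
    change Raises q k (f a⁻¹ - 1)
    have e : f a⁻¹ - 1 = -(f a⁻¹ * (f a - 1)) := by
      rw [mul_sub, ← map_mul, inv_mul_cancel, map_one]; noncomm_ring
    rw [e]
    have := hq.raises_mul (hf a⁻¹) ha
    rw [zero_add] at this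
    exact this.neg

variable (hq : IsBlocks q m) (f : G →* R) (hf : ∀ g, Raises q 0 (f g))

omit [NormedAlgebra ℝ R] in
theorem mem_congruenceSubgroup {k : ℕ} {h : G} :
    h ∈ congruenceSubgroup hq f hf k ↔ Raises q k (f h - 1) := Iff.rfl

omit [NormedAlgebra ℝ R] in
theorem congruenceSubgroup_conj {k : ℕ} {h : G} (hh : h ∈ congruenceSubgroup hq f hf k) (g : G) :
    g * h * g⁻¹ ∈ congruenceSubgroup hq f hf k := by
  rw [mem_congruenceSubgroup] at *
  have e : f (g * h * g⁻¹) - 1 = f g * (f h - 1) * f g⁻¹ := by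
    rw [mul_sub, sub_mul, mul_one, map_mul, map_mul, ← map_mul f g g⁻¹, mul_inv_cancel, map_one]
  rw [e]
  have := hq.raises_mul (hq.raises_mul (hf g) hh) (hf g⁻¹)
  rwa [zero_add, add_zero] at this

omit [NormedAlgebra ℝ R] in
theorem mem_congruenceSubgroup_one {h : G} :
    h ∈ congruenceSubgroup hq f hf 1 ↔ diagHom hq f hf h = 1 := by
  rw [mem_congruenceSubgroup, diagHom_apply]
  constructor
  · intro hh
    have := diagPart_eq_zero (m := m) (k := 0) hh
    rwa [diagPart_sub, hq.diagPart_one, sub_eq_zero] at this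
  · intro hh
    refine hq.raises_succ ((hf h).sub hq.raises_one) ?_
    rw [diagPart_sub, hq.diagPart_one, hh, sub_self]

omit [NormedAlgebra ℝ R] in
/-- The leading part of a commutator `[g, h]` is the conjugate of the leading part of `h` by the
diagonal part of `g`, minus the leading part of `h`. -/
theorem diagPart_commutator {k : ℕ} (hk : 1 ≤ k) {g h : G}
    (hh : h ∈ congruenceSubgroup hq f hf k) :
    diagPart q m k (f ⁅g, h⁆ - 1) =
      diagHom hq f hf g * diagPart q m k (f h - 1) * diagHom hq f hf g⁻¹ -
        diagPart q m k (f h - 1) := by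
  have e : f ⁅g, h⁆ - 1 = (f g * (f h - 1) * f g⁻¹ - (f h - 1)) * f h⁻¹ := by
    have e1 : f g * f g⁻¹ = 1 := by rw [← map_mul, mul_inv_cancel, map_one]
    have e2 : f h * f h⁻¹ = 1 := by rw [← map_mul, mul_inv_cancel, map_one]
    have : (f g * (f h - 1) * f g⁻¹ - (f h - 1)) * f h⁻¹ = f g * f h * f g⁻¹ * f h⁻¹ -
      f g * f g⁻¹ * f h⁻¹ - (f h * f h⁻¹ - f h⁻¹) := by noncomm_ring
    rw [this, e1, e2, commutatorElement_def, map_mul, map_mul, map_mul]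
    noncomm_ring
  have h1 : Raises q k (f h - 1) := hh
  have h2 : Raises q k (f g * (f h - 1)) := by simpa using hq.raises_mul (hf g) h1
  have h3 : Raises q k (f g * (f h - 1) * f g⁻¹) := by simpa using hq.raises_mul h2 (hf g⁻¹)
  have h4 : diagHom hq f hf h⁻¹ = 1 := by
    rw [← mem_congruenceSubgroup_one hq f hf]
    exact (congruenceSubgroup hq f hf 1).inv_mem (Raises.mono hk h1)
  have h5 := hq.diagPart_mul (h3.sub h1) (hf h⁻¹)
  rw [add_zero, ← e] at h5
  rw [h5, ← diagHom_apply hq f hf, h4, mul_one, diagPart_sub]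
  have h6 := hq.diagPart_mul h2 (hf g⁻¹)
  have h7 := hq.diagPart_mul (hf g) h1
  rw [add_zero] at h6
  rw [zero_add] at h7
  rw [h6, h7]
  rfl

variable (V : Set R) (hV : V ∈ 𝓝 (1 : R)) (hdisc : ∀ g, f g ∈ V → g = 1)

include hV hdisc in
/-- Iterated commutators of two elements of a discrete block triangular group with diagonal parts
close to `1` are eventually trivial: after conjugation by a large scaling both elements are close to
`1`. -/
theorem exists_iterate_commutator_eq_one [NormOneClass R] {g h : G}
    (hg : ‖diagHom hq f hf g - 1‖ < 1 / 16) (hh : ‖diagHom hq f hf h - 1‖ < 1 / 16) :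
    ∃ n, (fun x => ⁅g, x⁆)^[n] h = 1 := by
  have hev : ∀ x : G, ‖diagHom hq f hf x - 1‖ < 1 / 16 →
      ∀ᶠ t : ℝ in atTop, ‖scaling q m t⁻¹ * f x * scaling q m t - 1‖ < 1 / 16 := by
    intro x hx
    have h1 := ((tendsto_conj_scaling (m := m) (hf x)).sub_const 1).norm
    exact h1.eventually_lt_const hx
  obtain ⟨t, ⟨htg, hth⟩, ht⟩ :=
    (((hev g hg).and (hev h hh)).and (eventually_gt_atTop (0 : ℝ))).exists
  have hs1 : scaling q m t * scaling q m t⁻¹ = 1 := by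
    rw [hq.scaling_mul, mul_inv_cancel₀ ht.ne', hq.scaling_one]
  have hs2 : scaling q m t⁻¹ * scaling q m t = 1 := by
    rw [hq.scaling_mul, inv_mul_cancel₀ ht.ne', hq.scaling_one]
  let φ : G →* R :=
    { toFun := fun x => scaling q m t⁻¹ * f x * scaling q m t
      map_one' := by rw [map_one, mul_one, hs2]
      map_mul' := fun x y => by
        rw [map_mul]
        calc _ = scaling q m t⁻¹ * f x * 1 * f y * scaling q m t := by
              simp only [mul_assoc, mul_one]
          _ = _ := by rw [← hs1]; simp only [mul_assoc] }
  have hφ := norm_iterate_commutator_le φ (g := g) (h := h) htg.le hth.le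
  have h1 : Tendsto (fun n => φ ((fun x => ⁅g, x⁆)^[n] h)) atTop (𝓝 1) := by
    rw [tendsto_iff_norm_sub_tendsto_zero]
    refine squeeze_zero (fun _ => norm_nonneg _) hφ ?_
    have := (tendsto_pow_atTop_nhds_zero_of_lt_one (r := (1 / 2 : ℝ)) (by norm_num)
      (by norm_num)).mul_const ‖φ h - 1‖
    simpa using this
  have h2 := (h1.const_mul (scaling q m t)).mul_const (scaling q m t⁻¹)
  rw [mul_one, hs1] at h2
  obtain ⟨n, hn⟩ := (h2.eventually hV).exists
  refine ⟨n, hdisc _ ?_⟩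
  have e : ∀ x, scaling q m t * φ x * scaling q m t⁻¹ = f x := by
    intro x
    calc scaling q m t * (scaling q m t⁻¹ * f x * scaling q m t) * scaling q m t⁻¹ =
        (scaling q m t * scaling q m t⁻¹) * f x * (scaling q m t * scaling q m t⁻¹) := by
          simp only [mul_assoc]
      _ = f x := by rw [hs1]; simp
  rwa [e] at hn

include hV hdisc in
/-- Discrete groups of block triangular matrices with bounded diagonal part are finitely generated
as soon as their abelian subgroups are: elements with diagonal part close to `1` generate a
nilpotent subgroup of finite index. -/
theorem fg_of_triangular [NormOneClass R] [FiniteDimensional ℝ R] {C : ℝ}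
    (hC : ∀ g, ‖diagHom hq f hf g‖ ≤ C)
    (hab : ∀ A : Subgroup G, (∀ a ∈ A, ∀ b ∈ A, a * b = b * a) → A.FG) : Group.FG G := by
  set D := diagHom hq f hf with hD
  have hC1 : 1 ≤ C := by simpa using hC 1
  obtain ⟨δ, hδ0, hδ1, hδ2⟩ : ∃ δ : ℝ, 0 < δ ∧ δ ≤ 1 / 16 ∧ δ ≤ 1 / (4 * (C ^ 2 + 1)) :=
    ⟨min (1 / 16) (1 / (4 * (C ^ 2 + 1))), lt_min (by norm_num) (by positivity), min_le_left _ _,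
      min_le_right _ _⟩
  let P : Set G := {g | ‖D g - 1‖ < δ}
  let N := congruenceSubgroup hq f hf
  have hit : ∀ g ∈ P, ∀ h ∈ P, ∃ n, (fun x => ⁅g, x⁆)^[n] h = 1 := fun g hg h hh =>
    exists_iterate_commutator_eq_one hq f hf V hV hdisc (lt_of_lt_of_le hg hδ1)
      (lt_of_lt_of_le hh hδ1)
  have hPc : ∀ g ∈ P, ∀ h ∈ P, ⁅g, h⁆ ∈ P := by
    intro g hg h hh
    have h1 := norm_commutator_sub_one_le D (g := g) (h := h) (le_of_lt (lt_of_lt_of_le hg hδ1))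
      (le_of_lt (lt_of_lt_of_le hh hδ1))
    refine lt_of_le_of_lt h1 (lt_of_le_of_lt ?_ hh)
    linarith [norm_nonneg (D h - 1)]
  -- commutators of elements of `P` have trivial diagonal part
  have hbase : ∀ g ∈ P, ∀ h ∈ P, ⁅g, h⁆ ∈ N 1 := by
    intro g hg
    have key : ∀ n, ∀ h ∈ P, (fun x => ⁅g, x⁆)^[n] h = 1 → D ⁅g, h⁆ = 1 := by
      intro n
      induction n with
      | zero => intro h _ hn; rw [show h = 1 from hn]; simp
      | succ n ih =>
        intro h hh hn
        exact map_commutator_eq_one D hC ((le_of_lt hh).trans hδ2) (ih _ (hPc g hg h hh) hn)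
    intro h hh
    obtain ⟨n, hn⟩ := hit g hg h hh
    exact (mem_congruenceSubgroup_one hq f hf).2 (key n h hh hn)
  have hN1P : ∀ h ∈ N 1, h ∈ P := by
    intro h hh
    have : D h = 1 := (mem_congruenceSubgroup_one hq f hf).1 hh
    change ‖D h - 1‖ < δ
    rw [this, sub_self, norm_zero]; exact hδ0
  have hNanti : ∀ k l, k ≤ l → N l ≤ N k := fun k l hkl x hx => Raises.mono hkl hx
  have hNn : ∀ k, ∀ h ∈ N k, ∀ g : G, g * h * g⁻¹ ∈ N k := fun k h hh g =>
    congruenceSubgroup_conj hq f hf hh g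
  have hNc : ∀ k, ∀ h ∈ N k, ∀ g : G, ⁅g, h⁆ ∈ N k := fun k h hh g =>
    (N k).mul_mem (hNn k h hh g) ((N k).inv_mem hh)
  have hstep : ∀ k, 1 ≤ k → ∀ g ∈ P, ∀ h ∈ N k, ⁅g, h⁆ ∈ N (k + 1) := by
    intro k hk g hg
    have key : ∀ n, ∀ h ∈ N k, (fun x => ⁅g, x⁆)^[n] h = 1 →
        diagPart q m k (f ⁅g, h⁆ - 1) = 0 := by
      intro n
      induction n with
      | zero =>
        intro h hh hn
        rw [show h = 1 from hn]
        simp [diagPart]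
      | succ n ih =>
        intro h hh hn
        have h1 := ih _ (hNc k h hh g) hn
        rw [diagPart_commutator hq f hf hk (hNc k h hh g),
          diagPart_commutator hq f hf hk hh] at h1
        rw [diagPart_commutator hq f hf hk hh]
        refine conj_sub_eq_zero (C := C) (fun n => ?_) (fun n => ?_) h1
        · rw [← map_pow]; exact hC _
        · rw [← map_pow]; exact hC _
    intro h hh
    obtain ⟨n, hn⟩ := hit g hg h (hN1P h (hNanti 1 k hk hh))
    exact hq.raises_succ (hNc k h hh g) (key n h hh hn)
  let G₀ := Subgroup.closure P
  have hmul' : ∀ g h a : G, ⁅g * h, a⁆ = g * ⁅h, a⁆ * g⁻¹ * ⁅g, a⁆ := by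
    intro g h a; simp only [commutatorElement_def]; group
  have hmul : ∀ g a b : G, ⁅g, a * b⁆ = ⁅g, a⁆ * (a * ⁅g, b⁆ * a⁻¹) := by
    intro g a b; simp only [commutatorElement_def]; group
  have hinv' : ∀ g a : G, ⁅g⁻¹, a⁆ = g⁻¹ * ⁅g, a⁆⁻¹ * g⁻¹⁻¹ := by
    intro g a; simp only [commutatorElement_def]; group
  have hinv : ∀ g a : G, ⁅g, a⁻¹⁆ = a⁻¹ * ⁅g, a⁆⁻¹ * a⁻¹⁻¹ := by
    intro g a; simp only [commutatorElement_def]; group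
  -- a relation `[g, h] ∈ N k` extends from generators `g`, as well as from generators `h`
  have hextg : ∀ k (h : G), (∀ g ∈ P, ⁅g, h⁆ ∈ N k) → ∀ g ∈ G₀, ⁅g, h⁆ ∈ N k := by
    intro k h hP g hg
    induction hg using Subgroup.closure_induction with
    | mem x hx => exact hP x hx
    | one => simp
    | mul x y _ _ hx hy => rw [hmul']; exact (N k).mul_mem (hNn k _ hy x) hx
    | inv x _ hx => rw [hinv']; exact hNn k _ ((N k).inv_mem hx) _
  have hexth : ∀ k (g : G), (∀ h ∈ P, ⁅g, h⁆ ∈ N k) → ∀ h ∈ G₀, ⁅g, h⁆ ∈ N k := by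
    intro k g hP h hh
    induction hh using Subgroup.closure_induction with
    | mem x hx => exact hP x hx
    | one => simp
    | mul x y _ _ hx hy => rw [hmul]; exact (N k).mul_mem hx (hNn k _ hy x)
    | inv x _ hx => rw [hinv]; exact hNn k _ ((N k).inv_mem hx) _
  have hG₀ : Group.FG G₀ := by
    refine fg_of_central_chain (G := G₀) (fun k => (N k).subgroupOf G₀) m ?_ ?_ ?_ ?_ ?_
    · rw [Subgroup.subgroupOf_eq_top]
      intro x _
      exact (hf x).sub hq.raises_one
    · rw [eq_bot_iff]
      intro x hx
      have h1 : f x - 1 = 0 := hq.eq_zero_of_raises (Subgroup.mem_subgroupOf.1 hx)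
      have h2 : (x : G) = 1 := hdisc _ (by rw [sub_eq_zero.1 h1]; exact mem_of_mem_nhds hV)
      exact Subgroup.mem_bot.2 (Subtype.ext h2)
    · intro k x hx
      exact hNanti k (k + 1) (Nat.le_succ k) hx
    · intro k g h hh
      change ⁅(g : G), (h : G)⁆ ∈ N (k + 1)
      rcases Nat.eq_zero_or_pos k with rfl | hk
      · exact hextg 1 _ (fun x hx => hexth 1 x (fun y hy => hbase x hx y hy) h h.2) g g.2
      · exact hextg (k + 1) _ (fun x hx => hstep k hk x hx h hh) g g.2
    · intro A hA
      have h1 := hab (A.map G₀.subtype) (by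
        rintro _ ⟨a, ha, rfl⟩ _ ⟨b, hb, rfl⟩
        rw [← map_mul, hA a ha b hb, map_mul])
      rw [← Group.fg_iff_subgroup_fg] at h1 ⊢
      have e := A.equivMapOfInjective G₀.subtype G₀.subtype_injective
      exact Group.fg_of_surjective (f := e.symm.toMonoidHom) e.symm.surjective
  have hbdd : TotallyBounded (Set.range D) := by
    have : ProperSpace R := FiniteDimensional.proper ℝ R
    refine (Bornology.IsBounded.isCompact_closure ?_).totallyBounded.subset subset_closure
    rw [isBounded_iff_forall_norm_le]
    exact ⟨C, by rintro _ ⟨g, rfl⟩; exact hC g⟩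
  obtain ⟨t, hts, htf, ht⟩ := Metric.finite_approx_of_totallyBounded hbdd (δ / C) (by positivity)
  have hpre : ∀ y : t, ∃ g, D g = y := fun y => hts y.2
  choose r hr using hpre
  have : Finite t := htf
  refine fg_of_finite_translates G₀ ((Group.fg_iff_subgroup_fg _).1 hG₀) (Set.range r)
    (Set.finite_range r) fun g => ?_
  obtain ⟨y, hy, hgy⟩ := Set.mem_iUnion₂.1 (ht ⟨g, rfl⟩)
  refine ⟨r ⟨y, hy⟩, ⟨_, rfl⟩, Subgroup.subset_closure ?_⟩
  change ‖D ((r ⟨y, hy⟩)⁻¹ * g) - 1‖ < δ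
  rw [Metric.mem_ball, dist_eq_norm] at hgy
  have e : D ((r ⟨y, hy⟩)⁻¹ * g) - 1 = D (r ⟨y, hy⟩)⁻¹ * (D g - y) := by
    have h1 : D (r ⟨y, hy⟩)⁻¹ * D (r ⟨y, hy⟩) = 1 := by
      rw [← map_mul, inv_mul_cancel, map_one]
    rw [show D (r ⟨y, hy⟩) = y from hr ⟨y, hy⟩] at h1
    rw [mul_sub, map_mul, h1]
  rw [e]
  calc _ ≤ C * ‖D g - y‖ := (norm_mul_le _ _).trans (by gcongr; exact hC _)
    _ < C * (δ / C) := by gcongr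
    _ = δ := by field_simp

end Triangular

end RelAnosov

namespace RelAnosov

/-! ### Block triangular form of groups with bounded traces -/

section Trace

variable {K : Type*} [RCLike K] {E : Type*} [NormedAddCommGroup E] [InnerProductSpace K E]
  [FiniteDimensional K E]

open Polynomial in
/-- An endomorphism `a` with `tr (a p(a)) = 0` for all polynomials `p` is nilpotent: the projection
onto its Fitting-one component has the form `a p(a)`, and its trace is its rank. -/
theorem isNilpotent_of_trace_mul_aeval_eq_zero (a : Module.End K E)
    (h : ∀ p : K[X], LinearMap.trace K E (a * aeval a p) = 0) : IsNilpotent a := by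
  obtain ⟨s, hs, hds⟩ := exists_eq_pow_rootMultiplicity_mul_and_not_dvd a.charpoly
    a.charpoly_monic.ne_zero 0
  set k := a.charpoly.rootMultiplicity 0
  rw [C_0, sub_zero] at hs hds
  have hcop : IsCoprime (X ^ (k + 1) : K[X]) s :=
    ((Polynomial.irreducible_X.coprime_iff_not_dvd).2 hds).pow_left
  obtain ⟨u, v, huv⟩ := hcop
  set e := aeval a (u * X ^ (k + 1)) with he
  have hvs : aeval a (v * s) = 1 - e := by
    rw [he, eq_sub_iff_add_eq, ← map_add, add_comm, huv, map_one]
  have h0 : aeval a (X ^ k * s) = 0 := by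
    rw [← hs]; exact LinearMap.aeval_self_charpoly a
  have hidem : e * e = e := by
    have : e * (1 - e) = 0 := by
      rw [← hvs, he, ← map_mul, show u * X ^ (k + 1) * (v * s) = (X ^ k * s) * (u * X * v) by ring,
        map_mul, h0, zero_mul]
    rw [mul_sub, mul_one, sub_eq_zero] at this
    exact this.symm
  have htr : LinearMap.trace K E e = 0 := by
    rw [he, show u * X ^ (k + 1) = X * (u * X ^ k) by ring, map_mul, aeval_X]
    exact h _
  have he0 : e = 0 := LinearMap.IsIdempotentElem.eq_zero_of_trace_eq_zero hidem htr
  refine ⟨k, ?_⟩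
  calc a ^ k = a ^ k * (1 - e) := by rw [he0]; simp
    _ = aeval a (X ^ k) * aeval a (v * s) := by rw [hvs, aeval_X_pow (R := K)]
    _ = aeval a (X ^ k * s) * aeval a v := by
      rw [← map_mul, ← map_mul, show X ^ k * (v * s) = X ^ k * s * v by ring]
    _ = 0 := by rw [h0, zero_mul]

/-- The radical of the trace form of an algebra of endomorphisms. -/
def traceRadical (A : Subalgebra K (Module.End K E)) : Ideal A where
  carrier := {a | ∀ b : A, LinearMap.trace K E ((a * b : A) : Module.End K E) = 0}
  add_mem' := by
    intro a a' ha ha' b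
    rw [add_mul, A.coe_add, map_add, ha b, ha' b, add_zero]
  zero_mem' := by intro b; simp
  smul_mem' := by
    intro c a ha b
    rw [smul_eq_mul, mul_assoc, A.coe_mul, LinearMap.trace_mul_comm, ← A.coe_mul, mul_assoc]
    exact ha _

omit [FiniteDimensional K E] in
theorem mem_traceRadical {A : Subalgebra K (Module.End K E)} {a : A} :
    a ∈ traceRadical A ↔ ∀ b : A, LinearMap.trace K E ((a * b : A) : Module.End K E) = 0 :=
  Iff.rfl

theorem traceRadical_le_jacobson (A : Subalgebra K (Module.End K E)) :
    traceRadical A ≤ Ring.jacobson A := by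
  intro a ha
  rw [← Ideal.jacobson_bot, Ideal.mem_jacobson_iff]
  intro y
  have hya : y * a ∈ traceRadical A := (traceRadical A).smul_mem y ha
  have hnil : IsNilpotent (y * a) := by
    have h1 : IsNilpotent ((y * a : A) : Module.End K E) := by
      refine isNilpotent_of_trace_mul_aeval_eq_zero _ fun p => ?_
      have := hya (Polynomial.aeval (y * a) p)
      rwa [A.coe_mul, Polynomial.aeval_subalgebra_coe] at this
    obtain ⟨n, hn⟩ := h1
    exact ⟨n, Subtype.ext (by rw [A.coe_pow, hn]; rfl)⟩
  obtain ⟨u, hu⟩ := hnil.isUnit_one_add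
  refine ⟨(↑u⁻¹ : A), ?_⟩
  have : (↑u⁻¹ : A) * (1 + y * a) = 1 := by rw [← hu]; exact u.inv_mul
  rw [Ideal.mem_bot, mul_assoc, ← sub_eq_zero.2 this]
  noncomm_ring

/-- The descending flag `E ⊇ J E ⊇ J² E ⊇ …` for the radical `J` of the trace form. -/
def radicalFlag (A : Subalgebra K (Module.End K E)) (k : ℕ) : Submodule A E :=
  (fun N : Submodule A E => traceRadical A • N)^[k] ⊤

omit [FiniteDimensional K E] in
theorem radicalFlag_succ (A : Subalgebra K (Module.End K E)) (k : ℕ) :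
    radicalFlag A (k + 1) = traceRadical A • radicalFlag A k := by
  rw [radicalFlag, Function.iterate_succ_apply']; rfl

omit [FiniteDimensional K E] in
theorem radicalFlag_succ_le (A : Subalgebra K (Module.End K E)) (k : ℕ) :
    radicalFlag A (k + 1) ≤ radicalFlag A k := by
  rw [radicalFlag_succ]; exact Submodule.smul_le_right

theorem exists_radicalFlag_eq_bot (A : Subalgebra K (Module.End K E)) :
    ∃ m, radicalFlag A m = ⊥ := by
  have : Module.Finite A E := Module.Finite.of_restrictScalars_finite K A E
  have hfg : ∀ N : Submodule A E, N.FG := by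
    intro N
    have h1 : (N.restrictScalars K).FG := IsNoetherian.noetherian _
    have h2 : Module.Finite K N := Module.Finite.iff_fg.2 h1
    have h3 : Module.Finite A N := Module.Finite.of_restrictScalars_finite K A N
    exact Module.Finite.iff_fg.1 h3
  by_contra! hne
  have hlt : ∀ k, radicalFlag A (k + 1) < radicalFlag A k := by
    intro k
    refine lt_of_le_of_ne (radicalFlag_succ_le A k) fun h => hne k ?_
    refine (hfg _).eq_bot_of_le_jacobson_smul ?_
    conv_lhs => rw [← h, radicalFlag_succ]
    exact Submodule.smul_mono_left (traceRadical_le_jacobson A)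
  have hrank : ∀ k, Module.finrank K ((radicalFlag A k).restrictScalars K) + k ≤
      Module.finrank K E := by
    intro k
    induction k with
    | zero => simpa using Submodule.finrank_le _
    | succ k ih =>
      have : ((radicalFlag A (k + 1)).restrictScalars K) <
        ((radicalFlag A k).restrictScalars K) := hlt k
      have := Submodule.finrank_lt_finrank_of_lt this
      omega
  have := hrank (Module.finrank K E + 1)
  omega

/-- The orthogonal complements of successive terms of a finite descending flag form a block
decomposition. -/
theorem isBlocks_of_flag (W : ℕ → Submodule K E) (m : ℕ) (h0 : W 0 = ⊤) (hm : W m = ⊥)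
    (hanti : Antitone W) :
    IsBlocks (R := E →L[K] E) (fun k => (W k).starProjection - (W (k + 1)).starProjection) m := by
  have hle : ∀ i j, i ≤ j → (W i).starProjection * (W j).starProjection = (W j).starProjection := by
    intro i j hij
    ext v
    exact Submodule.starProjection_eq_self_iff.2
      (hanti hij (Submodule.starProjection_apply_mem _ _))
  have hle' : ∀ i j, i ≤ j → (W j).starProjection * (W i).starProjection = (W j).starProjection :=
    fun i j hij => Submodule.starProjection_comp_starProjection_of_le (hanti hij)
  refine ⟨fun i => ?_, fun i j hij => ?_, fun i hi => ?_, ?_⟩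
  · simp only [sub_mul, mul_sub]
    rw [hle i i le_rfl, hle i (i + 1) (by omega), hle' i (i + 1) (by omega),
      hle (i + 1) (i + 1) le_rfl]
    abel
  · simp only [sub_mul, mul_sub]
    rcases lt_or_gt_of_ne hij with h | h
    · rw [hle i j (by omega), hle i (j + 1) (by omega), hle (i + 1) j (by omega),
        hle (i + 1) (j + 1) (by omega)]
      abel
    · rw [hle' j i (by omega), hle' (j + 1) i (by omega), hle' j (i + 1) (by omega),
        hle' (j + 1) (i + 1) (by omega)]
      abel
  · have h1 : W i = ⊥ := eq_bot_iff.2 (hm ▸ hanti hi)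
    have h2 : W (i + 1) = ⊥ := eq_bot_iff.2 (hm ▸ hanti (by omega))
    simp [h1, h2]
  · rw [Finset.sum_range_sub' (fun k => (W k).starProjection), h0, hm,
      Submodule.starProjection_bot, sub_zero]
    exact ContinuousLinearMap.ext fun v =>
      Submodule.starProjection_eq_self_iff.2 (Submodule.mem_top (R := K) (x := v))

/-- A group of endomorphisms with bounded traces is block triangular with bounded diagonal part, in
blocks given by the flag `E ⊇ J E ⊇ J² E ⊇ …`, where `J` is the radical of the trace form on the
linear span of the group. The diagonal part vanishes on `J`, so that it is determined by the
traces. -/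
theorem exists_blocks {G : Type*} [Group G] (f : G →* (E →L[K] E)) {C : ℝ}
    (hC : ∀ g, ‖LinearMap.trace K E (f g : E →ₗ[K] E)‖ ≤ C) :
    ∃ (q : ℕ → (E →L[K] E)) (m : ℕ), IsBlocks q m ∧ (∀ g, Raises q 0 (f g)) ∧
      ∃ C', ∀ g, ‖diagPart q m 0 (f g)‖ ≤ C' := by
  let F : G →* Module.End K E :=
    { toFun := fun g => (f g : E →ₗ[K] E)
      map_one' := by rw [map_one]; rfl
      map_mul' := fun g h => by rw [map_mul]; rfl }
  let A : Subalgebra K (Module.End K E) := Algebra.adjoin K (Set.range F)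
  have hFA : ∀ g, F g ∈ A := fun g => Algebra.subset_adjoin ⟨g, rfl⟩
  have hAspan : Subalgebra.toSubmodule A = Submodule.span K (Set.range F) := by
    rw [Algebra.adjoin_eq_span]
    congr 1
    have : Set.range F = (MonoidHom.mrange F : Set (Module.End K E)) := rfl
    rw [this, Submonoid.closure_eq]
  obtain ⟨m, hm⟩ := exists_radicalFlag_eq_bot A
  let W : ℕ → Submodule K E := fun k => (radicalFlag A k).restrictScalars K
  have hanti : Antitone W := antitone_nat_of_succ_le fun k => radicalFlag_succ_le A k
  have hWm : W m = ⊥ := by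
    change (radicalFlag A m).restrictScalars K = ⊥
    rw [hm]; rfl
  have hq := isBlocks_of_flag W m rfl hWm hanti
  set q : ℕ → (E →L[K] E) := fun k => (W k).starProjection - (W (k + 1)).starProjection with hqdef
  have hqmem : ∀ j v, q j v ∈ W j := fun j v =>
    (W j).sub_mem (Submodule.starProjection_apply_mem _ _)
      (hanti (Nat.le_succ j) (Submodule.starProjection_apply_mem _ _))
  have hqzero : ∀ i j v, i < j → v ∈ W j → q i v = 0 := by
    intro i j v hij hv
    have h1 : (W i).starProjection v = v := Submodule.starProjection_eq_self_iff.2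
      (hanti (by omega : i ≤ j) hv)
    have h2 : (W (i + 1)).starProjection v = v := Submodule.starProjection_eq_self_iff.2
      (hanti (by omega : i + 1 ≤ j) hv)
    change (W i).starProjection v - (W (i + 1)).starProjection v = 0
    rw [h1, h2, sub_self]
  have hsmul : ∀ (a : A) j v, v ∈ W j → (a : Module.End K E) v ∈ W j := fun a j v hv =>
    (radicalFlag A j).smul_mem a hv
  refine ⟨q, m, hq, fun g i j hij => ?_, ?_⟩
  · ext v
    exact hqzero i j _ hij (hsmul ⟨F g, hFA g⟩ j _ (hqmem j v))
  -- the diagonal part as a linear map, and the traces against a basis of the algebra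
  obtain ⟨b, hbs, hbspan, hbli⟩ := exists_linearIndependent K (Set.range F)
  have : Finite b := hbli.finite
  have : Fintype b := Fintype.ofFinite b
  let T : A →ₗ[K] (b → K) := LinearMap.pi fun x =>
    (LinearMap.trace K E).comp ((LinearMap.mulRight K (x : Module.End K E)).comp
      (Subalgebra.toSubmodule A).subtype)
  let D : A →ₗ[K] (E →L[K] E) :=
    { toFun := fun a => diagPart q m 0 (LinearMap.toContinuousLinearMap (a : Module.End K E))
      map_add' := by
        intro x y
        simp [diagPart, mul_add, add_mul, Finset.sum_add_distrib]
      map_smul' := by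
        intro c x
        simp [diagPart, Finset.smul_sum] }
  have hker : T.ker ≤ D.ker := by
    intro a ha
    have haJ : a ∈ traceRadical A := by
      rw [mem_traceRadical]
      intro c
      have hc : (c : Module.End K E) ∈ Submodule.span K b := by
        rw [hbspan, ← hAspan]; exact c.2
      rw [A.coe_mul]
      generalize (c : Module.End K E) = c at hc
      induction hc using Submodule.span_induction with
      | mem x hx => exact congrFun (LinearMap.mem_ker.1 ha) ⟨x, hx⟩
      | zero => simp
      | add x y _ _ hx hy => rw [mul_add, map_add, hx, hy, add_zero]
      | smul r x _ hx => rw [mul_smul_comm, map_smul, hx, smul_zero]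
    rw [LinearMap.mem_ker]
    change diagPart q m 0 (LinearMap.toContinuousLinearMap (a : Module.End K E)) = 0
    refine Finset.sum_eq_zero fun j _ => ?_
    ext v
    refine hqzero j (j + 1) _ (Nat.lt_succ_self j) ?_
    change (a : Module.End K E) (q j v) ∈ radicalFlag A (j + 1)
    rw [radicalFlag_succ]
    exact Submodule.smul_mem_smul haJ (hqmem j v)
  obtain ⟨S, hS⟩ : ∃ S : (b → K) →ₗ[K] (E →L[K] E), S ∘ₗ T = D := by
    obtain ⟨S, hS⟩ := LinearMap.exists_extend
      ((T.ker.liftQ D hker) ∘ₗ T.quotKerEquivRange.symm.toLinearMap)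
    refine ⟨S, LinearMap.ext fun a => ?_⟩
    have h1 := LinearMap.congr_fun hS ⟨T a, LinearMap.mem_range_self T a⟩
    have h2 : T.quotKerEquivRange.symm ⟨T a, LinearMap.mem_range_self T a⟩ = T.ker.mkQ a := by
      rw [LinearEquiv.symm_apply_eq]; rfl
    simp only [LinearMap.comp_apply, LinearEquiv.coe_coe, h2, Submodule.mkQ_apply,
      Submodule.liftQ_apply, Submodule.subtype_apply] at h1
    exact h1
  have hC0 : 0 ≤ C := (norm_nonneg _).trans (hC 1)
  refine ⟨‖LinearMap.toContinuousLinearMap S‖ * C, fun g => ?_⟩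
  have h1 : diagPart q m 0 (f g) = LinearMap.toContinuousLinearMap S (T ⟨F g, hFA g⟩) := by
    have := LinearMap.congr_fun hS ⟨F g, hFA g⟩
    rw [LinearMap.coe_toContinuousLinearMap']
    exact this.symm
  rw [h1]
  refine (ContinuousLinearMap.le_opNorm _ _).trans ?_
  gcongr
  rw [pi_norm_le_iff_of_nonneg hC0]
  rintro ⟨x, hx⟩
  obtain ⟨h, rfl⟩ := hbs hx
  change ‖LinearMap.trace K E (F g * F h)‖ ≤ C
  rw [← map_mul]
  exact hC _

end Trace

end RelAnosov

namespace RelAnosov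

/-! ### Weakly unipotent discrete groups are finitely generated -/

/-- The embedding of `ℝ` or `ℂ` into `ℂ`. -/
noncomputable def toComplex (K : Type*) [RCLike K] : K →+* ℂ where
  toFun := RCLike.map K ℂ
  map_one' := by simp
  map_zero' := map_zero _
  map_add' := map_add _
  map_mul' x y := by
    simp only [RCLike.map_apply, RCLike.mul_re, RCLike.mul_im, RCLike.I_to_complex,
      Complex.coe_algebraMap, RCLike.ofReal_sub, RCLike.ofReal_add, RCLike.ofReal_mul]
    ring_nf
    rw [Complex.I_sq]
    ring

variable {K : Type*} [RCLike K] {d : ℕ}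

local notation "𝔼" => EuclideanSpace K (Fin d)
local notation "SL" => Matrix.SpecialLinearGroup (Fin d) K

theorem toComplex_apply (z : K) : toComplex K z = RCLike.map K ℂ z := rfl

theorem norm_toComplex (z : K) : ‖toComplex K z‖ = ‖z‖ := by
  rw [toComplex_apply, RCLike.map_apply]
  simp

theorem complexEigenvalues_eq (g : SL) :
    complexEigenvalues g =
      ((g : Matrix (Fin d) (Fin d) K).map (toComplex K)).charpoly.roots := rfl

theorem card_complexEigenvalues (g : SL) : Multiset.card (complexEigenvalues g) = d := by
  rw [complexEigenvalues_eq, ← (IsAlgClosed.splits _).natDegree_eq_card_roots,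
    Matrix.charpoly_natDegree_eq_dim, Fintype.card_fin]

theorem norm_eq_one_of_mem_complexEigenvalues {g : SL} (hg : IsWeaklyUnipotent g) {z : ℂ}
    (hz : z ∈ complexEigenvalues g) : ‖z‖ = 1 := by
  set l := ((complexEigenvalues g).map (fun z => ‖z‖)).sort (· ≥ ·) with hl
  have hlen : l.length = d := by
    rw [hl, Multiset.length_sort, Multiset.card_map, card_complexEigenvalues]
  have hm : ‖z‖ ∈ l := by
    rw [hl, Multiset.mem_sort]
    exact Multiset.mem_map_of_mem _ hz
  obtain ⟨i, hi, hiz⟩ := List.getElem_of_mem hm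
  have h1 := hg (i + 1) (by omega) (by omega)
  rw [eigMod, Nat.add_sub_cancel, ← hl, List.getD_eq_getElem l 0 hi, hiz] at h1
  exact h1

theorem trace_toLin (g : SL) :
    LinearMap.trace K 𝔼 (toLin g) = (g : Matrix (Fin d) (Fin d) K).trace := by
  rw [toLin, Matrix.toEuclideanLin, Matrix.toLpLin_eq_toLin]
  exact Matrix.trace_toLin_eq _ _

theorem norm_trace_le {g : SL} (hg : IsWeaklyUnipotent g) :
    ‖LinearMap.trace K 𝔼 (toLin g)‖ ≤ d := by
  have h1 : toComplex K (g : Matrix (Fin d) (Fin d) K).trace = (complexEigenvalues g).sum := by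
    rw [complexEigenvalues_eq, ← Matrix.trace_eq_sum_roots_charpoly]
    exact AddMonoidHom.map_trace (toComplex K).toAddMonoidHom _
  rw [trace_toLin, ← norm_toComplex, h1]
  refine (norm_multiset_sum_le _).trans ?_
  refine (Multiset.sum_le_card_nsmul _ 1 ?_).trans ?_
  · intro x hx
    obtain ⟨z, hz, rfl⟩ := Multiset.mem_map.1 hx
    exact (norm_eq_one_of_mem_complexEigenvalues hg hz).le
  · rw [Multiset.card_map, card_complexEigenvalues]; simp

theorem norm_entry_le (g : SL) (i j : Fin d) :
    ‖(g : Matrix (Fin d) (Fin d) K) i j - (1 : Matrix (Fin d) (Fin d) K) i j‖ ≤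
      ‖cl K d g - 1‖ := by
  have h1 := (cl K d g - 1).le_opNorm (EuclideanSpace.single j (1 : K))
  rw [PiLp.norm_single, norm_one, mul_one] at h1
  refine le_trans ?_ h1
  refine le_trans (le_of_eq ?_) (PiLp.norm_apply_le _ i)
  congr 1
  simp [toLin, Matrix.toLpLin_apply, Matrix.one_apply]

/-- A discrete group of matrices has no nontrivial elements with entries close to those of the
identity. -/
theorem exists_entries_discrete (U : Subgroup SL) (hU : DiscreteTopology U) :
    ∃ ε > 0, ∀ g ∈ U, (∀ i j, ‖(g : Matrix (Fin d) (Fin d) K) i j -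
      (1 : Matrix (Fin d) (Fin d) K) i j‖ < ε) → g = 1 := by
  have h1 : ({1} : Set U) ∈ 𝓝 (1 : U) := (isOpen_discrete _).mem_nhds rfl
  rw [nhds_subtype_eq_comap, mem_comap] at h1
  obtain ⟨S, hS, hSU⟩ := h1
  have hS' : S ∈ comap (Subtype.val : {A : Matrix (Fin d) (Fin d) K // A.det = 1} → _)
      (𝓝 (1 : Matrix (Fin d) (Fin d) K)) := by
    have h2 := nhds_induced (Subtype.val : {A : Matrix (Fin d) (Fin d) K // A.det = 1} → _)
      (1 : SL)
    exact h2 ▸ hS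
  obtain ⟨T, hT, hTS⟩ := mem_comap.1 hS'
  have hT' : T ∈ 𝓝 (fun i j => (1 : Matrix (Fin d) (Fin d) K) i j) := hT
  obtain ⟨ε, hε, hb⟩ := Metric.mem_nhds_iff.1 hT'
  refine ⟨ε, hε, fun g hg hgε => ?_⟩
  have h2 : g ∈ S := by
    refine hTS (hb ?_)
    have h4 : dist (fun i j => (g : Matrix (Fin d) (Fin d) K) i j)
        (fun i j => (1 : Matrix (Fin d) (Fin d) K) i j) < ε := by
      rw [dist_pi_lt_iff hε]
      intro i
      rw [dist_pi_lt_iff hε]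
      intro j
      rw [dist_eq_norm]
      exact hgε i j
    exact h4
  have h3 : (⟨g, hg⟩ : U) ∈ ({1} : Set U) := hSU h2
  exact congrArg Subtype.val (Set.mem_singleton_iff.1 h3)

theorem finiteDimensional_restrictScalars (R : Type*) [NormedRing R] [NormedAlgebra K R]
    [FiniteDimensional K R] :
    letI := NormedAlgebra.restrictScalars ℝ K R
    FiniteDimensional ℝ R := by
  let _ := NormedAlgebra.restrictScalars ℝ K R
  have : IsScalarTower ℝ K R := ⟨fun a b x => by
    change (a • b) • x = (algebraMap ℝ K a) • (b • x)
    rw [Algebra.smul_def (R := ℝ) (A := K), mul_smul]⟩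
  exact FiniteDimensional.trans ℝ K R

/-- A discrete weakly unipotent group is finitely generated. -/
theorem fg_of_weaklyUnipotent (hd : 2 ≤ d) (U : Subgroup SL) (hU : DiscreteTopology U)
    (hu : ∀ u ∈ U, IsWeaklyUnipotent u) : Group.FG U := by
  have : Nonempty (Fin d) := ⟨⟨0, by omega⟩⟩
  have : Nontrivial 𝔼 := inferInstance
  obtain ⟨ε, hε, hε'⟩ := exists_entries_discrete U hU
  let f : U →* (𝔼 →L[K] 𝔼) := (cl K d).comp U.subtype
  obtain ⟨q, m, hq, hf, C, hC⟩ := exists_blocks f (C := d) fun g => norm_trace_le (hu g g.2)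
  let _ : NormedAlgebra ℝ (𝔼 →L[K] 𝔼) := NormedAlgebra.restrictScalars ℝ K _
  have := finiteDimensional_restrictScalars (K := K) (𝔼 →L[K] 𝔼)
  refine fg_of_triangular hq f hf (Metric.ball 1 ε) (Metric.ball_mem_nhds _ hε) ?_
    (C := C) hC ?_
  · intro g hg
    rw [Metric.mem_ball, dist_eq_norm] at hg
    exact Subtype.ext (hε' g g.2 fun i j => (norm_entry_le _ i j).trans_lt hg)
  · intro A hA
    rw [← Group.fg_iff_subgroup_fg]
    let φ : A →* (EuclideanSpace ℂ (Fin d) →L[ℂ] EuclideanSpace ℂ (Fin d)) :=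
      (cl ℂ d).comp ((Matrix.SpecialLinearGroup.map (toComplex K)).comp
        (U.subtype.comp A.subtype))
    refine fg_of_discrete_commutative φ
      (fun a b => Subtype.ext (hA a a.2 b b.2)) (Metric.ball 1 ε) (Metric.ball_mem_nhds _ hε) ?_
    intro a ha
    rw [Metric.mem_ball, dist_eq_norm] at ha
    refine Subtype.ext (Subtype.ext (hε' a a.1.2 fun i j => ?_))
    refine lt_of_eq_of_lt ?_ ((norm_entry_le (K := ℂ)
      (Matrix.SpecialLinearGroup.map (toComplex K) (a : SL)) i j).trans_lt ha)
    rw [← norm_toComplex, map_sub]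
    congr 1
    rw [Matrix.SpecialLinearGroup.map_apply_coe, RingHom.mapMatrix_apply, Matrix.map_apply,
      Matrix.one_apply, Matrix.one_apply]
    split_ifs <;> simp

end RelAnosov

namespace RelAnosov

/-! ### Singular value decomposition -/

section SVD

variable {K : Type*} [RCLike K] {d : ℕ}

local notation "𝔼" => EuclideanSpace K (Fin d)
local notation "SL" => Matrix.SpecialLinearGroup (Fin d) K

theorem norm_le_of_coord_le {e f : OrthonormalBasis (Fin d) K 𝔼} {x y : 𝔼} {c : ℝ} (hc : 0 ≤ c)
    (h : ∀ i, ‖inner K (e i) x‖ ≤ c * ‖inner K (f i) y‖) : ‖x‖ ≤ c * ‖y‖ := by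
  refine le_of_sq_le_sq ?_ (by positivity)
  rw [mul_pow, ← e.sum_sq_norm_inner_right, ← f.sum_sq_norm_inner_right, Finset.mul_sum]
  refine Finset.sum_le_sum fun i _ => ?_
  rw [← mul_pow]
  exact pow_le_pow_left₀ (norm_nonneg _) (h i) 2

/-- Singular value decompositions of `g`: orthonormal bases `e`, `f` with `g (f i) = σ i • e i`, where
`σ` lists the singular values in decreasing order. -/
structure IsSVD (g : SL) (e f : OrthonormalBasis (Fin d) K 𝔼) (σ : Fin d → ℝ) : Prop where
  eq_singVal : ∀ i, σ i = singVal (i + 1) g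
  pos : ∀ i, 0 < σ i
  antitone : Antitone σ
  apply : ∀ i, toLin g (f i) = (σ i : K) • e i

theorem exists_isSVD (g : SL) : ∃ e f σ, IsSVD (K := K) (d := d) g e f σ := by
  have hn : Module.finrank K 𝔼 = d := finrank_euclideanSpace_fin
  set T := toLin g with hT
  have hsym := T.isSymmetric_adjoint_comp_self
  let f := hsym.eigenvectorBasis hn
  let σ : Fin d → ℝ := fun i => T.singularValues i
  have hTinj : Function.Injective T := cl_injective g
  have hpos : ∀ i, 0 < σ i := fun i =>
    T.injective_iff_forall_lt_finrank_singularValues_pos.1 hTinj i (by rw [hn]; exact i.2)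
  have hip : ∀ i j, inner K (T (f i)) (T (f j)) = if i = j then ((σ i : K)) ^ 2 else 0 := by
    intro i j
    have h1 : LinearMap.adjoint T (T (f j)) = ((σ j : K)) ^ 2 • f j := by
      have := hsym.apply_eigenvectorBasis hn j
      rw [← T.sq_singularValues_fin hn] at this
      push_cast at this
      exact this
    rw [← LinearMap.adjoint_inner_right, h1, inner_smul_right,
      orthonormal_iff_ite.1 f.orthonormal i j]
    split_ifs with h
    · rw [h, mul_one]
    · rw [mul_zero]
  have hne : ∀ i, (σ i : K) ≠ 0 := fun i => RCLike.ofReal_ne_zero.2 (hpos i).ne'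
  have hon : Orthonormal K fun i => ((σ i : K))⁻¹ • T (f i) := by
    rw [orthonormal_iff_ite]
    intro i j
    rw [inner_smul_left, inner_smul_right, hip]
    split_ifs with h
    · subst h
      rw [map_inv₀, RCLike.conj_ofReal]
      have := hne i
      field_simp
    · simp
  let e : OrthonormalBasis (Fin d) K 𝔼 := OrthonormalBasis.mk hon
    (hon.linearIndependent.span_eq_top_of_card_eq_finrank' (by rw [hn, Fintype.card_fin])).ge
  refine ⟨e, f, σ, fun i => ?_, hpos, fun i j hij => T.singularValues_antitone hij, fun i => ?_⟩
  · simp [σ, singVal, hT]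
  · rw [OrthonormalBasis.coe_mk, smul_smul, mul_inv_cancel₀ (hne i), one_smul]

namespace IsSVD

variable {g : Matrix.SpecialLinearGroup (Fin d) K}
  {e f : OrthonormalBasis (Fin d) K (EuclideanSpace K (Fin d))} {σ : Fin d → ℝ}

theorem ne_zero (h : IsSVD g e f σ) (i : Fin d) : (σ i : K) ≠ 0 :=
  RCLike.ofReal_ne_zero.2 (h.pos i).ne'

theorem norm_coe (h : IsSVD g e f σ) (i : Fin d) : ‖(σ i : K)‖ = σ i := by
  rw [RCLike.norm_ofReal, abs_of_pos (h.pos i)]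

theorem adjoint_apply (h : IsSVD g e f σ) (i : Fin d) :
    LinearMap.adjoint (toLin g) (e i) = (σ i : K) • f i := by
  refine InnerProductSpace.ext_inner_left_basis f.toBasis fun j => ?_
  rw [f.coe_toBasis, LinearMap.adjoint_inner_right, h.apply, inner_smul_left, inner_smul_right,
    RCLike.conj_ofReal, orthonormal_iff_ite.1 e.orthonormal, orthonormal_iff_ite.1 f.orthonormal]
  split_ifs with hij
  · rw [hij]
  · simp

theorem inner_apply (h : IsSVD g e f σ) (i : Fin d) (v : 𝔼) :
    inner K (e i) (toLin g v) = σ i * inner K (f i) v := by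
  rw [← LinearMap.adjoint_inner_left, h.adjoint_apply, inner_smul_left, RCLike.conj_ofReal]

theorem inner_inv_apply (h : IsSVD g e f σ) (i : Fin d) (v : 𝔼) :
    inner K (f i) (toLin g⁻¹ v) = ((σ i : K))⁻¹ * inner K (e i) v := by
  have h1 := h.inner_apply i (toLin g⁻¹ v)
  have h2 : toLin g (toLin g⁻¹ v) = v := by
    have := cl_inv_cl (K := K) g⁻¹ v
    rwa [inv_inv] at this
  rw [h2] at h1
  rw [h1, ← mul_assoc, inv_mul_cancel₀ (h.ne_zero i), one_mul]

/-- The axes of the image ellipsoid, when there is a gap after the `k`-th one. -/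
theorem mem_axes_iff (h : IsSVD g e f σ) {i j : Fin d} (hij : (i : ℕ) + 1 = j) (hgap : σ j < σ i)
    (v : 𝔼) : v ∈ axes j g ↔ ∀ l, j ≤ l → inner K (e l) v = 0 := by
  have hk : singVal j g = σ i := by rw [h.eq_singVal, hij]
  have hgg : ∀ l, (toLin g ∘ₗ LinearMap.adjoint (toLin g)) (e l) = ((σ l ^ 2 : ℝ) : K) • e l := by
    intro l
    rw [LinearMap.comp_apply, h.adjoint_apply, map_smul, h.apply, smul_smul]
    congr 1; push_cast; ring
  constructor
  · intro hv
    have hle : axes j g ≤ ⨅ l, ⨅ _ : j ≤ l, (Submodule.span K {e l})ᗮ := by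
      refine iSup₂_le fun t ht => ?_
      intro w hw
      simp only [Submodule.mem_iInf]
      intro l hl
      rw [Submodule.mem_orthogonal_singleton_iff_inner_right]
      rw [Module.End.mem_eigenspace_iff] at hw
      have h1 : inner K (e l) ((toLin g ∘ₗ LinearMap.adjoint (toLin g)) w) =
          ((σ l ^ 2 : ℝ) : K) * inner K (e l) w := by
        rw [LinearMap.comp_apply, ← LinearMap.adjoint_inner_left, ← LinearMap.adjoint_inner_left,
          LinearMap.adjoint_adjoint]
        have := hgg l
        rw [LinearMap.comp_apply] at this
        rw [this, inner_smul_left, RCLike.conj_ofReal]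
      rw [hw, inner_smul_right] at h1
      have h2 : ((t : K) - ((σ l ^ 2 : ℝ) : K)) * inner K (e l) w = 0 := by
        rw [sub_mul, h1, sub_self]
      rcases mul_eq_zero.1 h2 with h3 | h3
      · exfalso
        rw [sub_eq_zero] at h3
        have h4 : t = σ l ^ 2 := RCLike.ofReal_injective h3
        have h5 := h.antitone hl
        rw [hk] at ht
        have := h.pos l
        nlinarith
      · exact h3
    have := hle hv
    simp only [Submodule.mem_iInf] at this
    intro l hl
    exact Submodule.mem_orthogonal_singleton_iff_inner_right.1 (this l hl)
  · intro hv
    rw [← e.sum_repr' v]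
    refine Submodule.sum_mem _ fun l _ => ?_
    by_cases hl : j ≤ l
    · rw [hv l hl, zero_smul]; exact Submodule.zero_mem _
    · refine Submodule.smul_mem _ _ ?_
      refine Submodule.mem_iSup_of_mem (σ l ^ 2) (Submodule.mem_iSup_of_mem ?_ ?_)
      · rw [hk]
        have hli : l ≤ i := by
          rw [not_le] at hl
          have : (l : ℕ) < j := hl
          exact Fin.le_def.2 (by omega)
        have := h.antitone hli
        have := h.pos i
        nlinarith
      · rw [Module.End.mem_eigenspace_iff]
        exact hgg l

theorem le_norm (h : IsSVD g e f σ) (i : Fin d) : σ i ≤ ‖cl K d g‖ := by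
  have := (cl K d g).le_opNorm (f i)
  rw [cl_apply, h.apply, norm_smul, h.norm_coe, e.norm_eq_one, f.norm_eq_one, mul_one,
    mul_one] at this
  exact this

theorem le_norm_inv (h : IsSVD g e f σ) (i : Fin d) : (σ i)⁻¹ ≤ ‖cl K d g⁻¹‖ := by
  have h0 : toLin g⁻¹ (e i) = ((σ i : K))⁻¹ • f i := by
    have h1 : toLin g⁻¹ (toLin g (f i)) = f i := cl_inv_cl g (f i)
    rw [h.apply, map_smul] at h1
    rw [← h1, smul_smul, inv_mul_cancel₀ (h.ne_zero i), one_smul]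
  have := (cl K d g⁻¹).le_opNorm (e i)
  rw [cl_apply, h0, norm_smul, norm_inv, h.norm_coe, e.norm_eq_one, f.norm_eq_one, mul_one,
    mul_one] at this
  exact this

/-- The gap between the two smallest singular values of `g` is at least the gap between the two
largest ones of the inverse. -/
theorem gap_inv (h : IsSVD g e f σ) {e' f' : OrthonormalBasis (Fin d) K 𝔼} {σ' : Fin d → ℝ}
    (h' : IsSVD g⁻¹ e' f' σ') {i j i' j' : Fin d} (hij : (i : ℕ) + 1 = j) (hj : (j : ℕ) + 1 = d)
    (hi' : (i' : ℕ) = 0) (hj' : (j' : ℕ) = 1) : σ j / σ i ≤ σ' j' / σ' i' := by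
  have hlast : ∀ l, σ j ≤ σ l := fun l => h.antitone (Fin.le_def.2 (by omega))
  have h1 : 1 ≤ σ i * σ' j' := by
    -- a vector in the plane of the two shortest axes of `g`, orthogonal to the longest one of `g⁻¹`
    obtain ⟨v, hv0, hv1, hv2⟩ : ∃ v : 𝔼, v ≠ 0 ∧ inner K (f' i') v = 0 ∧
        ∀ l, l ≠ i → l ≠ j → inner K (e l) v = 0 := by
      have hij' : i ≠ j := fun hh => by rw [hh] at hij; omega
      have hon := orthonormal_iff_ite.1 e.orthonormal
      by_cases h0 : inner K (f' i') (e j) = 0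
      · refine ⟨e j, ?_, h0, fun l _ hl => by rw [hon, if_neg hl]⟩
        intro h00
        have := e.norm_eq_one j
        rw [h00, norm_zero] at this
        exact zero_ne_one this
      · refine ⟨inner K (f' i') (e j) • e i - inner K (f' i') (e i) • e j, ?_, ?_, ?_⟩
        · intro h00
          have := congrArg (inner K (e i)) h00
          rw [inner_sub_right, inner_smul_right, inner_smul_right, hon, hon, if_pos rfl,
            if_neg hij', inner_zero_right] at this
          apply h0
          simpa using this
        · rw [inner_sub_right, inner_smul_right, inner_smul_right]; ring
        · intro l hl hl'
          rw [inner_sub_right, inner_smul_right, inner_smul_right, hon, hon, if_neg hl,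
            if_neg hl']
          simp
    have hv3 : ‖v‖ ≤ σ i * ‖toLin g⁻¹ v‖ := by
      refine norm_le_of_coord_le (e := e) (f := f) (h.pos i).le fun l => ?_
      rw [h.inner_inv_apply, norm_mul, norm_inv, h.norm_coe]
      by_cases hl : l ≠ i ∧ l ≠ j
      · rw [hv2 l hl.1 hl.2]; simp
      · have hle : σ l ≤ σ i := by
          refine h.antitone (Fin.le_def.2 ?_)
          by_cases hli : l = i
          · rw [hli]
          · have : l = j := by by_contra hlj; exact hl ⟨hli, hlj⟩
            rw [this]; omega
        have hl0 := h.pos l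
        rw [← mul_assoc]
        refine le_mul_of_one_le_left (norm_nonneg _) ?_
        rw [← div_eq_mul_inv, one_le_div hl0]
        exact hle
    have hv4 : ‖toLin g⁻¹ v‖ ≤ σ' j' * ‖v‖ := by
      refine norm_le_of_coord_le (e := e') (f := f') (h'.pos j').le fun l => ?_
      rw [h'.inner_apply, norm_mul, h'.norm_coe]
      by_cases hl : l = i'
      · rw [hl, hv1]; simp
      · gcongr
        refine h'.antitone (Fin.le_def.2 ?_)
        have : (l : ℕ) ≠ i' := fun hh => hl (Fin.ext hh)
        omega
    have hvpos := norm_pos_iff.2 hv0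
    have : ‖v‖ ≤ (σ i * σ' j') * ‖v‖ := by
      calc ‖v‖ ≤ σ i * ‖toLin g⁻¹ v‖ := hv3
        _ ≤ σ i * (σ' j' * ‖v‖) := by gcongr; exact (h.pos i).le
        _ = _ := by ring
    nlinarith
  have h2 : σ' i' * σ j ≤ 1 := by
    have h3 : ‖toLin g⁻¹ (f' i')‖ ≤ (σ j)⁻¹ * ‖f' i'‖ := by
      refine norm_le_of_coord_le (e := f) (f := e) (inv_nonneg.2 (h.pos j).le) fun l => ?_
      rw [h.inner_inv_apply, norm_mul, norm_inv, h.norm_coe]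
      gcongr
      · exact h.pos j
      · exact hlast l
    rw [h'.apply, norm_smul, h'.norm_coe, e'.norm_eq_one, f'.norm_eq_one, mul_one, mul_one] at h3
    have := h.pos j
    calc σ' i' * σ j ≤ (σ j)⁻¹ * σ j := by gcongr
      _ = 1 := inv_mul_cancel₀ this.ne'
  rw [div_le_div_iff₀ (h.pos i) (h'.pos i')]
  nlinarith

end IsSVD

/-- For `g` with gaps between the two largest singular values of `g` and of `g⁻¹`, the spaces
`U_1(g)` and `U_{d-1}(g)` are a line `L` and a hyperplane `Mᗮ`, and `g`, `g⁻¹` are up to relative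
errors given by the gaps of rank one, with image `L` and with kernel `Mᗮ` respectively. -/
theorem exists_axes_lines (hd : 2 ≤ d) (g : SL) (h1 : 1 < singVal 1 g / singVal 2 g)
    (h2 : 1 < singVal 1 g⁻¹ / singVal 2 g⁻¹) :
    ∃ L M : Line K d, axes 1 g = L.1 ∧ axes (d - 1) g = M.1ᗮ ∧ L.Perp M ∧
      (∀ v, ‖cl K d g v - L.proj (cl K d g v)‖ ≤
        (singVal 1 g / singVal 2 g)⁻¹ * (‖cl K d g‖ * ‖v‖)) ∧
      ∀ v, ‖cl K d g⁻¹ v - cl K d g⁻¹ (M.proj v)‖ ≤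
        (singVal 1 g⁻¹ / singVal 2 g⁻¹)⁻¹ * (‖cl K d g⁻¹‖ * ‖v‖) := by
  obtain ⟨e, f, σ, h⟩ := exists_isSVD g
  obtain ⟨e', f', σ', h'⟩ := exists_isSVD g⁻¹
  let i0 : Fin d := ⟨0, by omega⟩
  let i1 : Fin d := ⟨1, by omega⟩
  let k0 : Fin d := ⟨d - 2, by omega⟩
  let k1 : Fin d := ⟨d - 1, by omega⟩
  have s1 : singVal 1 g = σ i0 := (h.eq_singVal i0).symm
  have s2 : singVal 2 g = σ i1 := (h.eq_singVal i1).symm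
  have s1' : singVal 1 g⁻¹ = σ' i0 := (h'.eq_singVal i0).symm
  have s2' : singVal 2 g⁻¹ = σ' i1 := (h'.eq_singVal i1).symm
  rw [s1, s2] at h1
  rw [s1', s2'] at h2
  have hk01 : (k0 : ℕ) + 1 = k1 := by simp [k0, k1]; omega
  have hgap := h.gap_inv h' hk01 (by simp [k1]; omega) (i' := i0) (j' := i1) rfl rfl
  have hg1 : σ i1 < σ i0 := by rwa [one_lt_div (h.pos i1)] at h1
  have hg2 : σ k1 < σ k0 := by
    rw [one_lt_div (h'.pos i1)] at h2
    rw [← div_lt_one (h.pos k0)]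
    refine hgap.trans_lt ?_
    rwa [div_lt_one (h'.pos i0)]
  have hne : ∀ i, e i ≠ 0 := fun i h0 => by
    have := e.norm_eq_one i
    rw [h0, norm_zero] at this
    exact zero_ne_one this
  have hon := orthonormal_iff_ite.1 e.orthonormal
  have hproj : ∀ i x, (Line.mk (e i) (hne i)).proj x = inner K (e i) x • e i := fun i x =>
    Line.proj_apply_unit (e.norm_eq_one i) (Line.mem_mk _) x
  have hcoord : ∀ i l x, inner K (e l) (x - (Line.mk (e i) (hne i)).proj x) =
      if l = i then 0 else inner K (e l) x := by
    intro i l x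
    rw [hproj, inner_sub_right, inner_smul_right, hon]
    split_ifs with hl
    · rw [hl]; simp
    · simp
  refine ⟨Line.mk (e i0) (hne i0), Line.mk (e k1) (hne k1), ?_, ?_, ?_, ?_, ?_⟩
  · ext v
    have := h.mem_axes_iff (i := i0) (j := i1) rfl hg1 v
    change v ∈ axes 1 g ↔ _ at this
    rw [this]
    constructor
    · intro hv
      rw [← Line.proj_eq_self]
      refine (sub_eq_zero.1 (InnerProductSpace.ext_inner_left_basis e.toBasis fun l => ?_)).symm
      rw [e.coe_toBasis, hcoord, inner_zero_right]
      split_ifs with hl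
      · rfl
      · refine hv l (Fin.le_def.2 ?_)
        have : (l : ℕ) ≠ i0 := fun hh => hl (Fin.ext hh)
        simp [i0] at this
        simp [i1]; omega
    · intro hv l hl
      rw [← Line.proj_eq_self.2 hv, hproj, inner_smul_right, hon, if_neg, mul_zero]
      rintro rfl
      have : (1 : ℕ) ≤ 0 := hl
      omega
  · ext v
    have := h.mem_axes_iff hk01 hg2 v
    change v ∈ axes (d - 1) g ↔ _ at this
    rw [this]
    have hl : ∀ l : Fin d, k1 ≤ l ↔ l = k1 := fun l => by
      constructor
      · intro hh
        have : d - 1 ≤ (l : ℕ) := hh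
        exact Fin.ext (by simp [k1]; omega)
      · rintro rfl; exact le_rfl
    simp only [hl, forall_eq]
    exact Submodule.mem_orthogonal_singleton_iff_inner_right.symm
  · rw [Line.perp_iff (hne i0) (Line.mem_mk _) (hne k1) (Line.mem_mk _), hon, if_neg]
    intro hh
    have : (0 : ℕ) = d - 1 := congrArg Fin.val hh
    omega
  · intro v
    rw [s1, s2, inv_div]
    have h3 : ‖cl K d g v - (Line.mk (e i0) (hne i0)).proj (cl K d g v)‖ ≤ σ i1 * ‖v‖ := by
      refine norm_le_of_coord_le (e := e) (f := f) (h.pos i1).le fun l => ?_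
      rw [hcoord]
      split_ifs with hl
      · rw [norm_zero]; exact mul_nonneg (h.pos i1).le (norm_nonneg _)
      · rw [cl_apply, h.inner_apply, norm_mul, h.norm_coe]
        gcongr
        refine h.antitone (Fin.le_def.2 ?_)
        have : (l : ℕ) ≠ i0 := fun hh => hl (Fin.ext hh)
        simp [i0] at this
        simp [i1]; omega
    refine h3.trans ?_
    rw [← mul_assoc]
    gcongr
    rw [div_mul_eq_mul_div, le_div_iff₀ (h.pos i0)]
    have := h.le_norm i0
    have := h.pos i1
    gcongr
  · intro v
    rw [s1', s2', inv_div, ← map_sub]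
    have h3 : ‖cl K d g⁻¹ (v - (Line.mk (e k1) (hne k1)).proj v)‖ ≤ (σ k0)⁻¹ * ‖v‖ := by
      refine norm_le_of_coord_le (e := f) (f := e) (inv_nonneg.2 (h.pos k0).le) fun l => ?_
      rw [cl_apply, h.inner_inv_apply, hcoord, norm_mul, norm_inv, h.norm_coe]
      split_ifs with hl
      · rw [norm_zero, mul_zero]
        exact mul_nonneg (inv_nonneg.2 (h.pos k0).le) (norm_nonneg _)
      · have h0 := h.pos k0
        gcongr
        refine h.antitone (Fin.le_def.2 ?_)
        have : (l : ℕ) ≠ k1 := fun hh => hl (Fin.ext hh)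
        have := l.2
        simp [k1] at *
        simp [k0]; omega
    refine h3.trans ?_
    rw [← mul_assoc]
    gcongr
    have h4 := h.le_norm_inv k1
    calc (σ k0)⁻¹ = σ k1 / σ k0 * (σ k1)⁻¹ := by
          have := (h.pos k1).ne'
          field_simp
      _ ≤ σ' i1 / σ' i0 * ‖cl K d g⁻¹‖ := by
          have := h'.pos i1
          have := h'.pos i0
          have := h.pos k1
          gcongr

end SVD

end RelAnosov

namespace RelAnosov

/-! ### Dynamics of divergent groups with a single limit flag -/

section Divergent

variable {K : Type*} [RCLike K] {d : ℕ}

local notation "𝔼" => EuclideanSpace K (Fin d)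
local notation "SL" => Matrix.SpecialLinearGroup (Fin d) K

theorem Escaping.comp_strictMono {G : Type*} {u : ℕ → G} (hu : Escaping u) {φ : ℕ → ℕ}
    (hφ : Tendsto φ atTop atTop) : Escaping (u ∘ φ) := Tendsto.comp hu hφ

theorem Escaping.inv {G : Type*} [Group G] {u : ℕ → G} (hu : Escaping u) :
    Escaping fun n => (u n)⁻¹ :=
  Tendsto.comp (inv_injective.tendsto_cofinite) hu

theorem cl_ne_zero (hd : 2 ≤ d) (g : SL) : cl K d g ≠ 0 := by
  intro h0
  have h1 : (1 : 𝔼 →L[K] 𝔼) = 0 := by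
    rw [← map_one (cl K d), ← inv_mul_cancel g, map_mul, h0, mul_zero]
  have : Nonempty (Fin d) := ⟨⟨0, by omega⟩⟩
  exact one_ne_zero h1

theorem finrank_orthogonal_line (V : Line K d) : Module.finrank K (V.1ᗮ) = d - 1 := by
  have h := V.1.finrank_add_finrank_orthogonal
  rw [V.2, finrank_euclideanSpace_fin] at h
  omega

/-- The pair of lines encoding a flag `(F¹, F^{d-1})`: the line `F¹` and the normal line of
`F^{d-1}`. -/
def IsPairOf (F : FlagPair K d) (G : Subspaces K d × Subspaces K d) : Prop :=
  F.1.1 = G.1 ∧ F.2.1ᗮ = G.2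

theorem exists_isPairOf (hd : 2 ≤ d) {G : Subspaces K d × Subspaces K d}
    (h1 : Module.finrank K G.1 = 1) (h2 : Module.finrank K G.2 = d - 1) :
    ∃ F : FlagPair K d, IsPairOf F G := by
  have h := G.2.finrank_add_finrank_orthogonal
  rw [h2, finrank_euclideanSpace_fin] at h
  exact ⟨FlagPair.mk ⟨G.1, h1⟩ ⟨G.2ᗮ, by omega⟩, rfl, Submodule.orthogonal_orthogonal _⟩

theorem IsPairOf.transverse_iff {F F' : FlagPair K d} {G G' : Subspaces K d × Subspaces K d}
    (h : IsPairOf F G) (h' : IsPairOf F' G') : Transverse G G' ↔ F.Opp F' := by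
  rw [Transverse, ← h.1, ← h'.1, ← h.2, ← h'.2, Line.isCompl_orthogonal_iff,
    Line.isCompl_orthogonal_iff]
  rfl

/-- A norm limit `T` of the normalized maps `g n / ‖g n‖` is of rank one when, up to small relative
errors, the image of `g n` is in a line near `p` and the kernel is near the complement of `q`. -/
theorem rankOneLimit_of_approx {g : ℕ → SL} {L M : ℕ → Line K d} {p q : Line K d} {ε ε' : ℕ → ℝ}
    (hd : 2 ≤ d) (hL : Tendsto L atTop (𝓝 p)) (hM : Tendsto M atTop (𝓝 q))
    (hε : Tendsto ε atTop (𝓝 0)) (hε' : Tendsto ε' atTop (𝓝 0))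
    (hgL : ∀ n v, ‖cl K d (g n) v - (L n).proj (cl K d (g n) v)‖ ≤
      ε n * (‖cl K d (g n)‖ * ‖v‖))
    (hgM : ∀ n v, ‖cl K d (g n) v - cl K d (g n) ((M n).proj v)‖ ≤
      ε' n * (‖cl K d (g n)‖ * ‖v‖))
    {T : 𝔼 →L[K] 𝔼}
    (hT : Tendsto (fun n => ((‖cl K d (g n)‖⁻¹ : ℝ) : K) • cl K d (g n)) atTop (𝓝 T)) :
    RankOneLimit g p q := by
  set c : ℕ → K := fun n => ((‖cl K d (g n)‖⁻¹ : ℝ) : K) with hc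
  have hpos : ∀ n, 0 < ‖cl K d (g n)‖ := fun n => norm_pos_iff.2 (cl_ne_zero hd _)
  have hcn : ∀ n, ‖c n‖ = ‖cl K d (g n)‖⁻¹ := fun n => by
    rw [hc, RCLike.norm_ofReal, abs_of_pos (inv_pos.2 (hpos n))]
  have hT1 : ‖T‖ = 1 := by
    have h1 : Tendsto (fun n => ‖c n • cl K d (g n)‖) atTop (𝓝 ‖T‖) := hT.norm
    have h2 : (fun n => ‖c n • cl K d (g n)‖) = fun _ => (1 : ℝ) := by
      funext n
      rw [norm_smul, hcn, inv_mul_cancel₀ (hpos n).ne']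
    rw [h2] at h1
    exact tendsto_nhds_unique h1 tendsto_const_nhds
  have hT0 : T ≠ 0 := by
    rintro rfl; rw [norm_zero] at hT1; exact zero_ne_one hT1
  have hTv : ∀ v, Tendsto (fun n => c n • cl K d (g n) v) atTop (𝓝 (T v)) := fun v =>
    tendsto_clm_apply hT tendsto_const_nhds
  have hsmall : ∀ (η : ℕ → ℝ) (w : ℕ → 𝔼) (v : 𝔼), Tendsto η atTop (𝓝 0) →
      (∀ n, ‖w n‖ ≤ η n * (‖cl K d (g n)‖ * ‖v‖)) → Tendsto (fun n => c n • w n) atTop (𝓝 0) := by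
    intro η w v hη hw
    rw [tendsto_zero_iff_norm_tendsto_zero]
    have h0 : Tendsto (fun n => η n * ‖v‖) atTop (𝓝 0) := by simpa using hη.mul_const ‖v‖
    refine squeeze_zero (fun _ => norm_nonneg _) (fun n => ?_) h0
    rw [norm_smul, hcn]
    have := hpos n
    calc _ ≤ ‖cl K d (g n)‖⁻¹ * (η n * (‖cl K d (g n)‖ * ‖v‖)) := by gcongr; exact hw n
      _ = η n * ‖v‖ := by field_simp
  have hrange : ∀ v, T v = p.proj (T v) := by
    intro v
    have h1 := hsmall ε _ v hε (fun n => hgL n v)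
    have h2 : Tendsto (fun n => (L n).proj (c n • cl K d (g n) v)) atTop (𝓝 (p.proj (T v))) :=
      tendsto_clm_apply ((Line.continuous_proj.tendsto p).comp hL) (hTv v)
    have h3 := (hTv v).sub h2
    refine sub_eq_zero.1 (tendsto_nhds_unique h3 ?_)
    refine h1.congr fun n => ?_
    rw [smul_sub, map_smul]
  have hker : ∀ v, T v = T (q.proj v) := by
    intro v
    have h1 := hsmall ε' _ v hε' (fun n => hgM n v)
    have h2 : Tendsto (fun n => (c n • cl K d (g n)) ((M n).proj v)) atTop (𝓝 (T (q.proj v))) :=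
      tendsto_clm_apply hT (tendsto_clm_apply ((Line.continuous_proj.tendsto q).comp hM)
        tendsto_const_nhds)
    have h3 := (hTv v).sub h2
    refine sub_eq_zero.1 (tendsto_nhds_unique h3 ?_)
    refine h1.congr fun n => ?_
    rw [smul_sub, smul_apply]
  refine ⟨c, T, hT, hT0, fun v => ?_, fun v => ?_⟩
  · rw [hrange]; exact p.proj_mem _
  · obtain ⟨w, hw1, hw, hspan⟩ := q.exists_unit
    have hqv : ∀ x, T x = inner K w x • T w := fun x => by
      rw [hker x, Line.proj_apply_unit hw1 hw, map_smul]
    have hTw : T w ≠ 0 := by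
      intro h0
      refine hT0 (ContinuousLinearMap.ext fun x => ?_)
      rw [hqv, h0, smul_zero]; rfl
    rw [hqv, smul_eq_zero_iff_left hTw]
    rw [Submodule.mem_orthogonal]
    constructor
    · intro h x hx
      obtain ⟨a, rfl⟩ := hspan x hx
      rw [inner_smul_left, h, mul_zero]
    · exact fun h => h w hw

/-- A limit of the spaces `U_1`, `U_{d-1}` along an escaping sequence is the limit flag. -/
theorem eq_of_tendsto_axes {U : Subgroup SL} {F_U : Subspaces K d × Subspaces K d}
    (hlim : limitSet 1 U = {F_U}) {F : FlagPair K d} (hF : IsPairOf F F_U)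
    {v : ℕ → U} {A B : ℕ → Line K d} {a b : Line K d} (hv : Escaping v)
    (hA : ∀ n, axes 1 (v n : SL) = (A n).1) (hB : ∀ n, axes (d - 1) (v n : SL) = (B n).1ᗮ)
    (hAB : ∀ n, (A n).Perp (B n)) (ha : Tendsto A atTop (𝓝 a)) (hb : Tendsto B atTop (𝓝 b)) :
    a = F.1 ∧ b = F.2 := by
  have hab : a.Perp b := by
    by_contra hcon
    have h1 : {z : Line K d × Line K d | ¬ z.1.Perp z.2} ∈ 𝓝 (a, b) :=
      Line.isOpen_not_perp.mem_nhds hcon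
    obtain ⟨n, hn⟩ := ((ha.prodMk_nhds hb).eventually h1).exists
    exact hn (hAB n)
  have hmem : (a.1, b.1ᗮ) ∈ limitSet 1 U := by
    refine ⟨⟨a.2, finrank_orthogonal_line b, hab⟩, v, hv, ?_⟩
    have h1 : Tendsto (fun n => ((A n).1, (B n).1ᗮ)) atTop (𝓝 (a.1, b.1ᗮ)) :=
      ((Line.continuous_val.tendsto a).comp ha).prodMk_nhds
        ((Line.continuous_orthogonal.tendsto b).comp hb)
    refine h1.congr fun n => ?_
    rw [hA, hB]
  rw [hlim, Set.mem_singleton_iff] at hmem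
  have h1 : a.1 = F.1.1 := by rw [hF.1, ← hmem]
  have h2 : b.1ᗮ = F.2.1ᗮ := by rw [hF.2, ← hmem]
  refine ⟨Subtype.ext h1, Subtype.ext ?_⟩
  rw [← Submodule.orthogonal_orthogonal b.1, h2, Submodule.orthogonal_orthogonal]

/-- Joint subsequential limits of the axes and the normalized maps. -/
theorem exists_subseq_tendsto (L M L' M' : ℕ → Line K d) (A A' : ℕ → (𝔼 →L[K] 𝔼))
    (hA : ∀ n, ‖A n‖ ≤ 1) (hA' : ∀ n, ‖A' n‖ ≤ 1) :
    ∃ φ : ℕ → ℕ, StrictMono φ ∧ ∃ l m l' m' T T', Tendsto (L ∘ φ) atTop (𝓝 l) ∧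
      Tendsto (M ∘ φ) atTop (𝓝 m) ∧ Tendsto (L' ∘ φ) atTop (𝓝 l') ∧
      Tendsto (M' ∘ φ) atTop (𝓝 m') ∧ Tendsto (A ∘ φ) atTop (𝓝 T) ∧
      Tendsto (A' ∘ φ) atTop (𝓝 T') := by
  have : ProperSpace (𝔼 →L[K] 𝔼) := FiniteDimensional.proper K _
  have hB := isCompact_closedBall (0 : 𝔼 →L[K] 𝔼) 1
  obtain ⟨z, -, φ, hφ, hz⟩ := (isCompact_univ (X := (Line K d × Line K d) ×
    (Line K d × Line K d))).tendsto_subseq (x := fun n => ((L n, M n), (L' n, M' n)))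
    (fun n => trivial)
  obtain ⟨T, -, ψ, hψ, hT⟩ := hB.tendsto_subseq (x := A ∘ φ) (fun n => by simpa using hA _)
  obtain ⟨T', -, χ, hχ, hT'⟩ := hB.tendsto_subseq (x := A' ∘ φ ∘ ψ) (fun n => by simpa using hA' _)
  have h1 := hz.comp (hψ.comp hχ).tendsto_atTop
  have h2 := (continuous_fst.tendsto z).comp h1
  have h3 := (continuous_snd.tendsto z).comp h1
  exact ⟨φ ∘ ψ ∘ χ, hφ.comp (hψ.comp hχ), _, _, _, _, T, T',
    (continuous_fst.tendsto z.1).comp h2, (continuous_snd.tendsto z.1).comp h2,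
    (continuous_fst.tendsto z.2).comp h3, (continuous_snd.tendsto z.2).comp h3,
    hT.comp hχ.tendsto_atTop, hT'⟩

/-- An escaping sequence with gaps in the singular values has a subsequence that attracts towards
the limit flag and repels from it. -/
theorem exists_dyn_of_gaps (hd : 2 ≤ d) {U : Subgroup SL}
    {F_U : Subspaces K d × Subspaces K d} (hlim : limitSet 1 U = {F_U}) {F : FlagPair K d}
    (hF : IsPairOf F F_U) {w : ℕ → U} (hw : Escaping w)
    (hw1 : ∀ n, 1 < singVal 1 (w n : SL) / singVal 2 (w n : SL))
    (hw2 : ∀ n, 1 < singVal 1 (w n : SL)⁻¹ / singVal 2 (w n : SL)⁻¹)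
    (hε : Tendsto (fun n => (singVal 1 (w n : SL) / singVal 2 (w n : SL))⁻¹) atTop (𝓝 0))
    (hε' : Tendsto (fun n => (singVal 1 (w n : SL)⁻¹ / singVal 2 (w n : SL)⁻¹)⁻¹) atTop (𝓝 0)) :
    ∃ φ : ℕ → ℕ, StrictMono φ ∧ Dyn (fun n => (w (φ n) : SL)) F F := by
  choose L M hL hM hLM hgL hgM using fun n => exists_axes_lines hd (w n : SL) (hw1 n) (hw2 n)
  have hw1' : ∀ n, 1 < singVal 1 ((w n : SL)⁻¹)⁻¹ / singVal 2 ((w n : SL)⁻¹)⁻¹ := fun n => by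
    rw [inv_inv]; exact hw1 n
  choose L' M' hL' hM' hLM' hgL' hgM' using
    fun n => exists_axes_lines hd (w n : SL)⁻¹ (hw2 n) (hw1' n)
  have hgM'' : ∀ n v, ‖cl K d (w n : SL) v - cl K d (w n : SL) ((M' n).proj v)‖ ≤
      (singVal 1 (w n : SL) / singVal 2 (w n : SL))⁻¹ * (‖cl K d (w n : SL)‖ * ‖v‖) := by
    intro n v
    have := hgM' n v
    rw [inv_inv] at this
    exact this
  have hc : ∀ g : SL, ‖((‖cl K d g‖⁻¹ : ℝ) : K) • cl K d g‖ ≤ 1 := by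
    intro g
    rw [norm_smul, RCLike.norm_ofReal, abs_inv, abs_norm]
    exact inv_mul_le_one
  obtain ⟨φ, hφ, l, m, l', m', T, T', hl, hm, hl', hm', hT, hT'⟩ := exists_subseq_tendsto
    L M L' M' (fun n => ((‖cl K d (w n : SL)‖⁻¹ : ℝ) : K) • cl K d (w n : SL))
    (fun n => ((‖cl K d (w n : SL)⁻¹‖⁻¹ : ℝ) : K) • cl K d (w n : SL)⁻¹)
    (fun n => hc _) (fun n => hc _)
  have hφt := hφ.tendsto_atTop
  have hwφ : Escaping (w ∘ φ) := hw.comp_strictMono hφt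
  obtain ⟨hl0, hm1⟩ := eq_of_tendsto_axes hlim hF (v := w ∘ φ) (A := L ∘ φ) (B := M ∘ φ)
    hwφ (fun n => hL (φ n)) (fun n => hM (φ n)) (fun n => hLM (φ n)) hl hm
  obtain ⟨hl1, hm2⟩ := eq_of_tendsto_axes hlim hF (v := fun n => ((w ∘ φ) n)⁻¹) (A := L' ∘ φ)
    (B := M' ∘ φ) hwφ.inv (fun n => hL' (φ n)) (fun n => hM' (φ n)) (fun n => hLM' (φ n))
    hl' hm'
  rw [hl0] at hl
  rw [hm1] at hm
  rw [hl1] at hl'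
  rw [hm2] at hm'
  refine ⟨φ, hφ, ?_, ?_⟩
  · exact rankOneLimit_of_approx (g := fun n => (w (φ n) : SL)) hd hl hm' (hε.comp hφt)
      (hε.comp hφt) (fun n v => hgL (φ n) v) (fun n v => hgM'' (φ n) v) hT
  · exact rankOneLimit_of_approx (g := fun n => (w (φ n) : SL)⁻¹) hd hl' hm (hε'.comp hφt)
      (hε'.comp hφt) (fun n v => hgL' (φ n) v) (fun n v => hgM (φ n) v) hT'

/-- Escaping sequences in a divergent group with a single limit flag have subsequences that attract
towards this flag and repel from it. -/
theorem exists_dyn_of_escaping (hd : 2 ≤ d) {U : Subgroup SL} (hdiv : IsDivergent 1 U)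
    {F_U : Subspaces K d × Subspaces K d} (hlim : limitSet 1 U = {F_U}) {F : FlagPair K d}
    (hF : IsPairOf F F_U) {u : ℕ → U} (hu : Escaping u) :
    ∃ φ : ℕ → ℕ, StrictMono φ ∧ Dyn (fun n => (u (φ n) : SL)) F F := by
  have hdiv' : ∀ v : ℕ → U, Escaping v →
      Tendsto (fun n => singVal 1 (v n : SL) / singVal 2 (v n : SL)) atTop atTop := hdiv
  have hd1 := hdiv' u hu
  have hd2 : Tendsto (fun n => singVal 1 (u n : SL)⁻¹ / singVal 2 (u n : SL)⁻¹) atTop atTop := by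
    simpa only [Subgroup.coe_inv] using hdiv' (fun n => (u n)⁻¹) hu.inv
  obtain ⟨N, hN⟩ := eventually_atTop.1
    ((hd1.eventually_gt_atTop 1).and (hd2.eventually_gt_atTop 1))
  have hshift : Tendsto (fun n => n + N) atTop atTop := tendsto_add_atTop_nat N
  have hwesc : Escaping fun n => u (n + N) := hu.comp_strictMono hshift
  have hw1 : ∀ n, 1 < singVal 1 (u (n + N) : SL) / singVal 2 (u (n + N) : SL) :=
    fun n => (hN (n + N) (Nat.le_add_left N n)).1
  have hw2 : ∀ n, 1 < singVal 1 (u (n + N) : SL)⁻¹ / singVal 2 (u (n + N) : SL)⁻¹ :=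
    fun n => (hN (n + N) (Nat.le_add_left N n)).2
  have hε : Tendsto (fun n => (singVal 1 (u (n + N) : SL) / singVal 2 (u (n + N) : SL))⁻¹)
      atTop (𝓝 0) := (tendsto_inv_atTop_zero.comp hd1).comp hshift
  have hε' : Tendsto (fun n => (singVal 1 (u (n + N) : SL)⁻¹ / singVal 2 (u (n + N) : SL)⁻¹)⁻¹)
      atTop (𝓝 0) := (tendsto_inv_atTop_zero.comp hd2).comp hshift
  obtain ⟨φ, hφ, h⟩ := exists_dyn_of_gaps hd hlim hF (w := fun n => u (n + N)) hwesc hw1 hw2 hε hε'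
  exact ⟨fun n => φ n + N, fun a b hab => Nat.add_lt_add_right (hφ hab) N, h⟩

/-- A divergent group with a single limit flag fixes this flag. -/
theorem smul_eq_of_limitSet (hd : 2 ≤ d) {U : Subgroup SL} (hdiv : IsDivergent 1 U)
    {F_U : Subspaces K d × Subspaces K d} (hlim : limitSet 1 U = {F_U}) {F z : FlagPair K d}
    (hF : IsPairOf F F_U) (hz : z.Opp F) {u : SL} (hu : u ∈ U) : u • F = F := by
  have hmem : F_U ∈ limitSet 1 U := by rw [hlim]; rfl
  obtain ⟨-, w, hw, -⟩ := hmem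
  obtain ⟨φ, hφ, h1⟩ := exists_dyn_of_escaping hd hdiv hlim hF hw
  have hw1 : Escaping (w ∘ φ) := hw.comp_strictMono hφ.tendsto_atTop
  have hw2 : Escaping fun n => (⟨u, hu⟩ : U) * w (φ n) :=
    Tendsto.comp (mul_right_injective (⟨u, hu⟩ : U)).tendsto_cofinite hw1
  obtain ⟨ψ, hψ, h2⟩ := exists_dyn_of_escaping hd hdiv hlim hF hw2
  have h3 := (h1.comp hψ.tendsto_atTop).tendsto (tendsto_const_nhds (x := z)) hz
  have h4 := h2.tendsto (tendsto_const_nhds (x := z)) hz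
  refine tendsto_nhds_unique ((h3.const_smul u).congr fun n => ?_) h4
  rw [← mul_smul]; rfl
end Divergent

end RelAnosov

namespace RelAnosov

/-! ### Dynamics of powers of proximal elements -/

section Proximal

open Polynomial

theorem tendsto_zero_of_recursion {w : ℂ} (hw : ‖w‖ < 1) {a b : ℕ → ℂ}
    (hb : Tendsto b atTop (𝓝 0)) (h : ∀ n, a (n + 1) = w * a n + b n) :
    Tendsto a atTop (𝓝 0) := by
  rw [Metric.tendsto_atTop] at hb ⊢
  simp only [dist_zero_right] at hb ⊢
  intro ε hε
  obtain ⟨N, hN⟩ := hb (ε / 2 * (1 - ‖w‖)) (by have : 0 < 1 - ‖w‖ := by linarith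
                                               positivity)
  have h1 : ∀ k, ‖a (N + k)‖ ≤ ‖w‖ ^ k * ‖a N‖ + ε / 2 := by
    intro k
    induction k with
    | zero => simp; positivity
    | succ k ih =>
      rw [← add_assoc, h]
      have h2 := (hN (N + k) (by omega)).le
      have h3 := norm_add_le (w * a (N + k)) (b (N + k))
      rw [norm_mul] at h3
      have h4 := mul_le_mul_of_nonneg_left ih (norm_nonneg w)
      rw [pow_succ]
      nlinarith
  have h2 : Tendsto (fun k => ‖w‖ ^ k * ‖a N‖) atTop (𝓝 0) := by
    simpa using (tendsto_pow_atTop_nhds_zero_of_lt_one (norm_nonneg w) hw).mul_const ‖a N‖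
  obtain ⟨k₀, hk₀⟩ := eventually_atTop.1 (h2.eventually_lt_const (half_pos hε))
  refine ⟨N + k₀, fun n hn => ?_⟩
  obtain ⟨k, rfl⟩ := Nat.exists_eq_add_of_le (show N ≤ n by omega)
  have := h1 k
  have := hk₀ k (by omega)
  linarith

/-- Powers of a matrix decay relatively to `z ^ n` on what is annihilated by a polynomial whose
roots are smaller than `z`. -/
theorem tendsto_pow_mul_of_roots {ι : Type*} [Fintype ι] [DecidableEq ι] (B : Matrix ι ι ℂ) {z : ℂ}
    (hz : z ≠ 0) (s : Multiset ℂ) (hs : ∀ w ∈ s, ‖w‖ < ‖z‖) (y : Matrix ι ι ℂ)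
    (hy : aeval B (s.map fun w => X - C w).prod * y = 0) (i j : ι) :
    Tendsto (fun n => (z ^ n)⁻¹ * (B ^ n * y) i j) atTop (𝓝 0) := by
  induction s using Multiset.induction_on generalizing y with
  | empty =>
    have h0 : y = 0 := by simpa using hy
    simp [h0]
  | cons w s ih =>
    rw [Multiset.map_cons, Multiset.prod_cons, mul_comm, map_mul, mul_assoc] at hy
    have h1 := ih (fun w hw => hs w (Multiset.mem_cons_of_mem hw)) _ hy
    have hw := hs w (Multiset.mem_cons_self _ _)
    refine tendsto_zero_of_recursion (w := w / z) ?_ (by rw [← mul_zero z⁻¹]; exact h1.const_mul z⁻¹)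
      fun n => ?_
    · rw [norm_div, div_lt_one (norm_pos_iff.2 hz)]
      exact hw
    · have h2 : B ^ n * (aeval B (X - C w) * y) = B ^ (n + 1) * y - w • (B ^ n * y) := by
        rw [map_sub, aeval_X, aeval_C, sub_mul, mul_sub, Algebra.algebraMap_eq_smul_one,
          smul_mul_assoc, one_mul, mul_smul_comm, pow_succ, mul_assoc]
      rw [h2, Matrix.sub_apply, Matrix.smul_apply, smul_eq_mul, pow_succ]
      field_simp
      ring

variable {K : Type*} [RCLike K] {d : ℕ}

local notation "𝔼" => EuclideanSpace K (Fin d)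
local notation "SL" => Matrix.SpecialLinearGroup (Fin d) K

/-- A root that is strictly larger than all the others lies in the field of definition. -/
theorem exists_toComplex_eq {P : K[X]} {z : ℂ} {s : Multiset ℂ}
    (hP : (P.map (toComplex K)).roots = z ::ₘ s) (hs : ∀ w ∈ s, ‖w‖ < ‖z‖) :
    ∃ c : K, toComplex K c = z := by
  rcases RCLike.I_eq_zero_or_im_I_eq_one (K := K) with hI | hI
  · have hstar : ∀ x : K, starRingEnd ℂ (toComplex K x) = toComplex K x := by
      intro x
      have hx : RCLike.im x = 0 := by
        have := RCLike.mul_im_I_ax (K := K) x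
        rw [hI] at this
        simpa using this.symm
      rw [toComplex_apply, RCLike.map_apply, hx]
      simp
    have hne : P.map (toComplex K) ≠ 0 := by
      intro h0
      rw [h0, roots_zero] at hP
      exact Multiset.cons_ne_zero hP.symm
    have hroot : (P.map (toComplex K)).IsRoot z :=
      isRoot_of_mem_roots (hP ▸ Multiset.mem_cons_self _ _)
    have hroot' : (P.map (toComplex K)).IsRoot (starRingEnd ℂ z) := by
      have h1 := hroot.map (f := starRingEnd ℂ)
      rw [Polynomial.map_map] at h1
      rwa [RingHom.ext (f := (starRingEnd ℂ).comp (toComplex K)) (g := toComplex K) hstar] at h1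
    have h2 : starRingEnd ℂ z ∈ z ::ₘ s := hP ▸ (mem_roots hne).2 hroot'
    rcases Multiset.mem_cons.1 h2 with h3 | h3
    · refine ⟨(z.re : K), ?_⟩
      rw [toComplex_apply, RCLike.map_apply]
      simpa using Complex.conj_eq_iff_re.1 h3
    · exact absurd (hs _ h3) (by simp)
  · refine ⟨(z.re : K) + (z.im : K) * RCLike.I, ?_⟩
    rw [toComplex_apply, RCLike.map_apply]
    apply Complex.ext <;> simp [hI]

theorem exists_dominant_root (hd : 2 ≤ d) {g : SL} (hg : IsProximal 1 g) :
    ∃ z s, complexEigenvalues g = z ::ₘ s ∧ ‖z‖ = eigMod 1 g ∧ ∀ w ∈ s, ‖w‖ < ‖z‖ := by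
  set l := ((complexEigenvalues g).map (fun z => ‖z‖)).sort (· ≥ ·) with hl
  have hlen : l.length = d := by
    rw [hl, Multiset.length_sort, Multiset.card_map, card_complexEigenvalues]
  have hcoe : (l : Multiset ℝ) = (complexEigenvalues g).map (fun z => ‖z‖) := by
    rw [hl, Multiset.sort_eq]
  have hsort : l.Pairwise (· ≥ ·) := Multiset.pairwise_sort _ _
  have hg' : l.getD 1 0 < l.getD 0 0 := hg
  have h0 : eigMod 1 g = l.getD 0 0 := rfl
  match l, hlen, hcoe, hsort, hg', h0 with
  | a :: b :: t, _, hcoe, hsort, hg', h0 =>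
    have hab : b < a := by simpa using hg'
    have ha : a ∈ (complexEigenvalues g).map (fun z => ‖z‖) := by rw [← hcoe]; simp
    obtain ⟨z, hz, hza⟩ := Multiset.mem_map.1 ha
    obtain ⟨s, hs⟩ := Multiset.exists_cons_of_mem hz
    refine ⟨z, s, hs, by rw [h0, hza]; rfl, fun w hw => ?_⟩
    rw [hs, Multiset.map_cons, hza, ← Multiset.cons_coe] at hcoe
    have h1 := (Multiset.cons_inj_right a).1 hcoe
    have h2 : ‖w‖ ∈ ((b :: t : List ℝ) : Multiset ℝ) := by
      rw [h1]; exact Multiset.mem_map_of_mem _ hw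
    rw [hza]
    rcases List.mem_cons.1 (Multiset.mem_coe.1 h2) with h3 | h3
    · rw [h3]; exact hab
    · exact ((List.pairwise_cons.1 (List.pairwise_cons.1 hsort).2).1 _ h3).trans_lt hab
  | [], hlen, _, _, _, _ => simp at hlen; omega
  | [a], hlen, _, _, _, _ => simp at hlen; omega

theorem charpoly_toLin_eq (g : SL) :
    (toLin g).charpoly = (g : Matrix (Fin d) (Fin d) K).charpoly := by
  rw [toLin, Matrix.toEuclideanLin, Matrix.toLpLin_eq_toLin]
  exact Matrix.charpoly_toLin _ _

/-- The powers of a proximal element, divided by those of the dominant eigenvalue, converge to a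
map with one-dimensional range. -/
theorem exists_tendsto_pow (hd : 2 ≤ d) {g : SL} (hg : IsProximal 1 g) :
    ∃ (c : K) (T : 𝔼 →L[K] 𝔼), c ≠ 0 ∧ ‖c‖ = eigMod 1 g ∧
      Module.finrank K (Module.End.eigenspace (toLin g) c) = 1 ∧
      Tendsto (fun n => (c ^ n)⁻¹ • cl K d (g ^ n)) atTop (𝓝 T) := by
  obtain ⟨z, s, hzs, hz, hs⟩ := exists_dominant_root hd hg
  set A : Matrix (Fin d) (Fin d) K := g.1 with hA
  set P := A.charpoly with hPdef
  have hPr : (P.map (toComplex K)).roots = z ::ₘ s := by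
    rw [hPdef, ← Matrix.charpoly_map]; exact hzs
  obtain ⟨c, rfl⟩ := exists_toComplex_eq hPr hs
  have hinj : Function.Injective (toComplex K) := (toComplex K).injective
  have hP0 : P ≠ 0 := (Matrix.charpoly_monic A).ne_zero
  have hPm : (P.map (toComplex K)).Monic := (Matrix.charpoly_monic A).map _
  -- the dominant eigenvalue does not vanish, as there is a smaller one
  have hc : c ≠ 0 := by
    rintro rfl
    have hcard := card_complexEigenvalues g
    rw [hzs, Multiset.card_cons] at hcard
    obtain ⟨w, hw⟩ := Multiset.card_pos_iff_exists_mem.1 (show 0 < Multiset.card s by omega)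
    have := hs w hw
    rw [map_zero, norm_zero] at this
    exact absurd this (norm_nonneg w).not_gt
  have hmult : rootMultiplicity c P = 1 := by
    classical
    rw [eq_rootMultiplicity_map hinj, ← count_roots, hPr, Multiset.count_cons_self,
      Multiset.count_eq_zero_of_notMem]
    exact fun h => lt_irrefl _ (hs _ h)
  have hroot : P.IsRoot c := by
    rw [← rootMultiplicity_pos hP0, hmult]; exact one_pos
  have heig : Module.finrank K (Module.End.eigenspace (toLin g) c) = 1 := by
    apply le_antisymm
    · have h1 := LinearMap.finrank_eigenspace_le (toLin g) c
      rwa [charpoly_toLin_eq, ← hA, ← hPdef, hmult] at h1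
    · have h1 : Module.End.HasEigenvalue (toLin g) c := by
        rw [Module.End.hasEigenvalue_iff_isRoot_charpoly, charpoly_toLin_eq]
        exact hroot
      exact Submodule.one_le_finrank_iff.2 h1
  -- the part of the powers that decays
  have hprod : P.map (toComplex K) =
      (X - C (toComplex K c)) * (s.map fun w => X - C w).prod := by
    rw [← (IsAlgClosed.splits (P.map (toComplex K))).eq_prod_roots_of_monic hPm |>.symm, hPr,
      Multiset.map_cons, Multiset.prod_cons]
  have hdecay : Tendsto (fun n => (c ^ n)⁻¹ • (A ^ n * (A - algebraMap K _ c))) atTop (𝓝 0) := by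
    refine tendsto_pi_nhds.2 fun i => tendsto_pi_nhds.2 fun j => ?_
    refine tendsto_zero_iff_norm_tendsto_zero.2 ?_
    have h1 := tendsto_pow_mul_of_roots (A.map (toComplex K)) (z := toComplex K c)
      ((_root_.map_ne_zero _).2 hc) s hs
      (aeval (A.map (toComplex K)) (X - C (toComplex K c))) (by
        rw [← map_mul, mul_comm, ← hprod, hPdef, ← Matrix.charpoly_map]
        exact Matrix.aeval_self_charpoly _) i j
    refine (tendsto_zero_iff_norm_tendsto_zero.1 h1).congr fun n => ?_
    rw [Matrix.smul_apply, smul_eq_mul, norm_mul, norm_mul, norm_inv, norm_inv, ← map_pow,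
      norm_toComplex, ← norm_toComplex ((A ^ n * (A - algebraMap K _ c)) i j)]
    congr 2
    have h2 : (A ^ n * (A - algebraMap K _ c)).map (toComplex K) =
        A.map (toComplex K) ^ n * aeval (A.map (toComplex K)) (X - C (toComplex K c)) := by
      have h3 := map_mul (toComplex K).mapMatrix (A ^ n) (A - algebraMap K _ c)
      rw [map_pow, map_sub] at h3
      rw [map_sub, aeval_X, aeval_C]
      refine h3.trans ?_
      congr 2
      ext k l
      by_cases hkl : k = l
      · subst hkl; simp [Matrix.algebraMap_matrix_apply]
      · simp [Matrix.algebraMap_matrix_apply, hkl]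
    exact (congrFun (congrFun h2 i) j).symm
  -- a Bezout identity splits off the eigenspace
  obtain ⟨q, hq⟩ : ∃ q, (X - C c) * q = P := ⟨_, mul_divByMonic_eq_iff_isRoot.2 hroot⟩
  have hcop : IsCoprime (X - C c) q := by
    rw [(irreducible_X_sub_C c).coprime_iff_not_dvd]
    rintro ⟨r, hr⟩
    have h1 : 2 ≤ rootMultiplicity c P := by
      rw [le_rootMultiplicity_iff hP0, ← hq, hr]
      exact ⟨r, by ring⟩
    omega
  obtain ⟨u, v, huv⟩ := hcop
  have hAq : A * aeval A q = c • aeval A q := by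
    have h1 : aeval A ((X - C c) * q) = 0 := by rw [hq]; exact Matrix.aeval_self_charpoly A
    rw [map_mul, map_sub, aeval_X, aeval_C, sub_mul, sub_eq_zero] at h1
    rw [h1, Algebra.smul_def]
  have hAnq : ∀ n, A ^ n * aeval A q = c ^ n • aeval A q := by
    intro n
    induction n with
    | zero => simp
    | succ n ih => rw [pow_succ, mul_assoc, hAq, mul_smul_comm, ih, smul_smul, pow_succ, mul_comm]
  have hpow : Tendsto (fun n => (c ^ n)⁻¹ • A ^ n) atTop (𝓝 (aeval A (q * v))) := by
    have h1 := (hdecay.mul_const (aeval A u)).add_const (aeval A (q * v))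
    rw [zero_mul, zero_add] at h1
    refine h1.congr fun n => ?_
    have h2 : A ^ n = A ^ n * (A - algebraMap K _ c) * aeval A u + c ^ n • aeval A (q * v) := by
      rw [map_mul, ← smul_mul_assoc, ← hAnq, mul_assoc, mul_assoc, ← mul_add]
      have h3 := congrArg (aeval A) huv
      rw [mul_comm u, mul_comm v, map_add, map_mul, map_mul, map_sub, aeval_X, aeval_C,
        map_one] at h3
      rw [h3, mul_one]
    rw [smul_mul_assoc]
    conv_rhs => rw [h2]
    rw [smul_add, smul_smul, inv_mul_cancel₀ (pow_ne_zero n hc), one_smul]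
  let Ψ : Matrix (Fin d) (Fin d) K →ₗ[K] (𝔼 →L[K] 𝔼) :=
    LinearMap.toContinuousLinearMap.toLinearMap ∘ₗ (Matrix.toEuclideanLin).toLinearMap
  have hΨ : Continuous Ψ := LinearMap.continuous_of_finiteDimensional Ψ
  refine ⟨c, Ψ (aeval A (q * v)), hc, by rw [← hz, norm_toComplex], heig,
    ((hΨ.tendsto _).comp hpow).congr fun n => ?_⟩
  rw [Function.comp, map_smul]
  rfl

/-- The powers of a proximal element converge projectively to the projection onto its attracting
line along its repelling hyperplane. -/
theorem exists_rankOneLimit_pow (hd : 2 ≤ d) {g : SL} (hg : IsProximal 1 g) :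
    ∃ p q : Line K d, p.1 = attractingLine g ∧ q.1ᗮ = repellingHyperplane g ∧ ¬ p.Perp q ∧
      RankOneLimit (fun n => g ^ n) p q := by
  obtain ⟨c, T, hc, hcn, heig, hT⟩ := exists_tendsto_pow hd hg
  have hTv : ∀ v, Tendsto (fun n => (c ^ n)⁻¹ • cl K d (g ^ n) v) atTop (𝓝 (T v)) := fun v =>
    tendsto_clm_apply hT tendsto_const_nhds
  have hgT : ∀ v, toLin g (T v) = c • T v := by
    intro v
    have h1 := ((cl K d g).continuous.tendsto _).comp (hTv v)
    have h2 := (((hTv v).comp (tendsto_add_atTop_nat 1)).const_smul c)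
    refine tendsto_nhds_unique h1 (h2.congr fun n => ?_)
    simp only [Function.comp]
    rw [smul_smul, map_smul, pow_succ', pow_succ', map_mul, mul_inv_rev, mul_comm c, mul_assoc,
      inv_mul_cancel₀ hc, mul_one]
    rfl
  have hpow : ∀ {b : K} {v : 𝔼}, toLin g v = b • v → ∀ n, cl K d (g ^ n) v = b ^ n • v := by
    intro b v hv n
    induction n with
    | zero => simp
    | succ n ih =>
      rw [pow_succ', map_mul]
      change cl K d g (cl K d (g ^ n) v) = _
      rw [ih, map_smul, cl_apply, hv, smul_smul, pow_succ]
  have hTfix : ∀ v, toLin g v = c • v → T v = v := by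
    intro v hv
    refine tendsto_nhds_unique (hTv v) (tendsto_const_nhds.congr fun n => ?_)
    rw [hpow hv, smul_smul, inv_mul_cancel₀ (pow_ne_zero n hc), one_smul]
  have hTT : ∀ v, T (T v) = T v := fun v => hTfix _ (hgT v)
  -- no other scalar of the same absolute value is an eigenvalue
  have hother : ∀ b v, ‖b‖ = ‖c‖ → toLin g v = b • v → b ≠ c → v = 0 := by
    intro b v hb hv hbc
    have h0 : T v = 0 := by
      have h1 : toLin g (T v) = b • T v := by
        have h2 := ((cl K d g).continuous.tendsto _).comp (hTv v)
        refine tendsto_nhds_unique h2 (((hTv v).const_smul b).congr fun n => ?_)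
        simp only [Function.comp]
        rw [hpow hv, map_smul, map_smul, cl_apply, hv, smul_comm b, smul_comm b]
      rw [hgT, ← sub_eq_zero, ← sub_smul, smul_eq_zero] at h1
      exact h1.resolve_left (sub_ne_zero.2 hbc.symm)
    have h3 := (hTv v).norm
    rw [h0, norm_zero] at h3
    have h4 : Tendsto (fun _ : ℕ => ‖v‖) atTop (𝓝 0) := by
      refine h3.congr fun n => ?_
      rw [hpow hv, smul_smul, norm_smul, norm_mul, norm_inv, norm_pow, norm_pow, hb,
        inv_mul_cancel₀ (pow_ne_zero n (norm_ne_zero_iff.2 hc)), one_mul]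
    exact norm_eq_zero.1 (tendsto_nhds_unique tendsto_const_nhds h4)
  have hline : attractingLine g = Module.End.eigenspace (toLin g) c := by
    rw [attractingLine, ← hcn]
    apply le_antisymm
    · refine iSup₂_le fun b hb v hv => ?_
      rw [Module.End.mem_eigenspace_iff] at hv
      by_cases hbc : b = c
      · rw [← hbc]; exact Module.End.mem_eigenspace_iff.2 hv
      · rw [hother b v hb hv hbc]; exact Submodule.zero_mem _
    · exact le_iSup₂_of_le c rfl le_rfl
  have hmem : ∀ v, v ∈ attractingLine g ↔ T v = v := by
    intro v
    rw [hline, Module.End.mem_eigenspace_iff]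
    exact ⟨hTfix v, fun h => by rw [← h]; exact hgT v⟩
  have hcompl : IsCompl (attractingLine g) (LinearMap.ker T.toLinearMap) := by
    rw [isCompl_iff, Submodule.disjoint_def, codisjoint_iff, Submodule.eq_top_iff']
    refine ⟨fun v hv hv' => ((hmem v).1 hv).symm.trans hv', fun v => ?_⟩
    rw [← add_sub_cancel (T v) v]
    refine Submodule.add_mem_sup ((hmem _).2 (hTT v)) ?_
    rw [LinearMap.mem_ker]
    change T (v - T v) = 0
    rw [map_sub, hTT, sub_self]
  have hset : {H : Subspaces K d | act g H ≤ H ∧ IsCompl (attractingLine g) H} =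
      {LinearMap.ker T.toLinearMap} := by
    ext H
    simp only [Set.mem_ofPred_eq, Set.mem_singleton_iff]
    constructor
    · rintro ⟨hH, hcH⟩
      have hHn : ∀ n, ∀ v ∈ H, cl K d (g ^ n) v ∈ H := by
        intro n v hv
        induction n with
        | zero => simpa using hv
        | succ n ih =>
          rw [pow_succ', map_mul]
          exact hH (Submodule.mem_map_of_mem ih)
      have hle : H ≤ LinearMap.ker T.toLinearMap := by
        intro v hv
        have h1 : T v ∈ H := (Submodule.closed_of_finiteDimensional H).mem_of_tendsto (hTv v)
          (Eventually.of_forall fun n => H.smul_mem _ (hHn n v hv))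
        exact (Submodule.disjoint_def.1 hcH.disjoint) _ ((hmem _).2 (hTT v)) h1
      exact eq_of_le_of_inf_le_of_sup_le hle
        (by rw [inf_comm, hcompl.inf_eq_bot]; exact bot_le)
        (by rw [sup_comm H, hcH.sup_eq_top]; exact le_top)
    · rintro rfl
      refine ⟨?_, hcompl⟩
      rintro _ ⟨v, hv, rfl⟩
      have hv' : T v = 0 := hv
      refine tendsto_nhds_unique (hTv (toLin g v)) ?_
      have h1 := ((cl K d g).continuous.tendsto _).comp (hTv v)
      rw [hv', map_zero] at h1
      refine h1.congr fun n => ?_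
      simp only [Function.comp]
      rw [map_smul, ← cl_apply, ← mul_apply_eq_comp, ← map_mul, ← mul_apply_eq_comp,
        ← map_mul, (Commute.refl g).pow_right n |>.eq]
  have hhyp : repellingHyperplane g = LinearMap.ker T.toLinearMap := by
    rw [repellingHyperplane, hset, sSup_singleton]
  have hfin : Module.finrank K (LinearMap.ker T.toLinearMap) = d - 1 := by
    have h1 := Submodule.finrank_add_eq_of_isCompl hcompl
    rw [hline, heig, finrank_euclideanSpace_fin] at h1
    omega
  have hq : Module.finrank K ((LinearMap.ker T.toLinearMap)ᗮ : Subspaces K d) = 1 := by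
    have h1 := (LinearMap.ker T.toLinearMap).finrank_add_finrank_orthogonal
    rw [hfin, finrank_euclideanSpace_fin] at h1
    omega
  refine ⟨⟨attractingLine g, by rw [hline, heig]⟩, ⟨_, hq⟩, rfl, ?_, ?_, ?_⟩
  · rw [hhyp, Submodule.orthogonal_orthogonal]
  · refine Line.isCompl_orthogonal_iff.1 ?_
    change IsCompl (attractingLine g) (LinearMap.ker T.toLinearMap)ᗮᗮ
    rwa [Submodule.orthogonal_orthogonal]
  · refine ⟨fun n => (c ^ n)⁻¹, T, hT, ?_, fun v => (hmem _).2 (hTT v), fun v => ?_⟩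
    · rintro rfl
      have h1 : attractingLine g = ⊥ := by
        rw [eq_bot_iff]
        intro v hv
        exact ((hmem v).1 hv).symm
      rw [hline] at h1
      rw [h1, finrank_bot] at heig
      exact zero_ne_one heig
    · change T v = 0 ↔ v ∈ (LinearMap.ker T.toLinearMap)ᗮᗮ
      rw [Submodule.orthogonal_orthogonal]
      rfl

/-- The dynamics of the powers of a biproximal element on pairs of lines. -/
theorem IsBiproximal.exists_dyn (hd : 2 ≤ d) {γ : SL} (hγ : IsBiproximal 1 γ) :
    ∃ F₁ F₂ : FlagPair K d, IsPairOf F₁ (attractingFlag γ) ∧ IsPairOf F₂ (attractingFlag γ⁻¹) ∧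
      F₁.Opp F₂ ∧ Dyn (fun n => γ ^ n) F₁ F₂ := by
  obtain ⟨p, q, hp, hq, hpq, h⟩ := exists_rankOneLimit_pow hd hγ.1
  obtain ⟨p', q', hp', hq', hpq', h'⟩ := exists_rankOneLimit_pow hd hγ.2
  refine ⟨FlagPair.mk p q', FlagPair.mk p' q, ⟨hp, hq'⟩, ⟨hp', ?_⟩, ⟨hpq, hpq'⟩, h, ?_⟩
  · rw [attractingFlag, inv_inv]; exact hq
  · simp only [inv_pow] at h'
    exact h'

/-- A biproximal element fixes its attracting flag. -/
theorem Dyn.smul_eq {γ : SL} {x y : FlagPair K d} (h : Dyn (fun n => γ ^ n) x y)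
    (hxy : x.Opp y) : γ • x = x := by
  have h1 := h.tendsto (tendsto_const_nhds (x := x)) hxy
  refine tendsto_nhds_unique ((h1.const_smul γ).congr fun n => ?_)
    (h1.comp (tendsto_add_atTop_nat 1))
  rw [Function.comp, pow_succ', mul_smul]

end Proximal
end RelAnosov

namespace RelAnosov

/-! ### Finitely generated linear groups are residually finite -/

section ResiduallyFinite

theorem isJacobsonRing_int : IsJacobsonRing ℤ := by
  rw [isJacobsonRing_iff_prime_eq]
  intro P hP
  rcases eq_or_ne P ⊥ with rfl | h0
  · rw [eq_bot_iff]
    intro x hx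
    rw [Ideal.mem_bot]
    by_contra hx0
    -- a prime number that is larger than `|x|` does not divide `x`
    obtain ⟨p, hpx, hp⟩ := Nat.exists_infinite_primes (x.natAbs + 1)
    have hprime : Prime (p : ℤ) := Nat.prime_iff_prime_int.1 hp
    have hmax : (Ideal.span {(p : ℤ)}).IsMaximal :=
      PrincipalIdealRing.isMaximal_of_irreducible hprime.irreducible
    have h1 : x ∈ Ideal.span {(p : ℤ)} :=
      Ideal.mem_sInf.1 hx ⟨bot_le, hmax⟩
    rw [Ideal.mem_span_singleton] at h1
    have h2 := Nat.le_of_dvd (Int.natAbs_pos.2 hx0) (Int.natCast_dvd.1 h1)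
    omega
  · have := hP.isMaximal h0
    exact Ideal.jacobson_eq_self_of_isMaximal

/-- A field that is finitely generated as a ring is finite. -/
theorem finite_of_field_of_finiteType (F : Type*) [Field F] [Algebra.FiniteType ℤ F] :
    Finite F := by
  have := isJacobsonRing_int
  have hfin : Module.Finite ℤ F := finite_of_finite_type_of_isJacobsonRing ℤ F
  have hnot : ¬ Function.Injective (algebraMap ℤ F) := by
    intro hinj
    have := isField_of_isIntegral_of_isField hinj (Field.toIsField F)
    exact Int.not_isField this
  obtain ⟨p, hp⟩ := CharP.exists F
  have hp0 : p ≠ 0 := by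
    rintro rfl
    have := CharP.charP_to_charZero F
    exact hnot (algebraMap ℤ F).injective_int
  have : NeZero p := ⟨hp0⟩
  let _ : Algebra (ZMod p) F := ZMod.algebra F p
  have : Module.Finite (ZMod p) F := Module.Finite.of_restrictScalars_finite ℤ (ZMod p) F
  exact Module.finite_of_finite (ZMod p)

/-- Elements of finitely generated domains can be separated from zero in finite fields. -/
theorem exists_maximal_notMem {R : Type*} [CommRing R] [IsDomain R] [Algebra.FiniteType ℤ R]
    {x : R} (hx : x ≠ 0) : ∃ m : Ideal R, Finite (R ⧸ m) ∧ x ∉ m := by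
  have := isJacobsonRing_int
  have hR : IsJacobsonRing R := isJacobsonRing_of_finiteType (A := ℤ)
  have h1 : x ∉ (⊥ : Ideal R).jacobson := by
    rw [IsJacobsonRing.out hR (Ideal.isPrime_bot (α := R)).isRadical]
    exact hx
  rw [Ideal.jacobson, Ideal.mem_sInf] at h1
  push Not at h1
  obtain ⟨m, ⟨-, hm⟩, hxm⟩ := h1
  have h : Algebra.FiniteType ℤ (R ⧸ m) :=
    .of_surjective (Ideal.Quotient.mkₐ ℤ m) (Ideal.Quotient.mkₐ_surjective ℤ m)
  exact ⟨m, @finite_of_field_of_finiteType (R ⧸ m) (Ideal.Quotient.field m) (by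
    convert h <;> rfl), hxm⟩

theorem residuallyFinite_specialLinear {R : Type*} [CommRing R] [IsDomain R]
    [Algebra.FiniteType ℤ R] (ι : Type*) [Fintype ι] [DecidableEq ι] :
    Group.ResiduallyFinite (Matrix.SpecialLinearGroup ι R) := by
  rw [Group.residuallyFinite_iff_exists_finiteIndex]
  intro g hg
  obtain ⟨i, j, hij⟩ : ∃ i j, (g : Matrix ι ι R) i j - (1 : Matrix ι ι R) i j ≠ 0 := by
    by_contra! hcon
    exact hg (Subtype.ext (Matrix.ext fun i j => sub_eq_zero.1 (hcon i j)))
  obtain ⟨m, hm, hx⟩ := exists_maximal_notMem hij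
  let f : Matrix.SpecialLinearGroup ι R →* Matrix.SpecialLinearGroup ι (R ⧸ m) :=
    Matrix.SpecialLinearGroup.map (Ideal.Quotient.mk m)
  have : Finite (Matrix.SpecialLinearGroup ι (R ⧸ m)) := Subtype.finite
  refine ⟨f.ker, Subgroup.finiteIndex_ker f, fun h => hx ?_⟩
  have h1 : f g = 1 := h
  have h2 : Ideal.Quotient.mk m ((g : Matrix ι ι R) i j) = (1 : Matrix ι ι (R ⧸ m)) i j :=
    congrArg (fun A : Matrix.SpecialLinearGroup ι (R ⧸ m) => A.1 i j) h1
  rw [← Ideal.Quotient.eq_zero_iff_mem, map_sub, h2, sub_eq_zero, Matrix.one_apply,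
    Matrix.one_apply]
  split_ifs <;> simp

/-- Malcev's theorem: finitely generated linear groups are residually finite. -/
theorem residuallyFinite_of_fg {F : Type*} [Field F] {ι : Type*} [Fintype ι] [DecidableEq ι]
    (U : Subgroup (Matrix.SpecialLinearGroup ι F)) (hU : Group.FG U) :
    Group.ResiduallyFinite U := by
  rw [Group.fg_iff_subgroup_fg] at hU
  obtain ⟨S, hS⟩ := hU
  let E : Set F := ⋃ g ∈ S, Set.range fun p : ι × ι => (g : Matrix ι ι F) p.1 p.2
  have hE : E.Finite := S.finite_toSet.biUnion fun g _ => Set.finite_range _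
  let R : Subalgebra ℤ F := Algebra.adjoin ℤ E
  have : Algebra.FiniteType ℤ R :=
    (Subalgebra.fg_iff_finiteType R).1 ⟨hE.toFinset, by rw [hE.coe_toFinset]⟩
  let f : Matrix.SpecialLinearGroup ι R →* Matrix.SpecialLinearGroup ι F :=
    Matrix.SpecialLinearGroup.map R.val.toRingHom
  have hf : Function.Injective f := by
    intro a b hab
    refine Subtype.ext (Matrix.ext fun i j => Subtype.ext ?_)
    exact congrFun (congrFun (congrArg Subtype.val hab) i) j
  have hle : U ≤ f.range := by
    rw [← hS, Subgroup.closure_le]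
    intro g hg
    have hmem : ∀ i j, (g : Matrix ι ι F) i j ∈ R := fun i j =>
      Algebra.subset_adjoin (Set.mem_biUnion hg ⟨(i, j), rfl⟩)
    let A : Matrix ι ι R := fun i j => ⟨(g : Matrix ι ι F) i j, hmem i j⟩
    have hA : R.val.toRingHom.mapMatrix A = (g : Matrix ι ι F) := rfl
    refine ⟨⟨A, Subtype.val_injective ?_⟩, Subtype.ext hA⟩
    have h1 := RingHom.map_det R.val.toRingHom A
    rw [hA, g.2] at h1
    exact h1
  have hRF := residuallyFinite_specialLinear (R := R) ι
  let φ : U →* Matrix.SpecialLinearGroup ι R :=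
    (MonoidHom.ofInjective hf).symm.toMonoidHom.comp (Subgroup.inclusion hle)
  have hφ : Function.Injective φ :=
    (MonoidHom.ofInjective hf).symm.injective.comp (Subgroup.inclusion_injective hle)
  rw [Group.residuallyFinite_iff_exists_finiteIndex] at hRF ⊢
  intro g hg
  obtain ⟨H, hH, hgH⟩ := hRF (φ g) (fun h => hg (hφ (by rw [h, map_one])))
  refine ⟨H.comap φ, ⟨?_⟩, hgH⟩
  rw [Subgroup.index_comap]
  exact (inferInstance : (H.subgroupOf φ.range).FiniteIndex).index_ne_zero

/-- A residually finite group has finite-index subgroups that avoid any finite set of nontrivial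
elements. -/
theorem exists_finiteIndex_disjoint {G : Type*} [Group G] [hG : Group.ResiduallyFinite G]
    {S : Set G} (hS : S.Finite) : ∃ H : Subgroup G, H.FiniteIndex ∧ ∀ g ∈ H, g ∈ S → g = 1 := by
  rw [Group.residuallyFinite_iff_exists_finiteIndex] at hG
  have h1 : ∀ g : G, ∃ H : Subgroup G, H.FiniteIndex ∧ (g ∈ H → g = 1) := by
    intro g
    by_cases hg : g = 1
    · exact ⟨⊤, inferInstance, fun _ => hg⟩
    · obtain ⟨H, hH, hgH⟩ := hG g hg
      exact ⟨H, hH, fun h => absurd h hgH⟩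
  choose H hH hH' using h1
  have := hS.to_subtype
  refine ⟨⨅ s : S, H s, Subgroup.finiteIndex_iInf fun s => hH s, fun g hg hgS => ?_⟩
  exact hH' g (Subgroup.mem_iInf.1 hg ⟨g, hgS⟩)

end ResiduallyFinite

end RelAnosov

namespace RelAnosov

/-! ### Free products and models of the limit set -/

section FreeProduct

variable {G G' X : Type*} [Group G] [Group G'] {H : Bool → Subgroup G} {H' : Bool → Subgroup G'}

lemma Red.map {f : G' →* G} (hf : ∀ b, ∀ h ∈ H' b, f h ∈ H b)
    (hf1 : ∀ b, ∀ h ∈ H' b, h ≠ 1 → f h ≠ 1) {b e : Bool} {l : List G'} (hl : Red H' b e l) :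
    Red H b e (l.map f) := by
  induction hl with
  | single hb h1 => exact .single (hf _ _ hb) (hf1 _ _ hb h1)
  | cons hb h1 _ ih => exact .cons (hf _ _ hb) (hf1 _ _ hb h1) ih

lemma gen_eq_sup : gen H = H true ⊔ H false := by
  apply le_antisymm
  · rw [gen, Subgroup.closure_le]
    rintro g ⟨b, hb⟩
    cases b with
    | false => exact Subgroup.mem_sup_right hb
    | true => exact Subgroup.mem_sup_left hb
  · exact sup_le (fun g hg => mem_gen hg) (fun g hg => mem_gen hg)

/-- A group generated by two subgroups is their free product when nonempty reduced words in the
subgroups are nontrivial. -/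
theorem exists_coprod_mulEquiv (h : ∀ b e l, Red H b e l → l.prod ≠ 1) :
    ∃ Φ : Monoid.Coprod (H true) (H false) ≃* gen H,
      (∀ a, (Φ (Monoid.Coprod.inl a) : G) = a) ∧ ∀ u, (Φ (Monoid.Coprod.inr u) : G) = u := by
  let f : Monoid.Coprod (H true) (H false) →* G :=
    Monoid.Coprod.lift (H true).subtype (H false).subtype
  have hl : ∀ a, f (Monoid.Coprod.inl a) = a := fun a => Monoid.Coprod.lift_apply_inl _ _ _
  have hr : ∀ a, f (Monoid.Coprod.inr a) = a := fun a => Monoid.Coprod.lift_apply_inr _ _ _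
  let C : Bool → Subgroup (Monoid.Coprod (H true) (H false)) := fun b =>
    bif b then (Monoid.Coprod.inl : H true →* _).range else (Monoid.Coprod.inr : H false →* _).range
  have hC : gen C = ⊤ := by
    rw [gen_eq_sup]
    exact Monoid.Coprod.range_inl_sup_range_inr
  have hinj : Function.Injective f := by
    rw [injective_iff_map_eq_one]
    intro w hw
    rcases isReduced_of_mem (hC.ge (Subgroup.mem_top w)) with h1 | ⟨b, e, l, hlw, rfl⟩
    · exact h1
    · exfalso
      rw [map_list_prod] at hw
      refine h b e (l.map f) (hlw.map ?_ ?_) hw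
      · rintro (_ | _) _ ⟨a, rfl⟩
        · rw [hr]; exact a.2
        · rw [hl]; exact a.2
      · rintro (_ | _) _ ⟨a, rfl⟩ ha
        · rw [hr]
          rintro h1
          exact ha (by rw [Subtype.ext (a1 := a) (a2 := 1) h1, map_one])
        · rw [hl]
          rintro h1
          exact ha (by rw [Subtype.ext (a1 := a) (a2 := 1) h1, map_one])
  have hrange : f.range = gen H := by
    rw [Monoid.Coprod.range_lift, Subgroup.range_subtype, Subgroup.range_subtype, gen_eq_sup]
  refine ⟨(MonoidHom.ofInjective hinj).trans (MulEquiv.subgroupCongr hrange), fun a => ?_,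
    fun a => ?_⟩
  · exact hl a
  · exact hr a

/-- The limit set has a model in the lowest universe when the ambient space does. -/
theorem exists_limitModel [MetricSpace X] [Small.{0} X] [MulAction G X] [ContinuousConstSMul G X]
    (L : Bool → Set X) : ∃ (M : Type) (_ : TopologicalSpace M) (_ : MulAction (gen H) M)
      (ι : M → X), LimitModel H L ι := by
  let Λ : Type _ := pingPongLimit H L
  let _ : MulAction (gen H) Λ :=
    { smul := fun g z => ⟨(g : G) • z.1, PingPong.smul_mem_limitSet g.2 z.2⟩
      one_smul := fun z => Subtype.ext (one_smul G z.1)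
      mul_smul := fun g h z => Subtype.ext (mul_smul (g : G) (h : G) z.1) }
  let e : Shrink.{0} Λ ≃ Λ := (equivShrink Λ).symm
  let _ : MulAction (gen H) (Shrink.{0} Λ) := e.mulAction (gen H)
  let ι : Shrink.{0} Λ → X := fun m => (e m).1
  let _ : TopologicalSpace (Shrink.{0} Λ) := TopologicalSpace.induced ι inferInstance
  refine ⟨Shrink.{0} Λ, inferInstance, inferInstance, ι, ⟨⟨rfl⟩, ?_⟩, ?_, ?_⟩
  · exact Subtype.val_injective.comp e.injective
  · rw [show ι = Subtype.val ∘ e from rfl, Set.range_comp, e.range_eq_univ, Set.image_univ,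
      Subtype.range_coe]
  · intro g m
    change (e (e.symm (g • e m))).1 = _
    rw [e.apply_symm_apply]
    rfl

end FreeProduct

end RelAnosov

namespace RelAnosov

/-! ### Ping-pong of a proximal element and a divergent group with a single limit flag -/

section Schottky

variable {K : Type*} [RCLike K] {d : ℕ}

local notation "SL" => Matrix.SpecialLinearGroup (Fin d) K

/-- The element `g` maps `D` into `W` and contracts it by the factor `δ`. -/
def Squeezes (g : Matrix.SpecialLinearGroup (Fin d) K) (D W : Set (FlagPair K d)) (δ : ℝ) : Prop :=
  (∀ z ∈ D, g • z ∈ W) ∧ ∀ z ∈ D, ∀ w ∈ D, dist (g • z) (g • w) ≤ δ * dist z w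

lemma Dyn.eventually_squeezes {g : ℕ → SL} {x y : FlagPair K d} (h : Dyn g x y)
    {D W : Set (FlagPair K d)} (hD : IsClosed D) (hDy : ∀ z ∈ D, z.Opp y) (hW : W ∈ 𝓝 x) {δ : ℝ}
    (hδ : 0 < δ) : ∀ᶠ n in atTop, Squeezes (g n) D W δ :=
  (h.eventually_mapsTo hD.isCompact hDy hW).and (h.eventually_dist_le hD.isCompact hDy hδ)

lemma finite_not_squeezes {U : Subgroup SL} {F : FlagPair K d}
    (hU : ∀ u : ℕ → U, Escaping u → ∃ φ : ℕ → ℕ, StrictMono φ ∧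
      Dyn (fun n => (u (φ n) : SL)) F F)
    {D W : Set (FlagPair K d)} (hD : IsClosed D) (hDF : ∀ z ∈ D, z.Opp F) (hW : W ∈ 𝓝 F) {δ : ℝ}
    (hδ : 0 < δ) : {u : U | ¬ Squeezes (u : SL) D W δ}.Finite := by
  by_contra hcon
  let u := (show Set.Infinite _ from hcon).natEmbedding
  have hu : Escaping fun n => (u n : U) := by
    rw [Escaping, ← Nat.cofinite_eq_atTop]
    exact (Subtype.val_injective.comp u.injective).tendsto_cofinite
  obtain ⟨φ, -, h⟩ := hU _ hu
  obtain ⟨n, hn⟩ := (h.eventually_squeezes hD hDF hW hδ).exists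
  exact (u (φ n)).2 hn

lemma exists_forall_squeezes {γ : SL} {F₁ F₂ : FlagPair K d} (hγ : Dyn (fun n => γ ^ n) F₁ F₂)
    {D W : Set (FlagPair K d)} (hD : IsClosed D) (hD₁ : ∀ z ∈ D, z.Opp F₁)
    (hD₂ : ∀ z ∈ D, z.Opp F₂) (hW₁ : W ∈ 𝓝 F₁) (hW₂ : W ∈ 𝓝 F₂) {δ : ℝ} (hδ : 0 < δ) :
    ∃ n : ℕ, ∀ k : ℤ, n ≤ k.natAbs → Squeezes (γ ^ k) D W δ := by
  obtain ⟨n, hn⟩ := eventually_atTop.1 ((hγ.eventually_squeezes hD hD₂ hW₁ hδ).and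
    (hγ.symm.eventually_squeezes hD hD₁ hW₂ hδ))
  refine ⟨n, fun k hk => ?_⟩
  rcases Int.natAbs_eq k with h | h
  · rw [h, zpow_natCast]; exact (hn _ hk).1
  · rw [h, zpow_neg, zpow_natCast]; exact (hn _ hk).2

/-- The two factors of the free product, the parabolic one being `H false`. -/
def factors (γ : Matrix.SpecialLinearGroup (Fin d) K)
    (U : Subgroup (Matrix.SpecialLinearGroup (Fin d) K)) (b : Bool) :
    Subgroup (Matrix.SpecialLinearGroup (Fin d) K) :=
  bif b then Subgroup.zpowers γ else U

/-- The ping-pong sets: balls around the poles of the proximal element, and around the limit flag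
of the parabolic group. -/
def balls (F F₁ F₂ : FlagPair K d) (η : ℝ) (b : Bool) : Set (FlagPair K d) :=
  bif b then Metric.closedBall F₁ η ∪ Metric.closedBall F₂ η else Metric.closedBall F η

/-- The limit points of the two factors. -/
def poles (F F₁ F₂ : FlagPair K d) (b : Bool) : Set (FlagPair K d) :=
  bif b then {F₁, F₂} else {F}

lemma ne_of_opp {z w : FlagPair K d} (h : z.Opp w) (hz : z.1.Perp z.2) : z ≠ w := by
  rintro rfl
  exact h.1 hz

lemma exists_radius {F F₁ F₂ : FlagPair K d} (hF : F.1.Perp F.2) (h1 : F.Opp F₁) (h2 : F.Opp F₂) :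
    ∃ η > 0, (∀ b, ∀ z ∈ balls F F₁ F₂ η b, ∀ w ∈ balls F F₁ F₂ η !b, z.Opp w) ∧
      ∀ b, Disjoint (balls F F₁ F₂ η b) (balls F F₁ F₂ η !b) := by
  have key : ∀ F', F.Opp F' → ∃ ε > 0, ∀ η ≤ ε,
      (∀ z ∈ Metric.closedBall F η, ∀ w ∈ Metric.closedBall F' η, z.Opp w) ∧
      Disjoint (Metric.closedBall F η) (Metric.closedBall F' η) := by
    intro F' h
    obtain ⟨ε, hε, hs⟩ := Metric.nhds_basis_closedBall.mem_iff.1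
      (FlagPair.isOpen_opp.mem_nhds (show (F, F') ∈ {z : FlagPair K d × FlagPair K d | _} from h))
    have hd := dist_pos.2 (ne_of_opp h hF)
    refine ⟨min ε (dist F F' / 3), lt_min hε (by positivity), fun η hη => ⟨?_, ?_⟩⟩
    · intro z hz w hw
      have : (z, w) ∈ Metric.closedBall (F, F') ε := by
        rw [← closedBall_prod_same]
        have hηε := hη.trans (min_le_left _ _)
        exact ⟨Metric.closedBall_subset_closedBall hηε hz,
          Metric.closedBall_subset_closedBall hηε hw⟩
      exact hs this
    · refine Metric.closedBall_disjoint_closedBall ?_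
      have := hη.trans (min_le_right _ _)
      linarith
  obtain ⟨ε₁, hε₁, k1⟩ := key F₁ h1
  obtain ⟨ε₂, hε₂, k2⟩ := key F₂ h2
  obtain ⟨o1, d1⟩ := k1 _ (min_le_left ε₁ ε₂)
  obtain ⟨o2, d2⟩ := k2 _ (min_le_right ε₁ ε₂)
  have ho : ∀ z ∈ balls F F₁ F₂ (min ε₁ ε₂) false, ∀ w ∈ balls F F₁ F₂ (min ε₁ ε₂) true,
      z.Opp w := by
    rintro z hz w (hw | hw)
    · exact o1 z hz w hw
    · exact o2 z hz w hw
  have hdis : Disjoint (balls F F₁ F₂ (min ε₁ ε₂) false) (balls F F₁ F₂ (min ε₁ ε₂) true) :=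
    Set.disjoint_union_right.2 ⟨d1, d2⟩
  refine ⟨min ε₁ ε₂, lt_min hε₁ hε₂, ?_, ?_⟩
  · rintro (_ | _) z hz w hw
    · exact ho z hz w hw
    · exact (ho w hw z hz).symm
  · rintro (_ | _)
    · exact hdis
    · exact hdis.symm

/-- High powers of a proximal element and a divergent group with a single limit flag play
ping-pong, when the nontrivial elements of the group that do not squeeze the neighbourhood of the
poles are left out. -/
theorem pingPong_factors {γ : SL} {U U' : Subgroup SL} {F F₁ F₂ : FlagPair K d} {η : ℝ} {N n₀ : ℕ}
    (hγ : Dyn (fun n => γ ^ n) F₁ F₂) (h₁₂ : F₁ ≠ F₂) (hγ₁ : γ • F₁ = F₁) (hγ₂ : γ • F₂ = F₂)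
    (hU : ∀ u : ℕ → U, Escaping u → ∃ φ : ℕ → ℕ, StrictMono φ ∧
      Dyn (fun n => (u (φ n) : SL)) F F) (hUF : ∀ u ∈ U, u • F = F) (hη : 0 < η)
    (hopp : ∀ b, ∀ z ∈ balls F F₁ F₂ η b, ∀ w ∈ balls F F₁ F₂ η !b, z.Opp w)
    (hdis : ∀ b, Disjoint (balls F F₁ F₂ η b) (balls F F₁ F₂ η !b))
    (hn₀ : ∀ k : ℤ, n₀ ≤ k.natAbs →
      Squeezes (γ ^ k) (balls F F₁ F₂ η false) (balls F F₁ F₂ η true) (1 / 2)) (hN : n₀ ≤ N)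
    (hU' : U' ≤ U) [Infinite U'] (hsq : ∀ u ∈ U', u ≠ 1 →
      Squeezes u (balls F F₁ F₂ η true) (balls F F₁ F₂ η false) (1 / 2)) :
    PingPong (factors (γ ^ N) U') (balls F F₁ F₂ η) (poles F F₁ F₂) := by
  have hF : F ∈ balls F F₁ F₂ η false := Metric.mem_closedBall_self hη.le
  have hF₁ : F₁ ∈ balls F F₁ F₂ η true := Or.inl (Metric.mem_closedBall_self hη.le)
  have hF₂ : F₂ ∈ balls F F₁ F₂ η true := Or.inr (Metric.mem_closedBall_self hη.le)
  have hne₁ : F₁ ≠ F := fun h => Set.disjoint_left.1 (hdis false) hF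
    (h.subst (motive := fun x => x ∈ balls F F₁ F₂ η true) hF₁)
  have hclosed : ∀ b, IsClosed (balls F F₁ F₂ η b) := by
    rintro (_ | _)
    · exact Metric.isClosed_closedBall
    · exact Metric.isClosed_closedBall.union Metric.isClosed_closedBall
  have hletter : ∀ b, ∀ h ∈ factors (γ ^ N) U' b, h ≠ 1 →
      Squeezes h (balls F F₁ F₂ η !b) (balls F F₁ F₂ η b) (1 / 2) := by
    rintro (_ | _) h hh h1
    · exact hsq h hh h1
    · obtain ⟨j, rfl⟩ := Subgroup.mem_zpowers_iff.1 hh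
      rw [← zpow_natCast, ← zpow_mul]
      refine hn₀ _ ?_
      have hj : j ≠ 0 := by rintro rfl; exact h1 (zpow_zero _)
      rw [Int.natAbs_mul, Int.natAbs_natCast]
      exact hN.trans (Nat.le_mul_of_pos_right _ (Int.natAbs_pos.2 hj))
  have hfinite : ∀ b, ∀ W : Set (FlagPair K d), IsOpen W → poles F F₁ F₂ b ⊆ W → ∀ δ : ℝ, 0 < δ →
      {h | h ∈ factors (γ ^ N) U' b ∧ ¬ Squeezes h (balls F F₁ F₂ η !b) W δ}.Finite := by
    rintro (_ | _) W hW hLW δ hδ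
    · have h1 := finite_not_squeezes hU (hclosed true) (fun z hz => hopp true z hz F hF)
        (hW.mem_nhds (hLW rfl)) hδ
      refine (h1.image Subtype.val).subset ?_
      rintro h ⟨hh, hs⟩
      exact ⟨⟨h, hU' hh⟩, hs, rfl⟩
    · obtain ⟨n, hn⟩ := exists_forall_squeezes hγ (hclosed false)
        (fun z hz => hopp false z hz F₁ hF₁) (fun z hz => hopp false z hz F₂ hF₂)
        (hW.mem_nhds (hLW (Or.inl rfl))) (hW.mem_nhds (hLW (Or.inr rfl))) hδ
      refine ((Set.finite_Icc (-n : ℤ) n).image fun k : ℤ => γ ^ k).subset ?_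
      rintro h ⟨hh, hs⟩
      obtain ⟨j, rfl⟩ := Subgroup.mem_zpowers_iff.1 hh
      rw [← zpow_natCast, ← zpow_mul] at hs ⊢
      refine ⟨N * j, ?_, rfl⟩
      by_contra hcon
      refine hs (hn _ ?_)
      rw [Set.mem_Icc] at hcon
      omega
  refine
    { isClosed := hclosed
      disjoint := hdis
      nontrivial := ?_
      limit_subset := ?_
      limit_closed := ?_
      limit_nonempty := ?_
      smul_limit := ?_
      mapsTo := fun b h hh h1 => (hletter b h hh h1).1
      contract := fun b h hh h1 => (hletter b h hh h1).2
      finite_near := fun b W hW hLW => (hfinite b W hW hLW 1 one_pos).subset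
        fun h hh => ⟨hh.1, fun hs => hh.2 hs.1⟩
      finite_contract := fun b δ hδ => (hfinite b Set.univ isOpen_univ (Set.subset_univ _) δ
        hδ).subset fun h hh => ⟨hh.1, fun hs => hh.2 hs.2⟩ }
  · rintro (_ | _)
    · obtain ⟨u, hu, hu1'⟩ := U'.nontrivial_iff_exists_ne_one.1 inferInstance
      have huF₁ : u • F₁ ∈ balls F F₁ F₂ η false := (hsq u hu hu1').1 _ hF₁
      have hne : u • F₁ ≠ F := by
        intro h
        exact hne₁ (smul_left_cancel u (h.trans (hUF u (hU' hu)).symm))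
      exact ⟨_, huF₁, F, hF, hne⟩
    · exact ⟨F₁, hF₁, F₂, hF₂, h₁₂⟩
  · rintro (_ | _)
    · rintro _ rfl; exact hF
    · rintro _ (rfl | rfl)
      exacts [hF₁, hF₂]
  · rintro (_ | _)
    · exact isClosed_singleton
    · exact (Set.toFinite ({F₁, F₂} : Set (FlagPair K d))).isClosed
  · rintro (_ | _)
    · exact ⟨F, rfl⟩
    · exact ⟨F₁, Or.inl rfl⟩
  · rintro (_ | _) h hh z hz
    · rw [show z = F from hz]
      exact hUF h (hU' hh)
    · obtain ⟨j, rfl⟩ := Subgroup.mem_zpowers_iff.1 hh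
      have hfix : ∀ x : FlagPair K d, γ • x = x → (γ ^ N) ^ j • x = x := by
        intro x hx
        have h1 : γ ∈ MulAction.stabilizer SL x := hx
        exact zpow_mem (pow_mem h1 N) j
      rcases hz with rfl | rfl
      · exact Or.inl (hfix _ hγ₁)
      · exact Or.inr (hfix _ hγ₂)

end Schottky

end RelAnosov

namespace RelAnosov

/-! ### Convergence dynamics of ping-pong groups -/

section PingPongDynamics

variable {K : Type*} [RCLike K] {d : ℕ}

local notation "SL" => Matrix.SpecialLinearGroup (Fin d) K

variable {H : Bool → Subgroup (Matrix.SpecialLinearGroup (Fin d) K)}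
  {D L : Bool → Set (FlagPair K d)}

/-- Long reduced words contract, so that the limit of the images of a single point is the limit on
a whole ping-pong set. -/
lemma PingPong.tendsto_of_escaping (P : PingPong H D L) {g : ℕ → SL} (hg : Escaping g) {b e : Bool}
    (hred : ∀ n, ∃ l, Red H b e l ∧ l.prod = g n) {z₀ x : FlagPair K d} (hz₀ : z₀ ∈ D !e)
    (hx : Tendsto (fun n => g n • z₀) atTop (𝓝 x)) {z : FlagPair K d} (hz : z ∈ D !e) :
    Tendsto (fun n => g n • z) atTop (𝓝 x) := by
  have h1 : Tendsto (fun n => dist (g n • z) (g n • z₀)) atTop (𝓝 0) := by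
    rw [Metric.tendsto_atTop]
    intro ε hε
    have hpos : 0 < dist z z₀ + 1 := by positivity
    have hev := hg.eventually
      (P.finite_word (ε / (dist z z₀ + 1)) (div_pos hε hpos)).compl_mem_cofinite
    obtain ⟨n₀, hn₀⟩ := eventually_atTop.1 hev
    refine ⟨n₀, fun n hn => ?_⟩
    have h3 : dist (g n • z) (g n • z₀) ≤ ε / (dist z z₀ + 1) * dist z z₀ := by
      by_contra hcon
      obtain ⟨l, hl, hln⟩ := hred n
      exact hn₀ n hn ⟨b, e, l, hl, hln, fun h => hcon (h z hz z₀ hz₀)⟩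
    rw [dist_zero_right, Real.norm_of_nonneg dist_nonneg]
    refine h3.trans_lt ?_
    rw [div_mul_eq_mul_div, div_lt_iff₀ hpos]
    nlinarith
  exact (tendsto_iff_of_dist h1).2 hx

/-- Escaping sequences in a ping-pong group have subsequences with attracting and repelling
points in the limit set. -/
theorem PingPong.exists_dyn (P : PingPong H D L) {η : ℝ} (hη : 0 < η)
    (hball : ∀ b, ∃ z ∈ L b, Metric.closedBall z η ⊆ D b) {g : ℕ → SL}
    (hg : ∀ n, g n ∈ gen H) (hesc : Escaping g) :
    ∃ φ : ℕ → ℕ, StrictMono φ ∧ ∃ x ∈ pingPongLimit H L, ∃ y ∈ pingPongLimit H L,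
      Dyn (g ∘ φ) x y := by
  obtain ⟨b, e, hfr⟩ : ∃ b e, ∃ᶠ n in atTop, ∃ l, Red H b e l ∧ l.prod = g n := by
    by_contra hcon
    simp only [not_exists, not_frequently] at hcon
    have h1 : ∀ᶠ n in atTop, ∀ b e, ∀ l, ¬ (Red H b e l ∧ l.prod = g n) :=
      eventually_all.2 fun b => eventually_all.2 fun e => hcon b e
    have h2 : ∀ᶠ n in atTop, g n ≠ 1 := hesc.eventually (Set.finite_singleton 1).compl_mem_cofinite
    obtain ⟨n, hn, hn1⟩ := (h1.and h2).exists
    rcases isReduced_of_mem (hg n) with h | ⟨b, e, l, hl, hln⟩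
    · exact hn1 h
    · exact hn b e l ⟨hl, hln⟩
  obtain ⟨φ, hφ, hred⟩ := extraction_of_frequently_atTop hfr
  obtain ⟨z₀, hz₀, hz₀D⟩ := hball !e
  obtain ⟨w₀, hw₀, hw₀D⟩ := hball !b
  obtain ⟨⟨x, y⟩, -, ψ, hψ, hlim⟩ := (isCompact_univ (X := FlagPair K d × FlagPair K d)).tendsto_subseq
    (x := fun n => (g (φ n) • z₀, (g (φ n))⁻¹ • w₀)) (fun n => trivial)
  have hx : Tendsto (fun n => g (φ (ψ n)) • z₀) atTop (𝓝 x) :=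
    (continuous_fst.tendsto (x, y)).comp hlim
  have hy : Tendsto (fun n => (g (φ (ψ n)))⁻¹ • w₀) atTop (𝓝 y) :=
    (continuous_snd.tendsto (x, y)).comp hlim
  have hesc' : Escaping fun n => g (φ (ψ n)) :=
    hesc.comp_strictMono (hφ.comp hψ).tendsto_atTop
  have hzD := hz₀D (Metric.mem_closedBall_self hη.le)
  have hwD := hw₀D (Metric.mem_closedBall_self hη.le)
  obtain ⟨χ, hχ, hdyn⟩ := Dyn.exists_subseq (g := fun n => g (φ (ψ n))) hη
    (fun z hz => P.tendsto_of_escaping hesc' (fun n => hred (ψ n)) hzD hx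
      (hz₀D (Metric.mem_closedBall.2 hz.le)))
    (fun z hz => P.tendsto_of_escaping hesc'.inv (b := e) (e := b) (fun n => by
        obtain ⟨l, hl, hln⟩ := hred (ψ n)
        exact ⟨_, hl.inv, by rw [Red.prod_inv, hln]⟩) hwD hy
      (hw₀D (Metric.mem_closedBall.2 hz.le)))
  refine ⟨φ ∘ ψ ∘ χ, hφ.comp (hψ.comp hχ), x, ?_, y, ?_, hdyn⟩
  · exact isClosed_limitSet.mem_of_tendsto hx (Eventually.of_forall fun n =>
      smul_mem_limitSet (hg _) (limit_subset_limitSet _ hz₀))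
  · exact isClosed_limitSet.mem_of_tendsto hy (Eventually.of_forall fun n =>
      smul_mem_limitSet (inv_mem (hg _)) (limit_subset_limitSet _ hw₀))

variable {M : Type*} [TopologicalSpace M] [MulAction (gen H) M] {ι : M → FlagPair K d}

/-- Sequences with attracting and repelling points converge off the repelling point on the limit
set, when distinct points of the limit set are opposite. -/
lemma LimitModel.convergesOffPoint (hM : LimitModel H L ι)
    (hopp : ∀ z ∈ pingPongLimit H L, ∀ w ∈ pingPongLimit H L, z ≠ w → z.Opp w)
    {g : ℕ → gen H} {a b : M} (h : Dyn (fun n => (g n : SL)) (ι a) (ι b)) :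
    ConvergesOffPoint g a b := by
  intro C hC hb V hV
  obtain ⟨W, hW, hWV⟩ := mem_comap.1 (hM.isEmbedding.nhds_eq_comap a ▸ hV)
  have h1 := h.eventually_mapsTo (hC.image hM.isEmbedding.continuous) (by
    rintro _ ⟨z, hz, rfl⟩
    refine hopp _ (hM.mem z) _ (hM.mem b) fun he => hb ?_
    rwa [← hM.isEmbedding.injective he]) hW
  filter_upwards [h1] with n hn z hz
  refine hWV ?_
  rw [Set.mem_preimage, hM.map_smul]
  exact hn _ ⟨z, hz, rfl⟩

lemma LimitModel.exists_dyn (hM : LimitModel H L ι) (P : PingPong H D L) {η : ℝ} (hη : 0 < η)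
    (hball : ∀ b, ∃ z ∈ L b, Metric.closedBall z η ⊆ D b) {g : ℕ → gen H} (hesc : Escaping g) :
    ∃ φ : ℕ → ℕ, StrictMono φ ∧ ∃ a b : M, Dyn (fun n => (g (φ n) : SL)) (ι a) (ι b) := by
  have hesc' : Escaping fun n => (g n : SL) :=
    Tendsto.comp Subtype.val_injective.tendsto_cofinite hesc
  obtain ⟨φ, hφ, x, hx, y, hy, h⟩ := P.exists_dyn hη hball (fun n => (g n).2) hesc'
  obtain ⟨a, rfl⟩ := hM.exists_eq hx
  obtain ⟨b, rfl⟩ := hM.exists_eq hy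
  exact ⟨φ, hφ, a, b, h⟩

lemma LimitModel.isConvergenceAction (hM : LimitModel H L ι) (P : PingPong H D L) {η : ℝ}
    (hη : 0 < η) (hball : ∀ b, ∃ z ∈ L b, Metric.closedBall z η ⊆ D b)
    (hopp : ∀ z ∈ pingPongLimit H L, ∀ w ∈ pingPongLimit H L, z ≠ w → z.Opp w) :
    IsConvergenceAction (gen H) M := by
  refine ⟨⟨fun g => ?_⟩, fun g hg => ?_⟩
  · rw [hM.isEmbedding.continuous_iff]
    have h1 : ι ∘ (fun m => g • m) = (fun z => (g : SL) • z) ∘ ι := funext fun m => hM.map_smul g m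
    rw [h1]
    exact (continuous_const_smul (g : SL)).comp hM.isEmbedding.continuous
  · obtain ⟨φ, hφ, a, b, h⟩ := hM.exists_dyn P hη hball (g := g) (by
      rw [Escaping, ← Nat.cofinite_eq_atTop]; exact hg.tendsto_cofinite)
    exact ⟨φ, hφ, a, b, hM.convergesOffPoint hopp h⟩

/-- The limit in the compactification by the limit set is the attracting point. -/
lemma LimitModel.eq_of_convergesToPoint (hM : LimitModel H L ι)
    (hopp : ∀ z ∈ pingPongLimit H L, ∀ w ∈ pingPongLimit H L, z ≠ w → z.Opp w)
    (hthree : ∀ a b : M, ∃ c, c ≠ a ∧ c ≠ b) {g : ℕ → gen H} {m : M} (hg : ConvergesToPoint g m)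
    {φ : ℕ → ℕ} (hφ : StrictMono φ) {a b : M}
    (h : Dyn (fun n => (g (φ n) : SL)) (ι a) (ι b)) : a = m := by
  obtain ⟨ψ, hψ, y, hy⟩ := hg.2 φ hφ
  obtain ⟨c, hcb, hcy⟩ := hthree b y
  have h1 : Tendsto (fun n => ι (g (φ (ψ n)) • c)) atTop (𝓝 (ι a)) := by
    have := (h.comp hψ.tendsto_atTop).tendsto (tendsto_const_nhds (x := ι c))
      (hopp _ (hM.mem c) _ (hM.mem b) (hM.isEmbedding.injective.ne hcb))
    exact this.congr fun n => (hM.map_smul _ _).symm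
  have h2 : Tendsto (fun n => g (φ (ψ n)) • c) atTop (𝓝 m) := by
    refine tendsto_def.2 fun V hV => ?_
    filter_upwards [hy {c} isCompact_singleton (fun h => hcy h.symm) V hV] with n hn
    exact hn c rfl
  have h3 := (hM.isEmbedding.continuous.tendsto m).comp h2
  exact hM.isEmbedding.injective (tendsto_nhds_unique h1 h3)

lemma act_orthogonal (g : SL) (V : Line K d) : act g V.1ᗮ = (dual K d g • V).1ᗮ := by
  apply Submodule.eq_of_le_of_finrank_eq
  · rintro _ ⟨v, hv, rfl⟩
    rw [Submodule.mem_orthogonal]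
    rintro _ ⟨w, hw, rfl⟩
    rw [← inner_conj_symm, inner_dual, inner_conj_symm]
    exact (Submodule.mem_orthogonal _ _).1 hv w hw
  · rw [finrank_orthogonal_line]
    exact (Submodule.equivMapOfInjective _ (cl_injective g) V.1ᗮ).finrank_eq.symm.trans
      (finrank_orthogonal_line V)

/-- The limit set of a ping-pong group, as a set of flags, defines a boundary map. -/
theorem LimitModel.isAnosovBoundaryMap (hM : LimitModel H L ι) (P : PingPong H D L) {η : ℝ}
    (hη : 0 < η) (hball : ∀ b, ∃ z ∈ L b, Metric.closedBall z η ⊆ D b)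
    (hopp : ∀ z ∈ pingPongLimit H L, ∀ w ∈ pingPongLimit H L, z ≠ w → z.Opp w)
    (hthree : ∀ a b : M, ∃ c, c ≠ a ∧ c ≠ b) :
    IsAnosovBoundaryMap 1 (gen H).subtype fun m => ((ι m).1.1, (ι m).2.1ᗮ) where
  finrank_fst m := (ι m).1.2
  finrank_snd m := finrank_orthogonal_line _
  continuous := by
    have h1 := hM.isEmbedding.continuous
    exact (Line.continuous_val.comp (FlagPair.continuous_fst.comp h1)).prodMk
      (Line.continuous_orthogonal.comp (FlagPair.continuous_snd.comp h1))
  equivariant g m := by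
    rw [hM.map_smul, FlagPair.smul_fst, FlagPair.smul_snd, Line.smul_val, Subgroup.subtype_apply,
      act_orthogonal]
  transverse a b hab := Line.isCompl_orthogonal_iff.2
    (hopp _ (hM.mem a) _ (hM.mem b) (hM.isEmbedding.injective.ne hab)).1
  stronglyDynamicsPreserving g x y hx hy V hV hVy := by
    let V' : Line K d := ⟨V, hV⟩
    have hV' : ¬ V'.Perp (ι y).2 := Line.isCompl_orthogonal_iff.1 hVy
    have key : Tendsto (fun n => (g n : SL) • V') atTop (𝓝 (ι x).1) := by
      refine tendsto_of_subseq_tendsto fun ns hns => ?_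
      obtain ⟨φ, hφ, hnsφ⟩ := strictMono_subseq_of_tendsto_atTop hns
      have hesc : Escaping fun n => g (ns (φ n)) := hx.1.comp_strictMono hnsφ.tendsto_atTop
      obtain ⟨ψ, hψ, a, b, h⟩ := hM.exists_dyn P hη hball hesc
      have hmono : StrictMono fun n => ns (φ (ψ n)) := hnsφ.comp hψ
      have ha : a = x := hM.eq_of_convergesToPoint hopp hthree hx hmono h
      have hb : b = y := hM.eq_of_convergesToPoint hopp hthree hy hmono h.symm
      subst ha hb
      exact ⟨φ ∘ ψ, h.1.tendsto tendsto_const_nhds hV'⟩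
    exact ((Line.continuous_val.tendsto _).comp key)

end PingPongDynamics

end RelAnosov

namespace RelAnosov

/-! ### The combination theorem -/

section Combination

variable {K : Type*} [RCLike K] {d : ℕ}

local notation "SL" => Matrix.SpecialLinearGroup (Fin d) K

instance small_line : Small.{0} (Line K d) := by
  let f : Line K d → Set (Fin d → ℂ) := fun V =>
    (fun (v : EuclideanSpace K (Fin d)) i => toComplex K (v i)) '' (V.1 : Set _)
  have hinj : Function.Injective fun (v : EuclideanSpace K (Fin d)) i => toComplex K (v i) := by
    intro v w h
    ext i
    exact (toComplex K).injective (congrFun h i)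
  refine small_of_injective (f := f) fun V W h => ?_
  exact Subtype.ext (SetLike.coe_injective (hinj.image_injective h))

instance small_flagPair : Small.{0} (FlagPair K d) :=
  inferInstanceAs (Small.{0} (Line K d × Line K d))

lemma infinite_of_finiteIndex {G : Type*} [Group G] [Infinite G] (A : Subgroup G)
    [A.FiniteIndex] : Infinite A := by
  have h1 := A.card_mul_index
  rw [Nat.card_eq_zero_of_infinite (α := G)] at h1
  have h2 := (mul_eq_zero.1 h1).resolve_right Subgroup.FiniteIndex.index_ne_zero
  exact (Nat.card_eq_zero.1 h2).resolve_left (not_isEmpty_of_nonempty A)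

lemma exists_ne_of_three {M : Type*} {x y z : M} (hxy : x ≠ y) (hxz : x ≠ z) (hyz : y ≠ z)
    (a b : M) : ∃ c, c ≠ a ∧ c ≠ b := by
  by_contra! h
  rcases eq_or_ne x a with hx | hx
  · have hy : y ≠ a := fun e => hxy (hx.trans e.symm)
    have hz : z ≠ a := fun e => hxz (hx.trans e.symm)
    exact hyz ((h y hy).trans (h z hz).symm)
  rcases eq_or_ne y a with hy | hy
  · have hz : z ≠ a := fun e => hyz (hy.trans e.symm)
    exact hxz ((h x hx).trans (h z hz).symm)
  exact hxy ((h x hx).trans (h y hy).symm)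

lemma Dyn.not_isOfFinOrder {γ : SL} {z F₁ F₂ : FlagPair K d} (hγ : Dyn (fun n => γ ^ n) F₁ F₂)
    (hz : z.Opp F₂) (hne : z ≠ F₁) : ¬ IsOfFinOrder γ := by
  intro h
  obtain ⟨t, ht, htγ⟩ := isOfFinOrder_iff_pow_eq_one.1 h
  have h1 : Tendsto (fun n => t * n) atTop atTop :=
    tendsto_id.const_mul_atTop' ht
  have h2 := (hγ.comp h1).tendsto (tendsto_const_nhds (x := z)) hz
  refine hne (tendsto_nhds_unique (tendsto_const_nhds.congr fun n => ?_) h2)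
  rw [Function.comp, pow_mul, htγ, one_pow, one_smul]

/-- Every ping-pong of high powers of a proximal element with a parabolic group is relatively
Anosov. -/
theorem PingPong.isAnosovRelativeTo {γ : SL} {U : Subgroup SL} {F F₁ F₂ : FlagPair K d}
    {η : ℝ} {N : ℕ} (hN : 1 ≤ N)
    (P : PingPong (factors (γ ^ N) U) (balls F F₁ F₂ η) (poles F F₁ F₂))
    (hγ : Dyn (fun n => γ ^ n) F₁ F₂) (h₁₂ : F₁.Opp F₂) (hne : F₁ ≠ F₂)
    (hγ₁ : γ • F₁ = F₁) (hγ₂ : γ • F₂ = F₂)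
    (hη : 0 < η)
    (hopp : ∀ b, ∀ z ∈ balls F F₁ F₂ η b, ∀ w ∈ balls F F₁ F₂ η !b, z.Opp w)
    [Infinite U] (hfg : U.FG) :
    IsAnosovRelativeTo 1 {U.subgroupOf (gen (factors (γ ^ N) U))}
      (gen (factors (γ ^ N) U)).subtype := by
  have hF : F ∈ balls F F₁ F₂ η false := Metric.mem_closedBall_self hη.le
  have hF₁ : F₁ ∈ balls F F₁ F₂ η true := Or.inl (Metric.mem_closedBall_self hη.le)
  have hF₂ : F₂ ∈ balls F F₁ F₂ η true := Or.inr (Metric.mem_closedBall_self hη.le)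
  have hne₁ : F ≠ F₁ := fun h => Set.disjoint_left.1 (P.disjoint false) hF
    (h.symm.subst (motive := fun x => x ∈ balls F F₁ F₂ η true) hF₁)
  have hne₂ : F ≠ F₂ := fun h => Set.disjoint_left.1 (P.disjoint false) hF
    (h.symm.subst (motive := fun x => x ∈ balls F F₁ F₂ η true) hF₂)
  have hball : ∀ b, ∃ z ∈ poles F F₁ F₂ b, Metric.closedBall z η ⊆ balls F F₁ F₂ η b := by
    rintro (_ | _)
    · exact ⟨F, rfl, subset_rfl⟩
    · exact ⟨F₁, Or.inl rfl, Set.subset_union_left⟩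
  have hΛ : ∀ z ∈ pingPongLimit (factors (γ ^ N) U) (poles F F₁ F₂),
      ∀ w ∈ pingPongLimit (factors (γ ^ N) U) (poles F F₁ F₂), z ≠ w → z.Opp w := by
    intro z hz w hw hzw
    refine P.opp_of_ne (R := FlagPair.Opp) (fun _ _ h => h.symm)
      (fun _ _ _ => FlagPair.opp_smul) hopp ?_ hz hw hzw
    rintro (_ | _) z hz w hw h
    · exact absurd ((show z = F from hz).trans (show w = F from hw).symm) h
    · rcases hz with rfl | rfl <;> rcases hw with rfl | rfl
      · exact absurd rfl h
      · exact h₁₂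
      · exact h₁₂.symm
      · exact absurd rfl h
  have hpow : ∀ n, (γ ^ N) ^ n = γ ^ (N * n) := fun n => (pow_mul γ N n).symm
  have hpowt : Tendsto (fun n => N * n) atTop atTop := tendsto_id.const_mul_atTop' hN
  have hγN : Dyn (fun n => (γ ^ N) ^ n) F₁ F₂ := by
    simp only [hpow]
    exact hγ.comp hpowt
  have hlimit := fun b => PingPong.limit_subset_limitSet (H := factors (γ ^ N) U)
    (L := poles F F₁ F₂) b
  have hΛ₁ := hlimit true (Or.inl rfl : F₁ ∈ poles F F₁ F₂ true)
  have hΛ₂ := hlimit true (Or.inr rfl : F₂ ∈ poles F F₁ F₂ true)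
  have hΛ₀ := hlimit false (rfl : F ∈ poles F F₁ F₂ false)
  have hfix : ∀ x : FlagPair K d, γ • x = x → ∀ h ∈ factors (γ ^ N) U true, h • x = x := by
    intro x hx h hh
    have h1 : γ ∈ MulAction.stabilizer SL x := hx
    have h2 : Subgroup.zpowers (γ ^ N) ≤ MulAction.stabilizer SL x :=
      Subgroup.zpowers_le.2 (pow_mem h1 N)
    exact h2 hh
  have hPP : ParabolicPingPong (factors (γ ^ N) U) (balls F F₁ F₂ η) (poles F F₁ F₂) F F₁ F₂ :=
    { P with
      infinite := ‹Infinite U›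
      limit_false := rfl
      limit_true := rfl
      ne := hne
      torsionFree := by
        intro h hh h1 hfin
        obtain ⟨j, rfl⟩ := Subgroup.mem_zpowers_iff.1 hh
        obtain ⟨m, hm, hm1⟩ := isOfFinOrder_iff_zpow_eq_one.1 hfin
        have hj : j ≠ 0 := by rintro rfl; exact h1 (zpow_zero _)
        refine hγN.not_isOfFinOrder (hopp false F hF F₂ hF₂) hne₁ ?_
        exact isOfFinOrder_iff_zpow_eq_one.2 ⟨j * m, mul_ne_zero hj hm, by rw [zpow_mul, hm1]⟩
      fix₁ := hfix F₁ hγ₁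
      fix₂ := hfix F₂ hγ₂
      northSouth := by
        refine ⟨fun n => ((γ ^ N) ^ n)⁻¹, fun n => ?_, fun z hz hz₁ => ?_, fun z hz hz₂ => ?_⟩
        · exact inv_mem (pow_mem (Subgroup.mem_zpowers (γ ^ N)) n)
        · exact hγN.symm.tendsto tendsto_const_nhds (hΛ z hz _ hΛ₁ hz₁)
        · simp only [inv_inv]
          exact hγN.tendsto tendsto_const_nhds (hΛ z hz _ hΛ₂ hz₂) }
  obtain ⟨M, _, _, ι, hM⟩ := exists_limitModel (H := factors (γ ^ N) U) (poles F F₁ F₂)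
  have hthree : ∀ a b : M, ∃ c, c ≠ a ∧ c ≠ b := by
    obtain ⟨m₀, h₀⟩ := hM.exists_eq hΛ₀
    obtain ⟨m₁, h₁⟩ := hM.exists_eq hΛ₁
    obtain ⟨m₂, h₂⟩ := hM.exists_eq hΛ₂
    have h01 : m₀ ≠ m₁ := fun h => hne₁ (by rw [← h₀, ← h₁, h])
    have h02 : m₀ ≠ m₂ := fun h => hne₂ (by rw [← h₀, ← h₂, h])
    have h12 : m₁ ≠ m₂ := fun h => hne (by rw [← h₁, ← h₂, h])
    exact exists_ne_of_three h01 h02 h12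
  have hle : U ≤ gen (factors (γ ^ N) U) := fun u hu => mem_gen (b := false) hu
  have hequiv : U.subgroupOf (gen (factors (γ ^ N) U)) ≃* U := Subgroup.subgroupOfEquivOfLe hle
  have hUfg : Group.FG U := Group.fg_iff_subgroup_fg U |>.2 hfg
  refine ⟨⟨?_, Set.finite_singleton _, ?_, ?_⟩, M, _, _,
    hPP.isBowditchBoundary hM (hM.isConvergenceAction P hη hball hΛ), _,
    hM.isAnosovBoundaryMap P hη hball hΛ hthree⟩
  · rw [Group.fg_iff_subgroup_fg, gen_eq_sup]
    refine Subgroup.FG.sup ⟨{γ ^ N}, ?_⟩ hfg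
    rw [Finset.coe_singleton, ← Subgroup.zpowers_eq_closure]
    rfl
  · rintro _ rfl
    rw [← Group.fg_iff_subgroup_fg]
    exact Group.fg_of_surjective (f := hequiv.symm.toMonoidHom) hequiv.symm.surjective
  · rintro _ rfl
    exact Infinite.of_injective hequiv.symm hequiv.symm.injective

/-- A proximal element and a residually finite divergent group with a single limit flag have high
powers and finite-index subgroups that generate their free product, relatively Anosov. -/
theorem exists_isAnosovRelativeTo {γ : SL} {U : Subgroup SL} {F F₁ F₂ : FlagPair K d}
    (hγ : Dyn (fun n => γ ^ n) F₁ F₂) (h₁₂ : F₁.Opp F₂) (hne : F₁ ≠ F₂)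
    (hF : F.1.Perp F.2) (h1 : F.Opp F₁) (h2 : F.Opp F₂)
    (hU : ∀ u : ℕ → U, Escaping u → ∃ φ : ℕ → ℕ, StrictMono φ ∧
      Dyn (fun n => (u (φ n) : SL)) F F) (hUF : ∀ u ∈ U, u • F = F) [Infinite U]
    [Group.ResiduallyFinite U] [Group.FG U] :
    ∃ (N : ℕ) (U' Γ : Subgroup SL), 1 ≤ N ∧ U' ≤ U ∧ (U'.subgroupOf U).FiniteIndex ∧
      Γ = Subgroup.closure ({γ ^ N} ∪ (U' : Set SL)) ∧
      (∃ Φ : Monoid.Coprod (Subgroup.zpowers (γ ^ N)) U' ≃* Γ,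
        (∀ a : Subgroup.zpowers (γ ^ N), (Φ (Monoid.Coprod.inl a) : SL) = a) ∧
        (∀ u : U', (Φ (Monoid.Coprod.inr u) : SL) = u)) ∧
      IsAnosovRelativeTo 1 {U'.subgroupOf Γ} Γ.subtype := by
  obtain ⟨η, hη, hopp, hdis⟩ := exists_radius hF h1 h2
  have hF₀ : F ∈ balls F F₁ F₂ η false := Metric.mem_closedBall_self hη.le
  have hF₁ : F₁ ∈ balls F F₁ F₂ η true := Or.inl (Metric.mem_closedBall_self hη.le)
  have hF₂ : F₂ ∈ balls F F₁ F₂ η true := Or.inr (Metric.mem_closedBall_self hη.le)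
  have hγ₁ : γ • F₁ = F₁ := hγ.smul_eq h₁₂
  have hγ₂ : γ • F₂ = F₂ := by
    have h3 : Dyn (fun n => γ⁻¹ ^ n) F₂ F₁ := by
      simp only [inv_pow]
      exact hγ.symm
    exact (inv_smul_eq_iff.1 (h3.smul_eq h₁₂.symm)).symm
  have hW : balls F F₁ F₂ η false ∈ 𝓝 F := Metric.closedBall_mem_nhds F hη
  have hW₁ : balls F F₁ F₂ η true ∈ 𝓝 F₁ :=
    mem_of_superset (Metric.closedBall_mem_nhds F₁ hη) Set.subset_union_left
  have hW₂ : balls F F₁ F₂ η true ∈ 𝓝 F₂ :=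
    mem_of_superset (Metric.closedBall_mem_nhds F₂ hη) Set.subset_union_right
  obtain ⟨n₀, hn₀⟩ := exists_forall_squeezes hγ (D := balls F F₁ F₂ η false)
    Metric.isClosed_closedBall (fun z hz => hopp false z hz F₁ hF₁)
    (fun z hz => hopp false z hz F₂ hF₂) hW₁ hW₂ (one_half_pos (α := ℝ))
  have hfin := finite_not_squeezes hU (D := balls F F₁ F₂ η true)
    (Metric.isClosed_closedBall.union Metric.isClosed_closedBall)
    (fun z hz => hopp true z hz F hF₀) hW (one_half_pos (α := ℝ))
  obtain ⟨A, hA, hAS⟩ := exists_finiteIndex_disjoint hfin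
  have hAinf : Infinite A := infinite_of_finiteIndex A
  have hAfg : Group.FG A := Subgroup.fg_of_index_ne_zero A
  have hequiv : A ≃* A.map U.subtype :=
    A.equivMapOfInjective U.subtype U.subtype_injective
  have hU'inf : Infinite (A.map U.subtype) := Infinite.of_injective hequiv hequiv.injective
  have hU'fg : (A.map U.subtype).FG := (Group.fg_iff_subgroup_fg _).1
    (Group.fg_of_surjective (f := hequiv.toMonoidHom) hequiv.surjective)
  have hU'le : A.map U.subtype ≤ U := by
    rintro _ ⟨u, -, rfl⟩
    exact u.2
  have P := pingPong_factors hγ hne hγ₁ hγ₂ hU hUF hη hopp hdis hn₀ (Nat.le_succ n₀) hU'le (by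
    rintro _ ⟨u, hu, rfl⟩ hu1
    by_contra hcon
    exact hu1 (by rw [hAS u hu hcon, map_one]))
  refine ⟨n₀ + 1, A.map U.subtype, gen (factors (γ ^ (n₀ + 1)) (A.map U.subtype)), by omega,
    hU'le, ?_, ?_, ?_, ?_⟩
  · rw [Subgroup.subgroupOf, Subgroup.comap_map_eq_self_of_injective U.subtype_injective]
    exact hA
  · rw [gen_eq_sup, Subgroup.closure_union, Subgroup.closure_eq, ← Subgroup.zpowers_eq_closure]
    rfl
  · exact exists_coprod_mulEquiv fun b e l hl => P.prod_ne_one hl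
  · exact P.isAnosovRelativeTo (by omega) hγ h₁₂ hne hγ₁ hγ₂ hη hopp hU'fg

end Combination

end RelAnosov

theorem proposition13p2 {K : Type*} [RCLike K] {d : ℕ} (hd : 2 ≤ d)
    (γ : Matrix.SpecialLinearGroup (Fin d) K) (hγ : IsBiproximal 1 γ)
    (U : Subgroup (Matrix.SpecialLinearGroup (Fin d) K))
    (hdiscrete : DiscreteTopology U)
    (hunipotent : ∀ u ∈ U, IsWeaklyUnipotent u)
    (hdivergent : IsDivergent 1 U)
    (F_U : Subspaces K d × Subspaces K d)
    (hlimit : limitSet 1 U = {F_U})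
    (hplus : Transverse F_U (attractingFlag γ))
    (hminus : Transverse F_U (attractingFlag γ⁻¹)) :
    ∃ (N : ℕ) (U' Γ : Subgroup (Matrix.SpecialLinearGroup (Fin d) K)),
      1 ≤ N ∧ U' ≤ U ∧ (U'.subgroupOf U).FiniteIndex ∧
      Γ = Subgroup.closure ({γ ^ N} ∪ (U' : Set (Matrix.SpecialLinearGroup (Fin d) K))) ∧
      (∃ Φ : Monoid.Coprod (Subgroup.zpowers (γ ^ N)) U' ≃* Γ,
        (∀ a : Subgroup.zpowers (γ ^ N),
          (Φ (Monoid.Coprod.inl a) : Matrix.SpecialLinearGroup (Fin d) K) = a) ∧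
        (∀ u : U', (Φ (Monoid.Coprod.inr u) : Matrix.SpecialLinearGroup (Fin d) K) = u)) ∧
      IsAnosovRelativeTo 1 {U'.subgroupOf Γ} Γ.subtype := by
  obtain ⟨F₁, F₂, hF₁, hF₂, h₁₂, hγdyn⟩ := hγ.exists_dyn hd
  have hmem : F_U ∈ limitSet 1 U := by rw [hlimit]; rfl
  obtain ⟨⟨hr₁, hr₂, -⟩, w, hw, -⟩ := hmem
  obtain ⟨F, hF⟩ := exists_isPairOf hd hr₁ hr₂
  have hFF₁ : F.Opp F₁ := (hF.transverse_iff hF₁).1 hplus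
  have hFF₂ : F.Opp F₂ := (hF.transverse_iff hF₂).1 hminus
  have hdyn : ∀ u : ℕ → U, Escaping u → ∃ φ : ℕ → ℕ, StrictMono φ ∧
      Dyn (fun n => (u (φ n) : Matrix.SpecialLinearGroup (Fin d) K)) F F :=
    fun u hu => exists_dyn_of_escaping hd hdivergent hlimit hF hu
  have hfix : ∀ u ∈ U, u • F = F := fun u hu =>
    smul_eq_of_limitSet hd hdivergent hlimit hF hFF₁.symm hu
  obtain ⟨φ, -, hwF⟩ := hdyn w hw
  -- a finite group has no escaping sequences
  have hinf : Infinite U := by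
    by_contra hcon
    rw [not_infinite_iff_finite] at hcon
    rw [Escaping, Filter.cofinite_eq_bot] at hw
    exact (map_neBot (m := w) (f := atTop)).ne (le_bot_iff.1 hw)
  have hfg : Group.FG U := fg_of_weaklyUnipotent hd U hdiscrete hunipotent
  have hrf : Group.ResiduallyFinite U := residuallyFinite_of_fg U hfg
  exact exists_isAnosovRelativeTo hγdyn h₁₂ (ne_of_opp h₁₂ (hγdyn.perp_left hd))
    (hwF.perp_left hd) hFF₁ hFF₂ hdyn hfix
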